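/- Let $\kappa>0$ and $c>2\kappa$, and let $Q$ be the solitary wave of speed $c$ of the Camassa–Holm equation $$(1-\partial_x^2)u_t+3uu_x+2\kappa u_x-2u_xu_{xx}-uu_{xxx}=0,$$ i.e. $Q\in C^3(\mathbb R)$ is real-valued, $Q\not\equiv 0$, $Q(x)\to0$ as $|x|\to\infty$ and $u(t,x)=Q(x-ct)$ is a solution, with the translation fixed so that $Q$ is even. Put $$M=\partial_x(Q-c)\partial_x+Q''-3Q+c-2\kappa,\qquad L=-\partial_xM\partial_x,\qquad \mathcal L=\begin{pmatrix}0&L\\1&0\end{pmatrix},$$ and let $\lambda<0$ be the negative eigenvalue of $L\colon H^4(\mathbb R)\subset L^2(\mathbb R)\to L^2(\mathbb R)$. Let $$X=L^2_{\rm odd}(\mathbb R)\times H^2_{\rm odd}(\mathbb R),\qquad Y=H^2_{\rm odd}(\mathbb R)\times H^4_{\rm odd}(\mathbb R)$$ (complex-valued odd functions) with norms $\|W\|_X=\|W_1\|_{L^2}+\|W_2\|_{H^2}$ and $\|W\|_Y=\|W_1\|_{H^2}+\|W_2\|_{H^4}$, where $\|f\|_{H^k}^2=\sum_{j=0}^k\|\partial_x^jf\|_{L^2}^2$.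 Regard $\mathcal L$ as an unbounded operator on $X$ with domain $Y$; in particular, $\mathcal L$ maps $Y$ into $X$. Then there is a constant $C$ such that for all integers $n$ with $|n|>1$ the number $\mathrm i n\sqrt{|\lambda|}$ belongs to the resolvent set of $\mathcal L$ and $$\big\|(\mathcal L-\mathrm i n\sqrt{|\lambda|})^{-1}\big\|_{X\to X}\le \frac{C}{\sqrt{|n|}},\qquad \big\|(\mathcal L-\mathrm i n\sqrt{|\lambda|})^{-1}\big\|_{X\to Y}\le C .$$ Consequently $\mathcal L$ satisfies the resolvent hypothesis of the Lyapunov–Iooss theorem with $\omega_0=\sqrt{|\lambda|}$: as $|n|\to\infty$, $\|(\mathcal L-\mathrm i n\omega_0)^{-1}\|_{X\to X}=o(1)$ and $\|(\mathcal L-\mathrm i n\omega_0)^{-1}\|_{X\to D(\mathcal L)}=O(1)$, where $D(\mathcal L)$ carries the graph norm. -/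

import Mathlib

open MeasureTheory Filter Topology TemperedDistribution
open scoped SchwartzMap ContDiff

namespace CHKP

noncomputable section

/-! ## The Camassa-Holm equation and its solitary waves -/

/-- `u = u(t, x)` satisfies the Camassa-Holm equation
`(1 - ∂ₓ²) uₜ + 3 u uₓ + 2 κ uₓ - 2 uₓ uₓₓ - u uₓₓₓ = 0` at every point. -/
def SolvesCamassaHolm (κ : ℝ) (u : ℝ → ℝ → ℝ) : Prop :=
  ∀ t x : ℝ,
    (deriv (fun s => u s x) t - iteratedDeriv 2 (fun z => deriv (fun s => u s z) t) x)
      + 3 * u t x * deriv (u t) x + 2 * κ * deriv (u t) x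
      - 2 * deriv (u t) x * iteratedDeriv 2 (u t) x
      - u t x * iteratedDeriv 3 (u t) x = 0

/-- `Q` is the profile of a (nontrivial, classical) solitary wave `u(t, x) = Q (x - c t)` of the
Camassa-Holm equation. -/
structure IsSolitaryWave (κ c : ℝ) (Q : ℝ → ℝ) : Prop where
  contDiff : ContDiff ℝ 3 Q
  nontrivial : Q ≠ 0
  decay : Tendsto Q (cocompact ℝ) (𝓝 0)
  solves : SolvesCamassaHolm κ (fun t x => Q (x - c * t))

/-! ## Function spaces -/

/-- Complex-valued `L²(ℝ)`. -/
abbrev L2 : Type := Lp ℂ 2 (volume : Measure ℝ)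

/-- The reflection `f ↦ f (-·)` on `L²(ℝ)`. -/
def reflect : L2 →ₗ[ℂ] L2 :=
  Lp.compMeasurePreservingₗ ℂ (fun x : ℝ => -x) (Measure.measurePreserving_neg volume)

/-- `L²_odd(ℝ)`, with the `L²` norm. -/
def oddL2 : Submodule ℂ L2 where
  carrier := {f | reflect f = -f}
  add_mem' := by
    intro f g hf hg
    simp only [Set.mem_ofPred_eq, map_add] at *
    rw [hf, hg, neg_add]
  zero_mem' := by simp
  smul_mem' := by
    intro a f hf
    simp only [Set.mem_ofPred_eq, map_smul] at *
    rw [hf, smul_neg]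

theorem mem_oddL2_iff (f : L2) : f ∈ oddL2 ↔ ∀ᵐ x : ℝ, f (-x) = -f x := by
  have h1 := Lp.coeFn_compMeasurePreserving f (Measure.measurePreserving_neg (volume : Measure ℝ))
  have h2 := Lp.coeFn_neg f
  change reflect f = -f ↔ _
  have h3 : reflect f = Lp.compMeasurePreserving (fun x : ℝ => -x)
    (Measure.measurePreserving_neg volume) f := rfl
  rw [h3, Lp.ext_iff]
  constructor
  · intro h
    filter_upwards [h, h1, h2] with x a b d
    rw [b, d] at a
    simpa using a
  · intro h
    filter_upwards [h, h1, h2] with x a b d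
    rw [b, d]
    simpa using a

/-- The submodule of odd functions in the Sobolev space `H^k(ℝ)`. -/
def oddSobolev (k : ℕ) : Submodule ℂ L2 where
  carrier := {f | MemSobolev (k : ℝ) 2 (f : 𝓢'(ℝ, ℂ)) ∧ f ∈ oddL2}
  add_mem' := by
    rintro f g ⟨hf, hf'⟩ ⟨hg, hg'⟩
    refine ⟨?_, oddL2.add_mem hf' hg'⟩
    have h := hf.add hg
    rwa [← Lp.toTemperedDistributionCLM_apply, ← Lp.toTemperedDistributionCLM_apply,
      ← map_add, Lp.toTemperedDistributionCLM_apply] at h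
  zero_mem' := by
    refine ⟨?_, oddL2.zero_mem⟩
    rw [← Lp.toTemperedDistributionCLM_apply, map_zero]
    exact memSobolev_fun_zero ℝ ℂ _ _
  smul_mem' := by
    rintro a f ⟨hf, hf'⟩
    refine ⟨?_, oddL2.smul_mem a hf'⟩
    have h := hf.smul a
    rwa [← Lp.toTemperedDistributionCLM_apply, ← map_smul,
      Lp.toTemperedDistributionCLM_apply] at h

theorem toDistribution_injective :
    Function.Injective (fun f : L2 => (f : 𝓢'(ℝ, ℂ))) := by
  intro f g h
  have hk := Lp.ker_toTemperedDistributionCLM_eq_bot (F := ℂ) (μ := (volume : Measure ℝ)) (p := 2)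
  exact LinearMap.ker_eq_bot.mp hk h

/-- The `j`-th distributional derivative of an `H^k` function, `j ≤ k`, is an `L²` function. -/
theorem exists_deriv_rep (j k : ℕ) (hjk : j ≤ k) (T : 𝓢'(ℝ, ℂ)) (hT : MemSobolev (k : ℝ) 2 T) :
    ∃ g : L2, (derivCLM ℂ)^[j] T = (g : 𝓢'(ℝ, ℂ)) := by
  have key : ∀ j : ℕ, MemSobolev ((k : ℝ) - j) 2 ((derivCLM ℂ)^[j] T) := by
    intro j
    induction j with
    | zero => simpa using hT
    | succ j ih =>
      rw [Function.iterate_succ_apply']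
      have h := ih.lineDerivOp (m := (1 : ℝ))
      have e : (k : ℝ) - j - 1 = (k : ℝ) - (j + 1 : ℕ) := by push_cast; ring
      rw [e] at h
      exact h
  refine memSobolev_zero_iff.mp ((key j).mono ?_)
  have : (j : ℝ) ≤ k := by exact_mod_cast hjk
  linarith

/-- `H^k_odd(ℝ)`, as a type of its own since it carries the `H^k` norm and not the `L²` norm. -/
def HOdd (k : ℕ) : Type := oddSobolev k

instance (k : ℕ) : AddCommGroup (HOdd k) := inferInstanceAs (AddCommGroup (oddSobolev k))
instance (k : ℕ) : Module ℂ (HOdd k) := inferInstanceAs (Module ℂ (oddSobolev k))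

/-- The underlying `L²` function of an element of `H^k_odd`. -/
def HOdd.toL2 (k : ℕ) : HOdd k →ₗ[ℂ] L2 := (oddSobolev k).subtype

theorem HOdd.toL2_injective (k : ℕ) : Function.Injective (HOdd.toL2 k) :=
  (oddSobolev k).injective_subtype

theorem HOdd.toL2_mem (k : ℕ) (f : HOdd k) : HOdd.toL2 k f ∈ oddSobolev k := Subtype.property f

/-- The distribution of an element of `H^k_odd`. -/
def HOdd.toDist (k : ℕ) : HOdd k →ₗ[ℂ] 𝓢'(ℝ, ℂ) :=
  (Lp.toTemperedDistributionCLM ℂ (volume : Measure ℝ) 2).toLinearMap ∘ₗ HOdd.toL2 k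

/-- The `j`-th weak derivative `∂ₓʲ f ∈ L²(ℝ)` of `f ∈ H^k_odd(ℝ)`, for `j ≤ k`. -/
def HOdd.wderiv (k : ℕ) (j : Fin (k + 1)) (f : HOdd k) : L2 :=
  (exists_deriv_rep j k (Nat.lt_succ_iff.mp j.2) (HOdd.toDist k f) (HOdd.toL2_mem k f).1).choose

theorem HOdd.wderiv_spec (k : ℕ) (j : Fin (k + 1)) (f : HOdd k) :
    (derivCLM ℂ)^[j] (HOdd.toDist k f) = (HOdd.wderiv k j f : 𝓢'(ℝ, ℂ)) :=
  (exists_deriv_rep j k (Nat.lt_succ_iff.mp j.2) (HOdd.toDist k f) (HOdd.toL2_mem k f).1).choose_spec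

theorem iterate_derivCLM_eq (j : ℕ) :
    ∃ D : 𝓢'(ℝ, ℂ) →ₗ[ℂ] 𝓢'(ℝ, ℂ), ∀ T, (derivCLM ℂ)^[j] T = D T := by
  induction j with
  | zero => exact ⟨LinearMap.id, fun T => rfl⟩
  | succ j ih =>
    obtain ⟨D, hD⟩ := ih
    exact ⟨(derivCLM ℂ).toLinearMap ∘ₗ D, fun T => by rw [Function.iterate_succ_apply', hD]; rfl⟩

/-- All weak derivatives `(f, ∂ₓ f, …, ∂ₓᵏ f)`, in the Hilbert sum of `k + 1` copies of `L²`. -/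
def HOdd.jet (k : ℕ) : HOdd k →ₗ[ℂ] PiLp 2 (fun _ : Fin (k + 1) => L2) where
  toFun f := WithLp.toLp 2 (fun j => HOdd.wderiv k j f)
  map_add' := by
    intro f g
    ext1 j
    apply toDistribution_injective
    obtain ⟨D, hD⟩ := iterate_derivCLM_eq j
    change ((HOdd.wderiv k j (f + g) : L2) : 𝓢'(ℝ, ℂ)) =
      Lp.toTemperedDistributionCLM ℂ volume 2 (HOdd.wderiv k j f + HOdd.wderiv k j g)
    rw [map_add, Lp.toTemperedDistributionCLM_apply, Lp.toTemperedDistributionCLM_apply,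
      ← HOdd.wderiv_spec, ← HOdd.wderiv_spec, ← HOdd.wderiv_spec, hD, hD, hD, map_add, map_add]
  map_smul' := by
    intro a f
    ext1 j
    apply toDistribution_injective
    obtain ⟨D, hD⟩ := iterate_derivCLM_eq j
    change ((HOdd.wderiv k j (a • f) : L2) : 𝓢'(ℝ, ℂ)) =
      Lp.toTemperedDistributionCLM ℂ volume 2 (a • HOdd.wderiv k j f)
    rw [map_smul, Lp.toTemperedDistributionCLM_apply,
      ← HOdd.wderiv_spec, ← HOdd.wderiv_spec, hD, hD, map_smul, map_smul]

theorem HOdd.jet_injective (k : ℕ) : Function.Injective (HOdd.jet k) := by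
  intro f g h
  have h0 : HOdd.wderiv k 0 f = HOdd.wderiv k 0 g :=
    congrArg (fun v : PiLp 2 (fun _ : Fin (k + 1) => L2) => v 0) h
  apply HOdd.toL2_injective
  apply toDistribution_injective
  have hf := HOdd.wderiv_spec k 0 f
  have hg := HOdd.wderiv_spec k 0 g
  rw [h0, ← hg] at hf
  exact hf

/-- `H^k_odd(ℝ)` with the usual norm, see `HOdd.norm_eq`. -/
instance (k : ℕ) : NormedAddCommGroup (HOdd k) :=
  NormedAddCommGroup.induced (HOdd k) (PiLp 2 (fun _ : Fin (k + 1) => L2)) (HOdd.jet k)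
    (HOdd.jet_injective k)

instance (k : ℕ) : NormedSpace ℂ (HOdd k) :=
  NormedSpace.induced ℂ (HOdd k) (PiLp 2 (fun _ : Fin (k + 1) => L2)) (HOdd.jet k)

theorem HOdd.norm_eq (k : ℕ) (f : HOdd k) :
    ‖f‖ = Real.sqrt (∑ j : Fin (k + 1), ‖HOdd.wderiv k j f‖ ^ 2) := by
  change ‖HOdd.jet k f‖ = _
  rw [PiLp.norm_eq_of_L2]
  rfl

/-- The inclusion `H^k_odd ⊆ L²_odd`. -/
def HOdd.toOddL2 (k : ℕ) : HOdd k →ₗ[ℂ] oddL2 :=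
  (HOdd.toL2 k).codRestrict oddL2 (fun f => (HOdd.toL2_mem k f).2)

theorem HOdd.toL2_mem_of_le (k m : ℕ) (h : k ≤ m) (f : HOdd m) :
    HOdd.toL2 m f ∈ oddSobolev k :=
  ⟨(HOdd.toL2_mem m f).1.mono (by exact_mod_cast h), (HOdd.toL2_mem m f).2⟩

/-- The inclusion `H^m_odd ⊆ H^k_odd` for `k ≤ m`. -/
def HOdd.incl (k m : ℕ) (h : k ≤ m) : HOdd m →ₗ[ℂ] HOdd k :=
  (HOdd.toL2 m).codRestrict (oddSobolev k) (HOdd.toL2_mem_of_le k m h)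

theorem HOdd.toOddL2_injective (k : ℕ) : Function.Injective (HOdd.toOddL2 k) := by
  intro f g h
  exact HOdd.toL2_injective k (congrArg (oddL2.subtype) h)

theorem HOdd.toL2_incl (k m : ℕ) (hkm : k ≤ m) (f : HOdd m) :
    HOdd.toL2 k (HOdd.incl k m hkm f) = HOdd.toL2 m f := by
  exact LinearMap.codRestrict_apply (h := HOdd.toL2_mem_of_le k m hkm) (oddSobolev k) (HOdd.toL2 m) f

theorem HOdd.incl_injective (k m : ℕ) (hkm : k ≤ m) : Function.Injective (HOdd.incl k m hkm) := by
  intro f g h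
  have e := congrArg (HOdd.toL2 k) h
  rw [HOdd.toL2_incl, HOdd.toL2_incl] at e
  exact HOdd.toL2_injective m e

/-- `X = L²_odd × H²_odd` with norm `‖W₁‖_{L²} + ‖W₂‖_{H²}`. -/
abbrev X : Type := WithLp 1 (oddL2 × HOdd 2)

/-- `Y = H²_odd × H⁴_odd` with norm `‖W₁‖_{H²} + ‖W₂‖_{H⁴}`. -/
abbrev Y : Type := WithLp 1 (HOdd 2 × HOdd 4)

/-- The inclusion `Y ⊆ X`. -/
def inclYX : Y →ₗ[ℂ] X where
  toFun Z := WithLp.toLp 1 (HOdd.toOddL2 2 Z.fst, HOdd.incl 2 4 (by norm_num) Z.snd)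
  map_add' := by
    intro Z Z'
    simp only [WithLp.add_fst, WithLp.add_snd, map_add]
    rfl
  map_smul' := by
    intro a Z
    simp only [WithLp.smul_fst, WithLp.smul_snd, map_smul]
    rfl

/-! ## The operators -/

/-- `M = ∂ₓ (Q - c) ∂ₓ + Q'' - 3 Q + c - 2 κ`, acting on tempered distributions. (For a solitary
wave `Q` and `κ > 0` the coefficients are smooth with bounded derivatives of all orders.) -/
def opM (κ c : ℝ) (Q : ℝ → ℝ) : 𝓢'(ℝ, ℂ) →L[ℂ] 𝓢'(ℝ, ℂ) :=
  derivCLM ℂ ∘L smulLeftCLM ℂ (fun x : ℝ => ((Q x - c : ℝ) : ℂ)) ∘L derivCLM ℂ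
    + smulLeftCLM ℂ (fun x : ℝ => ((iteratedDeriv 2 Q x - 3 * Q x + c - 2 * κ : ℝ) : ℂ))

/-- `L = -∂ₓ M ∂ₓ`, acting on tempered distributions. -/
def opL (κ c : ℝ) (Q : ℝ → ℝ) : 𝓢'(ℝ, ℂ) →L[ℂ] 𝓢'(ℝ, ℂ) :=
  -(derivCLM ℂ ∘L opM κ c Q ∘L derivCLM ℂ)

/-- `ν` is an eigenvalue of `L : H⁴(ℝ) ⊆ L²(ℝ) → L²(ℝ)`. -/
def IsEigenvalueL (κ c : ℝ) (Q : ℝ → ℝ) (ν : ℝ) : Prop :=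
  ∃ ψ : L2, MemSobolev 4 2 (ψ : 𝓢'(ℝ, ℂ)) ∧ ψ ≠ 0 ∧
    opL κ c Q (ψ : 𝓢'(ℝ, ℂ)) = (ν : ℂ) • (ψ : 𝓢'(ℝ, ℂ))

/-- The graph of `𝓛 = (0, L; 1, 0)`: pairs `(W, V)` with `W ∈ Y`, `V ∈ X`,
`V₁ = L W₂` and `V₂ = W₁`. -/
def graphCurlyL (κ c : ℝ) (Q : ℝ → ℝ) : Submodule ℂ (X × X) where
  carrier := {p | ∃ Z : Y, inclYX Z = p.1 ∧
    ((p.2.fst : L2) : 𝓢'(ℝ, ℂ)) = opL κ c Q (HOdd.toDist 4 Z.snd) ∧ p.2.snd = Z.fst}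
  add_mem' := by
    rintro ⟨W, V⟩ ⟨W', V'⟩ ⟨Z, h1, h2, h3⟩ ⟨Z', h1', h2', h3'⟩
    refine ⟨Z + Z', ?_, ?_, ?_⟩
    · exact (map_add inclYX Z Z').trans (congrArg₂ (· + ·) h1 h1')
    · simp only [WithLp.add_snd, map_add]
      rw [← h2, ← h2']
      exact map_add (Lp.toTemperedDistributionCLM ℂ (volume : Measure ℝ) 2) (V.fst : L2)
        (V'.fst : L2)
    · exact congrArg₂ (· + ·) h3 h3'
  zero_mem' := by
    refine ⟨0, map_zero _, ?_, rfl⟩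
    simp only [WithLp.zero_snd, map_zero]
    exact map_zero (Lp.toTemperedDistributionCLM ℂ (volume : Measure ℝ) 2)
  smul_mem' := by
    rintro a ⟨W, V⟩ ⟨Z, h1, h2, h3⟩
    refine ⟨a • Z, ?_, ?_, ?_⟩
    · exact (map_smul inclYX a Z).trans (congrArg (a • ·) h1)
    · simp only [WithLp.smul_snd, map_smul]
      rw [← h2]
      exact map_smul (Lp.toTemperedDistributionCLM ℂ (volume : Measure ℝ) 2) a (V.fst : L2)
    · exact congrArg (a • ·) h3

/-- The unbounded operator `𝓛` on `X` whose graph is `graphCurlyL`, see `graph_curlyL`. -/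
def curlyL (κ c : ℝ) (Q : ℝ → ℝ) : X →ₗ.[ℂ] X := (graphCurlyL κ c Q).toLinearPMap

theorem inclYX_injective : Function.Injective inclYX := by
  intro Z Z' h
  have e1 : Z.fst = Z'.fst :=
    HOdd.toOddL2_injective 2 (congrArg (fun W : X => W.fst) h)
  have e2 : Z.snd = Z'.snd :=
    HOdd.incl_injective 2 4 (by norm_num) (congrArg (fun W : X => W.snd) h)
  exact (WithLp.ofLp_injective 1) (Prod.ext e1 e2)

theorem graph_curlyL (κ c : ℝ) (Q : ℝ → ℝ) : (curlyL κ c Q).graph = graphCurlyL κ c Q := by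
  apply Submodule.toLinearPMap_graph_eq
  rintro ⟨W, V⟩ ⟨Z, h1, h2, h3⟩ hW
  have hZ : Z = 0 := inclYX_injective (by rw [h1, map_zero]; exact hW)
  subst hZ
  have e1 : V.fst = 0 := by
    apply Subtype.ext
    apply toDistribution_injective
    simp only [WithLp.zero_snd, map_zero] at h2
    refine h2.trans ?_
    exact (map_zero (Lp.toTemperedDistributionCLM ℂ (volume : Measure ℝ) 2)).symm
  exact (WithLp.ofLp_injective 1) (Prod.ext e1 h3)

/-! ## Resolvents of unbounded operators -/

section Resolvent

variable {E : Type*} [NormedAddCommGroup E] [NormedSpace ℂ E]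

/-- `R = (A - μ)⁻¹` as a bounded operator on `E`; its existence means `μ ∈ ρ(A)`. -/
def IsResolvent (A : E →ₗ.[ℂ] E) (μ : ℂ) (R : E →L[ℂ] E) : Prop :=
  (∀ V : E, ∃ h : R V ∈ A.domain, A ⟨R V, h⟩ - μ • R V = V) ∧
    ∀ W : A.domain, R (A W - μ • (W : E)) = W

/-- The resolvent hypothesis of the Lyapunov-Iooss theorem for `A` and the frequency `ω₀`:
`‖(A - i n ω₀)⁻¹‖_{E → E} = o(1)` and `‖(A - i n ω₀)⁻¹‖_{E → D(A)} = O(1)` as `|n| → ∞`, where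
`i n ω₀ ∈ ρ(A)` for all integers `|n| > 1` and `D(A)` carries the graph norm. -/
def LyapunovIoossResolventHypothesis (A : E →ₗ.[ℂ] E) (ω₀ : ℝ) : Prop :=
  ∃ R : ℤ → E →L[ℂ] E,
    (∀ n : ℤ, 1 < |n| → IsResolvent A (Complex.I * n * ω₀) (R n)) ∧
    Tendsto (fun n => ‖R n‖) cofinite (𝓝 0) ∧
    ∃ C : ℝ, ∀ᶠ n : ℤ in cofinite, ∀ V : E, ∃ h : R n V ∈ A.domain,
      ‖R n V‖ + ‖A ⟨R n V, h⟩‖ ≤ C * ‖V‖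

end Resolvent

end

end CHKP

open scoped InnerProductSpace

/-! Write `p = c - Q` and `q = Q'' - 3Q + c - 2κ`, so that `L = ∂²p∂² - ∂q∂`, with form `B(u,u) = ∫
p|u''|² + q|u'|²`. If `(W₁, W₂)` solves `(𝓛 - iμ)W = V`, then eliminating `W₁ = V₂ + iμW₂` leaves
the scalar equation `LW₂ + μ²W₂ = V₁ + iμV₂`. Everything rests on the lower bound `L ≥ λ`: it makes
`L + μ²` invertible with `μ² + λ ≥ (3/4)μ²` as soon as `μ² ≥ 4|λ|`, which for `μ = n√|λ|` means `|n|
≥ 2`.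

The lower bound. Differentiating the profile equation gives `MQ' = 0`, and the first integrals show
that `Q'` vanishes only at the crest `0`, where `Q'' < 0`. On each half line Jacobi's identity
`p|g'|² + q|g|² = p|g' - (Q''/Q')g|² + (pQ''|g|²/Q')'` makes the form of `M` nonnegative on
functions with `g(0) = 0`. This is one linear condition on `g = u'`, so `B` has at most one negative
direction (`IsSolitaryWave.formB_mul_le`); an eigenvector for `λ < 0` occupies it, whence `B(u,u) ≥
λ‖u‖²` (`IsSolitaryWave.le_formB`).

Solvability. By elliptic regularity (`memSobolev_four_of_elliptic`) the `L²` functions with `L²`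
image lie in `H⁴`. The lower bound gives injectivity and closed range; an element orthogonal to the
range is, after conjugation, a distributional solution of the homogeneous equation, hence zero
(`IsSolitaryWave.rangeL_eq_top`). Even coefficients and uniqueness keep the solution odd.

The estimate (`IsSolitaryWave.exists_resolvent_bound`). The equation is paired with `Lu`, not with
`u`, where `u = W₂`: `‖Lu‖² + μ²B(u,u) = ⟨Lu,V₁⟩ + iμB(u,V₂)`. Since `B` is continuous on `H²` and
coercive there up to an `L²` error, this bounds `‖Lu‖` and `|μ|‖u‖_{H²}` by `‖V‖_X`. The `X → X`
bound thus decays like `1/|n|`, faster than the required `1/√|n|`. -/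

namespace CHKP

/-! ### The profile equation and its first integrals. -/

/-- A differentiable function with a limit at `+∞` has derivative tending to zero along a
sequence. -/
theorem exists_seq_deriv_tendsto_zero {f : ℝ → ℝ} (hf : Differentiable ℝ f) {a : ℝ}
    (h : Tendsto f atTop (𝓝 a)) :
    ∃ x : ℕ → ℝ, Tendsto x atTop atTop ∧ Tendsto (fun n => deriv f (x n)) atTop (𝓝 0) := by
  have H : ∀ n : ℕ, ∃ y : ℝ, (n : ℝ) < y ∧ deriv f y = f (n + 1) - f n := by
    intro n
    obtain ⟨y, hy, e⟩ := exists_deriv_eq_slope f (a := (n : ℝ)) (b := n + 1) (by linarith)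
      hf.continuous.continuousOn hf.differentiableOn
    exact ⟨y, hy.1, by rw [e]; simp⟩
  choose x hx hx' using H
  refine ⟨x, tendsto_atTop_mono (fun n => (hx n).le) tendsto_natCast_atTop_atTop, ?_⟩
  simp_rw [hx']
  have h1 := h.comp (tendsto_natCast_atTop_atTop (R := ℝ))
  have h2 := h.comp ((tendsto_natCast_atTop_atTop (R := ℝ)).atTop_add
    (tendsto_const_nhds (x := (1 : ℝ))))
  simpa using h2.sub h1

theorem exists_const_of_hasDerivAt_zero {f : ℝ → ℝ} (h : ∀ x, HasDerivAt f 0 x) :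
    ∃ a, ∀ x, f x = a :=
  ⟨f 0, fun x => is_const_of_deriv_eq_zero (fun y => (h y).differentiableAt)
    (fun y => (h y).deriv) x 0⟩

namespace IsSolitaryWave

variable {κ c : ℝ} {Q : ℝ → ℝ}

theorem hasDerivAt (hQ : IsSolitaryWave κ c Q) (x : ℝ) : HasDerivAt Q (deriv Q x) x :=
  (hQ.contDiff.differentiable (by norm_num)).differentiableAt.hasDerivAt

theorem contDiff_deriv (hQ : IsSolitaryWave κ c Q) : ContDiff ℝ 2 (deriv Q) :=
  (contDiff_succ_iff_deriv.mp (show ContDiff ℝ (2 + 1) Q from hQ.contDiff)).2.2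

theorem hasDerivAt_deriv (hQ : IsSolitaryWave κ c Q) (x : ℝ) :
    HasDerivAt (deriv Q) (deriv (deriv Q) x) x :=
  (hQ.contDiff_deriv.differentiable (by norm_num)).differentiableAt.hasDerivAt

theorem contDiff_deriv_deriv (hQ : IsSolitaryWave κ c Q) : ContDiff ℝ 1 (deriv (deriv Q)) :=
  (contDiff_succ_iff_deriv.mp (show ContDiff ℝ (1 + 1) (deriv Q) from hQ.contDiff_deriv)).2.2

theorem hasDerivAt_deriv_deriv (hQ : IsSolitaryWave κ c Q) (x : ℝ) :
    HasDerivAt (deriv (deriv Q)) (deriv (deriv (deriv Q)) x) x :=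
  (hQ.contDiff_deriv_deriv.differentiable (by norm_num)).differentiableAt.hasDerivAt

theorem third_order (hQ : IsSolitaryWave κ c Q) (x : ℝ) :
    (c - Q x) * deriv (deriv (deriv Q)) x =
      (c - 2 * κ) * deriv Q x - 3 * Q x * deriv Q x + 2 * deriv Q x * deriv (deriv Q) x := by
  have h := hQ.solves 0 x
  have h1 : ∀ z : ℝ, deriv (fun s : ℝ => Q (z - c * s)) 0 = -c * deriv Q z := by
    intro z
    have e : HasDerivAt (fun s : ℝ => z - c * s) (-c) 0 := by
      simpa using ((hasDerivAt_id (0 : ℝ)).const_mul c).const_sub z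
    have h0 : HasDerivAt Q (deriv Q z) (z - c * 0) := by simpa using hQ.hasDerivAt z
    have := (HasDerivAt.comp (0 : ℝ) h0 e).deriv
    simp only [Function.comp_def] at this
    rw [this]
    ring
  simp only [h1, mul_zero, sub_zero] at h
  change -c * deriv Q x - _ + 3 * Q x * deriv Q x + 2 * κ * deriv Q x - 2 * deriv Q x *
    iteratedDeriv 2 Q x - Q x * iteratedDeriv 3 Q x = 0 at h
  simp only [iteratedDeriv_succ, iteratedDeriv_zero] at h
  have e1 : deriv (fun z => -c * deriv Q z) = fun z => -c * deriv (deriv Q) z := by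
    ext z
    exact ((hQ.hasDerivAt_deriv z).const_mul (-c)).deriv
  have e2 : deriv (fun z => -c * deriv (deriv Q) z) x = -c * deriv (deriv (deriv Q)) x :=
    ((hQ.hasDerivAt_deriv_deriv x).const_mul (-c)).deriv
  rw [e1, e2] at h
  linarith

theorem tendsto_atTop (hQ : IsSolitaryWave κ c Q) : Tendsto Q atTop (𝓝 0) :=
  hQ.decay.mono_left atTop_le_cocompact

/-- The third-order equation is the derivative of the first identity, and `2Q'` times the first
identity is the derivative of the second. -/
theorem exists_first_integrals (hQ : IsSolitaryWave κ c Q) :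
    ∃ A B, ∀ x, ((c - Q x) * deriv (deriv Q) x - deriv Q x ^ 2 / 2 =
        (c - 2 * κ) * Q x - 3 / 2 * Q x ^ 2 + A) ∧
      (c - Q x) * deriv Q x ^ 2 = Q x ^ 2 * (c - 2 * κ - Q x) + 2 * A * Q x + B := by
  obtain ⟨A, hA⟩ := exists_const_of_hasDerivAt_zero (f := fun x => (c - Q x) * deriv (deriv Q) x
    - deriv Q x ^ 2 / 2 - ((c - 2 * κ) * Q x - 3 / 2 * Q x ^ 2)) (by
      intro x
      have h0 := hQ.hasDerivAt x
      have h1 := hQ.hasDerivAt_deriv x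
      have h2 := hQ.hasDerivAt_deriv_deriv x
      refine ((((h0.const_sub c).mul h2).sub ((h1.pow 2).div_const 2)).sub
        ((h0.const_mul (c - 2 * κ)).sub ((h0.pow 2).const_mul (3 / 2)))).congr_deriv ?_
      have := hQ.third_order x
      push_cast
      linear_combination this)
  obtain ⟨B, hB⟩ := exists_const_of_hasDerivAt_zero (f := fun x => (c - Q x) * deriv Q x ^ 2
    - (Q x ^ 2 * (c - 2 * κ - Q x) + 2 * A * Q x)) (by
      intro x
      have h0 := hQ.hasDerivAt x
      have h1 := hQ.hasDerivAt_deriv x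
      refine (((h0.const_sub c).mul (h1.pow 2)).sub
        (((h0.pow 2).mul (h0.const_sub (c - 2 * κ))).add (h0.const_mul (2 * A)))).congr_deriv ?_
      have := hA x
      push_cast
      simp only [Pi.pow_apply]
      linear_combination (2 * deriv Q x) * this)
  exact ⟨A, B, fun x => ⟨by linarith [hA x], by linarith [hB x]⟩⟩

/-- Only `Q → 0` is assumed, not decay of its derivatives. Along a sequence with `Q' → 0` the second
integral gives `B = 0`; that integral then forces `Q' → 0` along the whole line, so there is a
sequence with `Q'' → 0`, and the first integral gives `A = 0`. -/
theorem first_integrals (hQ : IsSolitaryWave κ c Q) (hc : 0 < c) (x : ℝ) :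
    ((c - Q x) * deriv (deriv Q) x - deriv Q x ^ 2 / 2 =
        (c - 2 * κ) * Q x - 3 / 2 * Q x ^ 2) ∧
      (c - Q x) * deriv Q x ^ 2 = Q x ^ 2 * (c - 2 * κ - Q x) := by
  obtain ⟨A, B, h⟩ := hQ.exists_first_integrals
  have hB : B = 0 := by
    obtain ⟨y, hy, hy'⟩ := exists_seq_deriv_tendsto_zero
      (hQ.contDiff.differentiable (by norm_num)) hQ.tendsto_atTop
    have hq := hQ.tendsto_atTop.comp hy
    have l1 : Tendsto (fun n => (c - Q (y n)) * deriv Q (y n) ^ 2) atTop (𝓝 ((c - 0) * 0 ^ 2)) :=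
      (hq.const_sub c).mul (hy'.pow 2)
    have l2 : Tendsto (fun n => Q (y n) ^ 2 * (c - 2 * κ - Q (y n)) + 2 * A * Q (y n) + B) atTop
        (𝓝 (0 ^ 2 * (c - 2 * κ - 0) + 2 * A * 0 + B)) :=
      (((hq.pow 2).mul (hq.const_sub (c - 2 * κ))).add (hq.const_mul (2 * A))).add_const B
    have := tendsto_nhds_unique l1 (l2.congr (fun n => ((h (y n)).2).symm))
    linarith
  subst hB
  have hq := hQ.tendsto_atTop
  have l1 : Tendsto (fun x => (c - Q x) * deriv Q x ^ 2) atTop (𝓝 0) := by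
    have : Tendsto (fun x => Q x ^ 2 * (c - 2 * κ - Q x) + 2 * A * Q x + 0) atTop
        (𝓝 (0 ^ 2 * (c - 2 * κ - 0) + 2 * A * 0 + 0)) :=
      (((hq.pow 2).mul (hq.const_sub (c - 2 * κ))).add (hq.const_mul (2 * A))).add_const 0
    refine (this.congr (fun n => ((h n).2).symm)).trans_eq ?_
    simp
  have hcne : c - 0 ≠ 0 := by simpa using hc.ne'
  have hev : ∀ᶠ x in atTop, c - Q x ≠ 0 := (hq.const_sub c).eventually_ne hcne
  have l2 : Tendsto (fun x => deriv Q x ^ 2) atTop (𝓝 0) := by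
    have := l1.div (hq.const_sub c) hcne
    rw [zero_div] at this
    refine this.congr' ?_
    filter_upwards [hev] with x hx
    simp only [Pi.div_apply]
    field_simp
  have l2' : Tendsto (deriv Q) atTop (𝓝 0) := by
    have := l2.sqrt
    simp only [Real.sqrt_sq_eq_abs, Real.sqrt_zero] at this
    exact (tendsto_zero_iff_abs_tendsto_zero _).mpr this
  have hA : A = 0 := by
    obtain ⟨y, hy, hy'⟩ := exists_seq_deriv_tendsto_zero
      (hQ.contDiff_deriv.differentiable (by norm_num)) l2'
    have hq := hq.comp hy
    have m1 : Tendsto (fun n => (c - Q (y n)) * deriv (deriv Q) (y n) - deriv Q (y n) ^ 2 / 2)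
        atTop (𝓝 ((c - 0) * 0 - 0 / 2)) :=
      ((hq.const_sub c).mul hy').sub ((l2.comp hy).div_const 2)
    have m2 : Tendsto (fun n => (c - 2 * κ) * Q (y n) - 3 / 2 * Q (y n) ^ 2 + A) atTop
        (𝓝 ((c - 2 * κ) * 0 - 3 / 2 * 0 ^ 2 + A)) :=
      ((hq.const_mul (c - 2 * κ)).sub ((hq.pow 2).const_mul (3 / 2))).add_const A
    have := tendsto_nhds_unique m1 (m2.congr (fun n => ((h (y n)).1).symm))
    linarith
  subst hA
  have := h x
  constructor <;> linarith

end IsSolitaryWave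


/-! ### Shape of the profile: bounds, nonvanishing, a single crest, behaviour at infinity. -/

namespace IsSolitaryWave

variable {κ c : ℝ} {Q : ℝ → ℝ}

/-- Where `Q = c` the second integral would read `0 = -2κc²`; since `Q` is small at infinity, the
intermediate value theorem keeps it below `c`. This excludes peaks and keeps the leading coefficient
positive. -/
theorem lt_speed (hQ : IsSolitaryWave κ c Q) (hκ : 0 < κ) (hc : 0 < c) (x : ℝ) : Q x < c := by
  have hne : ∀ y, Q y ≠ c := by
    intro y hy
    have := (hQ.first_integrals hc y).2
    rw [hy] at this
    have : 0 < κ * c ^ 2 := by positivity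
    nlinarith
  obtain ⟨y, hy⟩ := (hQ.tendsto_atTop.eventually (gt_mem_nhds hc)).exists
  by_contra! h
  obtain ⟨z, -, hz⟩ := intermediate_value_uIcc (a := x) (b := y)
    hQ.contDiff.continuous.continuousOn (Set.mem_uIcc.mpr (Or.inr ⟨hy.le, h⟩))
  exact hne z hz

theorem le_max (hQ : IsSolitaryWave κ c Q) (hκ : 0 < κ) (hc : 2 * κ < c) (x : ℝ) :
    Q x ≤ c - 2 * κ := by
  have hc0 : 0 < c := by linarith
  have h1 := (hQ.first_integrals hc0 x).2
  have h2 := hQ.lt_speed hκ hc0 x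
  by_contra! h
  have h3 : 0 ≤ (c - Q x) * deriv Q x ^ 2 := by
    have : 0 < c - Q x := by linarith
    positivity
  have h4 : 0 < Q x ^ 2 * (Q x - (c - 2 * κ)) := by
    have h5 : 0 < Q x := by linarith
    have h6 : 0 < Q x - (c - 2 * κ) := by linarith
    positivity
  linarith

theorem two_mul_le_sub (hQ : IsSolitaryWave κ c Q) (hκ : 0 < κ) (hc : 2 * κ < c) (x : ℝ) :
    2 * κ ≤ c - Q x := by
  linarith [hQ.le_max hκ hc x]

theorem sq_deriv_le (hQ : IsSolitaryWave κ c Q) (hκ : 0 < κ) (hc : 2 * κ < c) (x : ℝ) :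
    deriv Q x ^ 2 ≤ Q x ^ 2 := by
  have h1 := (hQ.first_integrals (by linarith) x).2
  have h2 := hQ.two_mul_le_sub hκ hc x
  have h3 : (c - Q x) * deriv Q x ^ 2 ≤ (c - Q x) * Q x ^ 2 := by
    nlinarith [mul_nonneg hκ.le (sq_nonneg (Q x))]
  exact le_of_mul_le_mul_left h3 (by linarith)

/-- A Gronwall argument: `|Q'| ≤ |Q|` makes `Q² exp(-2x)` nonincreasing and `Q² exp(2x)`
nondecreasing, so one zero spreads to both sides. -/
theorem ne_zero (hQ : IsSolitaryWave κ c Q) (hκ : 0 < κ) (hc : 2 * κ < c) (x : ℝ) : Q x ≠ 0 := by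
  intro hx
  apply hQ.nontrivial
  have hd : ∀ (s y : ℝ), HasDerivAt (fun y => Q y ^ 2 * Real.exp (s * y))
      ((2 * Q y * deriv Q y + s * Q y ^ 2) * Real.exp (s * y)) y := by
    intro s y
    have e := ((hasDerivAt_id y).const_mul s).exp
    refine (((hQ.hasDerivAt y).pow 2).mul e).congr_deriv ?_
    simp only [id, Pi.pow_apply]
    push_cast
    ring
  have hsq : ∀ y, |2 * Q y * deriv Q y| ≤ 2 * Q y ^ 2 := by
    intro y
    have := hQ.sq_deriv_le hκ hc y
    rw [abs_le]
    constructor <;> nlinarith [sq_nonneg (Q y + deriv Q y), sq_nonneg (Q y - deriv Q y)]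
  have hanti : Antitone (fun y => Q y ^ 2 * Real.exp (-2 * y)) := by
    refine antitone_of_deriv_nonpos (fun y => (hd _ y).differentiableAt) (fun y => ?_)
    rw [(hd _ y).deriv]
    exact mul_nonpos_of_nonpos_of_nonneg (by linarith [(abs_le.mp (hsq y)).2]) (Real.exp_pos _).le
  have hmono : Monotone (fun y => Q y ^ 2 * Real.exp (2 * y)) := by
    refine monotone_of_deriv_nonneg (fun y => (hd _ y).differentiableAt) (fun y => ?_)
    rw [(hd _ y).deriv]
    exact mul_nonneg (by linarith [(abs_le.mp (hsq y)).1]) (Real.exp_pos _).le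
  ext y
  have key : ∃ s : ℝ, Q y ^ 2 * Real.exp (s * y) ≤ 0 := by
    rcases le_total x y with h | h
    · exact ⟨-2, by simpa [hx] using hanti h⟩
    · exact ⟨2, by simpa [hx] using hmono h⟩
  obtain ⟨s, hs⟩ := key
  have := nonpos_of_mul_nonpos_left hs (Real.exp_pos _)
  exact pow_eq_zero_iff (two_ne_zero) |>.mp (le_antisymm this (sq_nonneg _))

theorem deriv_eq_zero_iff (hQ : IsSolitaryWave κ c Q) (hκ : 0 < κ) (hc : 2 * κ < c) (x : ℝ) :
    deriv Q x = 0 ↔ Q x = c - 2 * κ := by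
  have h1 := (hQ.first_integrals (by linarith) x).2
  have h2 := hQ.two_mul_le_sub hκ hc x
  have h3 := hQ.ne_zero hκ hc x
  constructor
  · intro h
    rw [h] at h1
    have : Q x ^ 2 * (c - 2 * κ - Q x) = 0 := by rw [← h1]; ring
    rcases mul_eq_zero.mp this with h | h
    · exact absurd (pow_eq_zero_iff two_ne_zero |>.mp h) h3
    · linarith
  · intro h
    rw [h] at h1
    have : (2 * κ) * deriv Q x ^ 2 = 0 := by linear_combination h1
    rcases mul_eq_zero.mp this with h | h
    · linarith
    · exact pow_eq_zero_iff two_ne_zero |>.mp h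

theorem deriv_zero (_hQ : IsSolitaryWave κ c Q) (hev : Function.Even Q) : deriv Q 0 = 0 := by
  have h := deriv_comp_neg Q 0
  have e : (fun x => Q (-x)) = Q := funext hev
  rw [e, neg_zero] at h
  linarith

theorem deriv_deriv_neg_of_crest (hQ : IsSolitaryWave κ c Q) (hκ : 0 < κ) (hc : 2 * κ < c) {x : ℝ}
    (hx : Q x = c - 2 * κ) : deriv (deriv Q) x < 0 := by
  have h1 := (hQ.first_integrals (by linarith) x).1
  rw [(hQ.deriv_eq_zero_iff hκ hc x).mpr hx, hx] at h1
  have : 0 < (c - 2 * κ) ^ 2 := pow_pos (by linarith) 2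
  by_contra! h
  nlinarith [mul_nonneg hκ.le h]

/-- Critical points are exactly the points of height `c - 2κ`, the upper bound of `Q`. If `x > 0`
were one, the minimum of `Q` on `[0, x]`, attained at an endpoint or at an interior critical point,
would have that height too. Then `Q` would be constant there, against `Q'' < 0` at a crest. -/
theorem deriv_ne_zero (hQ : IsSolitaryWave κ c Q) (hκ : 0 < κ) (hc : 2 * κ < c)
    (hev : Function.Even Q) {x : ℝ} (hx : 0 < x) : deriv Q x ≠ 0 := by
  intro h
  have hm := (hQ.deriv_eq_zero_iff hκ hc x).mp h
  have h0 : Q 0 = c - 2 * κ := (hQ.deriv_eq_zero_iff hκ hc 0).mp (hQ.deriv_zero hev)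
  obtain ⟨z, hz, hmin⟩ := isCompact_Icc.exists_isMinOn (Set.nonempty_Icc.mpr hx.le)
    hQ.contDiff.continuous.continuousOn
  have hz' : Q z = c - 2 * κ := by
    by_cases h1 : z = 0
    · rw [h1, h0]
    by_cases h2 : z = x
    · rw [h2, hm]
    have hzi : z ∈ Set.Ioo 0 x :=
      ⟨lt_of_le_of_ne hz.1 (Ne.symm h1), lt_of_le_of_ne hz.2 h2⟩
    have hloc : IsLocalMin Q z := hmin.isLocalMin (Icc_mem_nhds hzi.1 hzi.2)
    exact (hQ.deriv_eq_zero_iff hκ hc z).mp hloc.deriv_eq_zero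
  have hconst : ∀ y ∈ Set.Ioo 0 x, Q y = c - 2 * κ := fun y hy =>
    le_antisymm (hQ.le_max hκ hc y) (hz' ▸ hmin (Set.Ioo_subset_Icc_self hy))
  have hmid : x / 2 ∈ Set.Ioo 0 x := ⟨by linarith, by linarith⟩
  have hdz : deriv Q =ᶠ[𝓝 (x / 2)] fun _ => 0 := by
    filter_upwards [Ioo_mem_nhds hmid.1 hmid.2] with y hy
    exact (hQ.deriv_eq_zero_iff hκ hc y).mpr (hconst y hy)
  have := hQ.deriv_deriv_neg_of_crest hκ hc (hconst _ hmid)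
  rw [hdz.deriv_eq] at this
  simp at this

/-- Once `|Q| ≤ (c - 2κ)/4`, the first integrals bound `|Q'|` from below and `|Q''|` from above by
multiples of `|Q|`. The ratio `Q''/Q'` is the one in the boundary term of Jacobi's identity at
infinity. -/
theorem exists_bound_deriv_ratio (hQ : IsSolitaryWave κ c Q) (hκ : 0 < κ) (hc : 2 * κ < c) :
    ∃ K, ∀ᶠ x in atTop, |deriv (deriv Q) x / deriv Q x| ≤ K := by
  have hm : 0 < c - 2 * κ := by linarith
  have hc0 : 0 < c := by linarith
  have e1 := hQ.tendsto_atTop.eventually (Ioo_mem_nhds (show -((c - 2 * κ) / 4) < 0 by linarith)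
    (show 0 < (c - 2 * κ) / 4 by linarith))
  have hδ : 0 < Real.sqrt ((c - 2 * κ) / (4 * c)) := Real.sqrt_pos.mpr (by positivity)
  refine ⟨3 * (c - 2 * κ) / (2 * κ) / Real.sqrt ((c - 2 * κ) / (4 * c)), ?_⟩
  filter_upwards [e1] with x hx
  obtain ⟨i1, i2⟩ := hQ.first_integrals hc0 x
  have hp := hQ.two_mul_le_sub hκ hc x
  have hsq := hQ.sq_deriv_le hκ hc x
  have habs : |Q x| ≤ (c - 2 * κ) / 4 := abs_le.mpr ⟨hx.1.le, hx.2.le⟩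
  have hlow : Real.sqrt ((c - 2 * κ) / (4 * c)) * |Q x| ≤ |deriv Q x| := by
    apply abs_le_of_sq_le_sq' _ (abs_nonneg _) |>.2
    rw [mul_pow, Real.sq_sqrt (by positivity), sq_abs, sq_abs, div_mul_eq_mul_div,
      div_le_iff₀ (by positivity)]
    have h1 : (c - Q x) * deriv Q x ^ 2 ≤ (2 * c) * deriv Q x ^ 2 :=
      mul_le_mul_of_nonneg_right (by linarith [hx.1]) (sq_nonneg _)
    have h2 : Q x ^ 2 * ((c - 2 * κ) / 2) ≤ Q x ^ 2 * (c - 2 * κ - Q x) :=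
      mul_le_mul_of_nonneg_left (by linarith [hx.2]) (sq_nonneg _)
    linarith
  have hup : |deriv (deriv Q) x| ≤ 3 * (c - 2 * κ) / (2 * κ) * |Q x| := by
    rw [div_mul_eq_mul_div, le_div_iff₀ (by positivity)]
    have h1 : |deriv (deriv Q) x| * (2 * κ) ≤ |(c - Q x) * deriv (deriv Q) x| := by
      rw [abs_mul, mul_comm, abs_of_pos (show 0 < c - Q x by linarith)]
      exact mul_le_mul_of_nonneg_right hp (abs_nonneg _)
    have h2 : (c - Q x) * deriv (deriv Q) x =
        (c - 2 * κ) * Q x - 3 / 2 * Q x ^ 2 + deriv Q x ^ 2 / 2 := by linarith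
    have h3 : Q x ^ 2 ≤ (c - 2 * κ) / 4 * |Q x| := by
      rw [← sq_abs, sq]
      exact mul_le_mul_of_nonneg_right habs (abs_nonneg _)
    refine h1.trans ?_
    rw [h2, abs_le]
    have h4 := mul_le_mul_of_nonneg_left (le_abs_self (Q x)) hm.le
    have h5 := mul_le_mul_of_nonneg_left (neg_abs_le (Q x)) hm.le
    have h6 : 0 ≤ (c - 2 * κ) * |Q x| := by positivity
    constructor <;> linarith [sq_nonneg (deriv Q x), sq_nonneg (Q x)]
  rw [abs_div]
  refine div_le_of_le_mul₀ (abs_nonneg _) (by positivity) (hup.trans ?_)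
  rw [div_mul_eq_mul_div (3 * (c - 2 * κ) / (2 * κ)), le_div_iff₀ hδ, mul_assoc]
  refine mul_le_mul_of_nonneg_left ?_ (by positivity)
  rwa [mul_comm]

end IsSolitaryWave


/-! ### Smoothness and boundedness of the coefficients. -/

/-- Smooth real functions on the line all of whose derivatives are bounded. -/
def BddSmooth (a : ℝ → ℝ) : Prop :=
  ContDiff ℝ ∞ a ∧ ∀ n, ∃ C, ∀ x, |iteratedDeriv n a x| ≤ C

theorem BddSmooth.hasTemperateGrowth {a : ℝ → ℝ} (ha : BddSmooth a) :
    Function.HasTemperateGrowth a := by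
  refine ⟨ha.1, fun n => ?_⟩
  obtain ⟨C, hC⟩ := ha.2 n
  refine ⟨0, C, fun x => ?_⟩
  rw [norm_iteratedFDeriv_eq_norm_iteratedDeriv]
  simpa using hC x

theorem BddSmooth.hasTemperateGrowth_ofReal {a : ℝ → ℝ} (ha : BddSmooth a) :
    Function.HasTemperateGrowth (fun x => (a x : ℂ)) :=
  Complex.ofRealCLM.hasTemperateGrowth.comp ha.hasTemperateGrowth

theorem BddSmooth.deriv {a : ℝ → ℝ} (ha : BddSmooth a) : BddSmooth (deriv a) := by
  refine ⟨(contDiff_infty_iff_deriv.mp ha.1).2, fun n => ?_⟩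
  obtain ⟨C, hC⟩ := ha.2 (n + 1)
  exact ⟨C, fun x => by rw [← iteratedDeriv_succ']; exact hC x⟩

theorem BddSmooth.differentiable {a : ℝ → ℝ} (ha : BddSmooth a) : Differentiable ℝ a :=
  ha.1.differentiable (by norm_num)

theorem BddSmooth.continuous {a : ℝ → ℝ} (ha : BddSmooth a) : Continuous a :=
  ha.1.continuous

theorem BddSmooth.bounded {a : ℝ → ℝ} (ha : BddSmooth a) : ∃ C, ∀ x, |a x| ≤ C := by
  simpa using ha.2 0

/-- A set of bounded differentiable functions that is stable under differentiation consists of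
smooth functions with bounded derivatives. -/
theorem BddSmooth.of_stable {S : Set (ℝ → ℝ)} (hd : ∀ a ∈ S, Differentiable ℝ a)
    (hb : ∀ a ∈ S, ∃ C, ∀ x, |a x| ≤ C) (hS : ∀ a ∈ S, _root_.deriv a ∈ S) {a : ℝ → ℝ}
    (ha : a ∈ S) : BddSmooth a := by
  have key : ∀ n, ∀ a ∈ S, iteratedDeriv n a ∈ S := by
    intro n
    induction n with
    | zero => intro a ha; simpa using ha
    | succ n ih => intro a ha; rw [iteratedDeriv_succ]; exact hS _ (ih a ha)
  exact ⟨contDiff_of_differentiable_iteratedDeriv fun n _ => hd _ (key n a ha),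
    fun n => hb _ (key n a ha)⟩

namespace IsSolitaryWave

variable {κ c : ℝ} {Q : ℝ → ℝ}

theorem bounded (hQ : IsSolitaryWave κ c Q) : ∃ C, ∀ x, |Q x| ≤ C := by
  obtain ⟨K, hK, hKs⟩ := mem_cocompact.mp (hQ.decay.eventually
    (Ioo_mem_nhds (show (-1 : ℝ) < 0 by norm_num) (show (0 : ℝ) < 1 by norm_num)))
  obtain ⟨C, hC⟩ := hK.exists_bound_of_continuousOn hQ.contDiff.continuous.continuousOn
  refine ⟨max C 1, fun x => ?_⟩
  by_cases hx : x ∈ K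
  · exact le_max_of_le_left (hC x hx)
  · have h := hKs hx
    exact le_max_of_le_right (abs_le.mpr ⟨h.1.le, h.2.le⟩)

/-- The algebra generated by `Q`, `Q'` and `1 / (c - Q)`. -/
def coeffAlgebra (c : ℝ) (Q : ℝ → ℝ) : Subalgebra ℝ (ℝ → ℝ) :=
  Algebra.adjoin ℝ {Q, deriv Q, fun x => (c - Q x)⁻¹}

theorem mem_coeffAlgebra (c : ℝ) (Q : ℝ → ℝ) : Q ∈ coeffAlgebra c Q :=
  Algebra.subset_adjoin (by simp)

theorem deriv_mem_coeffAlgebra (c : ℝ) (Q : ℝ → ℝ) : deriv Q ∈ coeffAlgebra c Q :=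
  Algebra.subset_adjoin (by simp)

theorem inv_mem_coeffAlgebra (c : ℝ) (Q : ℝ → ℝ) :
    (fun x => (c - Q x)⁻¹) ∈ coeffAlgebra c Q :=
  Algebra.subset_adjoin (by simp)

theorem const_mem_coeffAlgebra (c : ℝ) (Q : ℝ → ℝ) (a : ℝ) :
    (fun _ => a) ∈ coeffAlgebra c Q :=
  (coeffAlgebra c Q).algebraMap_mem a

/-- The first integral expresses `Q''` polynomially in `Q`, `Q'` and `1/(c - Q)`. This closes the
algebra under differentiation and lifts `C³` to `C^∞` with all derivatives bounded. -/
theorem deriv_deriv_mem_coeffAlgebra (hQ : IsSolitaryWave κ c Q) (hκ : 0 < κ) (hc : 2 * κ < c) :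
    deriv (deriv Q) ∈ coeffAlgebra c Q := by
  have h : deriv (deriv Q) = ((fun _ => c - 2 * κ) * Q - (fun _ => 3 / 2) * (Q * Q) +
      (fun _ => 1 / 2) * (deriv Q * deriv Q)) * fun x => (c - Q x)⁻¹ := by
    ext x
    have h1 := (hQ.first_integrals (by linarith) x).1
    have h2 := hQ.two_mul_le_sub hκ hc x
    have h3 : c - Q x ≠ 0 := by linarith
    simp only [Pi.mul_apply, Pi.add_apply, Pi.sub_apply]
    field_simp
    linarith
  have m0 := mem_coeffAlgebra c Q
  have m1 := deriv_mem_coeffAlgebra c Q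
  rw [h]
  exact mul_mem (add_mem (sub_mem (mul_mem (const_mem_coeffAlgebra _ _ _) m0)
    (mul_mem (const_mem_coeffAlgebra _ _ _) (mul_mem m0 m0)))
    (mul_mem (const_mem_coeffAlgebra _ _ _) (mul_mem m1 m1))) (inv_mem_coeffAlgebra _ _)

theorem coeffAlgebra_spec (hQ : IsSolitaryWave κ c Q) (hκ : 0 < κ) (hc : 2 * κ < c) {a : ℝ → ℝ}
    (ha : a ∈ coeffAlgebra c Q) :
    (Differentiable ℝ a ∧ deriv a ∈ coeffAlgebra c Q) ∧ ∃ C, ∀ x, |a x| ≤ C := by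
  obtain ⟨K, hK⟩ := hQ.bounded
  have hne : ∀ x, c - Q x ≠ 0 := fun x => by linarith [hQ.two_mul_le_sub hκ hc x]
  induction ha using Algebra.adjoin_induction with
  | mem a ha =>
    rcases ha with rfl | rfl | rfl
    · exact ⟨⟨fun x => (hQ.hasDerivAt x).differentiableAt, deriv_mem_coeffAlgebra _ _⟩, K, hK⟩
    · exact ⟨⟨fun x => (hQ.hasDerivAt_deriv x).differentiableAt,
        hQ.deriv_deriv_mem_coeffAlgebra hκ hc⟩, K, fun x =>
          (sq_le_sq.mp (hQ.sq_deriv_le hκ hc x)).trans (hK x)⟩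
    · have hd : ∀ x, HasDerivAt (fun x => (c - Q x)⁻¹) (-(-deriv Q x) / (c - Q x) ^ 2) x :=
        fun x => ((hQ.hasDerivAt x).const_sub c).inv (hne x)
      refine ⟨⟨fun x => (hd x).differentiableAt, ?_⟩, (2 * κ)⁻¹, fun x => ?_⟩
      · have : deriv (fun x => (c - Q x)⁻¹) =
            deriv Q * ((fun x => (c - Q x)⁻¹) * fun x => (c - Q x)⁻¹) := by
          ext x
          have := hne x
          rw [(hd x).deriv]
          simp only [Pi.mul_apply]
          field_simp
        rw [this]
        exact mul_mem (deriv_mem_coeffAlgebra _ _)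
          (mul_mem (inv_mem_coeffAlgebra _ _) (inv_mem_coeffAlgebra _ _))
      · have := hQ.two_mul_le_sub hκ hc x
        rw [abs_of_pos (by apply inv_pos.mpr; linarith)]
        exact inv_anti₀ (by positivity) this
  | algebraMap r =>
    have : (algebraMap ℝ (ℝ → ℝ)) r = fun _ => r := rfl
    rw [this]
    refine ⟨⟨differentiable_const _, ?_⟩, |r|, fun x => le_rfl⟩
    rw [deriv_const']
    exact const_mem_coeffAlgebra _ _ _
  | add a b ha hb iha ihb =>
    obtain ⟨⟨da, ea⟩, C, hC⟩ := iha
    obtain ⟨⟨db, eb⟩, D, hD⟩ := ihb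
    refine ⟨⟨da.add db, ?_⟩, C + D, fun x => (abs_add_le _ _).trans (add_le_add (hC x) (hD x))⟩
    have : deriv (a + b) = deriv a + deriv b := by
      ext x
      exact deriv_add (da x) (db x)
    rw [this]
    exact add_mem ea eb
  | mul a b ha hb iha ihb =>
    obtain ⟨⟨da, ea⟩, C, hC⟩ := iha
    obtain ⟨⟨db, eb⟩, D, hD⟩ := ihb
    refine ⟨⟨da.mul db, ?_⟩, C * D, fun x => ?_⟩
    · have : deriv (a * b) = deriv a * b + a * deriv b := by
        ext x
        exact deriv_mul (da x) (db x)
      rw [this]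
      exact add_mem (mul_mem ea hb) (mul_mem ha eb)
    · rw [Pi.mul_apply, abs_mul]
      exact mul_le_mul (hC x) (hD x) (abs_nonneg _) ((abs_nonneg _).trans (hC x))

theorem bddSmooth_of_mem (hQ : IsSolitaryWave κ c Q) (hκ : 0 < κ) (hc : 2 * κ < c) {a : ℝ → ℝ}
    (ha : a ∈ coeffAlgebra c Q) : BddSmooth a :=
  BddSmooth.of_stable (S := coeffAlgebra c Q) (fun _ h => (hQ.coeffAlgebra_spec hκ hc h).1.1)
    (fun _ h => (hQ.coeffAlgebra_spec hκ hc h).2)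
    (fun _ h => (hQ.coeffAlgebra_spec hκ hc h).1.2) ha

end IsSolitaryWave

/-- The leading coefficient `c - Q` of `-M`. -/
def coeffP (c : ℝ) (Q : ℝ → ℝ) (x : ℝ) : ℝ := c - Q x

/-- The zeroth order coefficient `Q'' - 3 Q + c - 2 κ` of `M`. -/
noncomputable def coeffQ (κ c : ℝ) (Q : ℝ → ℝ) (x : ℝ) : ℝ := iteratedDeriv 2 Q x - 3 * Q x + c - 2 * κ

namespace IsSolitaryWave

variable {κ c : ℝ} {Q : ℝ → ℝ}

theorem bddSmooth_coeffP (hQ : IsSolitaryWave κ c Q) (hκ : 0 < κ) (hc : 2 * κ < c) :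
    BddSmooth (coeffP c Q) :=
  hQ.bddSmooth_of_mem hκ hc (sub_mem (const_mem_coeffAlgebra c Q c) (mem_coeffAlgebra c Q))

theorem bddSmooth_inv_coeffP (hQ : IsSolitaryWave κ c Q) (hκ : 0 < κ) (hc : 2 * κ < c) :
    BddSmooth (fun x => (coeffP c Q x)⁻¹) :=
  hQ.bddSmooth_of_mem hκ hc (inv_mem_coeffAlgebra c Q)

theorem coeffQ_eq (κ c : ℝ) (Q : ℝ → ℝ) : coeffQ κ c Q =
    deriv (deriv Q) - (fun _ => 3) * Q + (fun _ => c) - fun _ => 2 * κ := by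
  ext x
  simp [coeffQ, iteratedDeriv_succ]

theorem bddSmooth_coeffQ (hQ : IsSolitaryWave κ c Q) (hκ : 0 < κ) (hc : 2 * κ < c) :
    BddSmooth (coeffQ κ c Q) := by
  rw [coeffQ_eq]
  exact hQ.bddSmooth_of_mem hκ hc (sub_mem (add_mem (sub_mem
    (hQ.deriv_deriv_mem_coeffAlgebra hκ hc) (mul_mem (const_mem_coeffAlgebra c Q 3)
    (mem_coeffAlgebra c Q))) (const_mem_coeffAlgebra c Q c)) (const_mem_coeffAlgebra c Q (2 * κ)))

end IsSolitaryWave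


/-! ### Nonnegativity of the form of `M` on functions vanishing at the crest. -/

namespace IsSolitaryWave

variable {κ c : ℝ} {Q : ℝ → ℝ}

theorem coeffP_even (hev : Function.Even Q) (x : ℝ) : coeffP c Q (-x) = coeffP c Q x := by
  simp [coeffP, hev x]

theorem coeffQ_even (hev : Function.Even Q) (x : ℝ) : coeffQ κ c Q (-x) = coeffQ κ c Q x := by
  have h := iteratedDeriv_comp_neg 2 Q x
  have e : (fun x => Q (-x)) = Q := funext hev
  rw [e] at h
  simp only [coeffQ, hev x, h]
  norm_num

/-- Differentiating the equation of the profile: `M Q' = 0`. -/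
theorem hasDerivAt_coeffP_mul (hQ : IsSolitaryWave κ c Q) (x : ℝ) :
    HasDerivAt (fun x => coeffP c Q x * deriv (deriv Q) x) (coeffQ κ c Q x * deriv Q x) x := by
  refine (((hQ.hasDerivAt x).const_sub c).mul (hQ.hasDerivAt_deriv_deriv x)).congr_deriv ?_
  have h := hQ.third_order x
  simp only [coeffQ, iteratedDeriv_succ, iteratedDeriv_zero]
  linear_combination h

/-- The quadratic form of `M` on a half line, at functions vanishing at the crest. -/
theorem integral_Ioi_form_nonneg (hQ : IsSolitaryWave κ c Q) (hκ : 0 < κ) (hc : 2 * κ < c)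
    (hev : Function.Even Q) {g g' : ℝ → ℂ} (hg : ∀ x, HasDerivAt g (g' x) x)
    (hg' : Continuous g') (hg0 : g 0 = 0) (hginf : Tendsto g atTop (𝓝 0))
    (hint : IntegrableOn (fun x => coeffP c Q x * ‖g' x‖ ^ 2 + coeffQ κ c Q x * ‖g x‖ ^ 2)
      (Set.Ioi 0)) :
    0 ≤ ∫ x in Set.Ioi 0, (coeffP c Q x * ‖g' x‖ ^ 2 + coeffQ κ c Q x * ‖g x‖ ^ 2) := by
  set f : ℝ → ℝ := fun x => coeffP c Q x * ‖g' x‖ ^ 2 + coeffQ κ c Q x * ‖g x‖ ^ 2 with hf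
  have hgc : Continuous g := continuous_iff_continuousAt.mpr fun x => (hg x).continuousAt
  have hp := hQ.bddSmooth_coeffP hκ hc
  have hq := hQ.bddSmooth_coeffQ hκ hc
  have hfc : Continuous f := by
    have := hp.continuous
    have := hq.continuous
    fun_prop
  set w : ℝ → ℝ := fun x => deriv (deriv Q) x / deriv Q x with hw
  set Φ : ℝ → ℝ := fun x => coeffP c Q x * deriv (deriv Q) x * ‖g x‖ ^ 2 / deriv Q x with hΦ
  set F : ℝ → ℝ := fun x => ∫ y in (0 : ℝ)..x, f y with hF
  have hFd : ∀ x, HasDerivAt F (f x) x := fun x =>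
    intervalIntegral.integral_hasDerivAt_right (hfc.intervalIntegrable _ _)
      hfc.stronglyMeasurable.stronglyMeasurableAtFilter hfc.continuousAt
  -- Jacobi's identity: since `(pQ'')' = qQ'`, the integrand minus the derivative of the boundary
  -- term `Φ` is the square `p|g' - (Q''/Q')g|²`.
  have hGd : ∀ x ∈ Set.Ioi (0 : ℝ), HasDerivAt (fun x => F x - Φ x)
      (coeffP c Q x * ‖g' x - w x • g x‖ ^ 2) x := by
    intro x hx
    have hne := hQ.deriv_ne_zero hκ hc hev hx
    refine ((hFd x).sub (((hQ.hasDerivAt_coeffP_mul x).mul (hg x).norm_sq).div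
      (hQ.hasDerivAt_deriv x) hne)).congr_deriv ?_
    rw [norm_sub_sq_real, norm_smul, real_inner_smul_right, real_inner_comm]
    simp only [hf, hw, Pi.mul_apply, Real.norm_eq_abs, mul_pow, sq_abs]
    field_simp
    ring
  have hmono : MonotoneOn (fun x => F x - Φ x) (Set.Ioi 0) := by
    refine monotoneOn_of_deriv_nonneg (convex_Ioi 0)
      (fun x hx => (hGd x hx).continuousAt.continuousWithinAt)
      (fun x hx => (hGd x (interior_subset hx)).differentiableAt.differentiableWithinAt)
      (fun x hx => ?_)
    rw [(hGd x (interior_subset hx)).deriv]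
    have := hQ.two_mul_le_sub hκ hc x
    exact mul_nonneg (by unfold coeffP; linarith) (sq_nonneg _)
  have hF0 : Tendsto F (𝓝[>] 0) (𝓝 0) := by
    have := ((hFd 0).continuousAt.tendsto).mono_left (nhdsWithin_le_nhds (s := Set.Ioi 0))
    simpa [hF] using this
  -- At the crest `|g|²` vanishes to second order and `Q'` only to first, because `Q''(0) ≠ 0`.
  have hΦ0 : Tendsto Φ (𝓝[>] 0) (𝓝 0) := by
    have hm := hQ.deriv_deriv_neg_of_crest hκ hc
      ((hQ.deriv_eq_zero_iff hκ hc 0).mp (hQ.deriv_zero hev))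
    have t1 : Tendsto (fun x : ℝ => x⁻¹ • g x) (𝓝[>] 0) (𝓝 (g' 0)) := by
      have := (hg 0).tendsto_slope_zero_right
      simpa [hg0] using this
    have t2 : Tendsto (fun x : ℝ => x⁻¹ • deriv Q x) (𝓝[>] 0) (𝓝 (deriv (deriv Q) 0)) := by
      have := (hQ.hasDerivAt_deriv 0).tendsto_slope_zero_right
      simpa [hQ.deriv_zero hev] using this
    have t3 : Tendsto (fun x : ℝ => x) (𝓝[>] 0) (𝓝 0) :=
      tendsto_id.mono_left nhdsWithin_le_nhds
    have t4 : Tendsto (fun x => coeffP c Q x * deriv (deriv Q) x) (𝓝[>] 0)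
        (𝓝 (coeffP c Q 0 * deriv (deriv Q) 0)) :=
      (hQ.hasDerivAt_coeffP_mul 0).continuousAt.tendsto.mono_left nhdsWithin_le_nhds
    have := (t4.mul (t3.mul ((t1.norm.pow 2).div t2 hm.ne)))
    rw [zero_mul, mul_zero] at this
    refine this.congr' ?_
    filter_upwards [self_mem_nhdsWithin] with x hx
    have hne := hQ.deriv_ne_zero hκ hc hev hx
    have hx' : x ≠ 0 := ne_of_gt hx
    simp only [hΦ, Pi.div_apply, norm_smul, norm_inv, Real.norm_eq_abs, smul_eq_mul, mul_pow,
      inv_pow, sq_abs]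
    field_simp
  have hnn : ∀ x ∈ Set.Ioi (0 : ℝ), 0 ≤ F x - Φ x := by
    intro x hx
    have ht := hF0.sub hΦ0
    rw [sub_zero] at ht
    refine le_of_tendsto ht ?_
    filter_upwards [self_mem_nhdsWithin, nhdsWithin_le_nhds (gt_mem_nhds hx)] with y hy hyx
    exact hmono hy hx (le_of_lt hyx)
  have hΦinf : Tendsto Φ atTop (𝓝 0) := by
    obtain ⟨K, hK⟩ := hQ.exists_bound_deriv_ratio hκ hc
    obtain ⟨C, hC⟩ := hp.bounded
    have hz : Tendsto (fun x => C * K * ‖g x‖ ^ 2) atTop (𝓝 0) := by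
      have := (hginf.norm.pow 2).const_mul (C * K)
      simpa using this
    refine squeeze_zero_norm' ?_ hz
    filter_upwards [hK] with x hx
    have e : Φ x = coeffP c Q x * (deriv (deriv Q) x / deriv Q x) * ‖g x‖ ^ 2 := by
      simp only [hΦ]
      ring
    rw [e, norm_mul, norm_mul, norm_pow, norm_norm]
    exact mul_le_mul_of_nonneg_right (mul_le_mul (hC x) hx (abs_nonneg _)
      ((abs_nonneg _).trans (hC x))) (sq_nonneg _)
  have hFinf : Tendsto F atTop (𝓝 (∫ x in Set.Ioi 0, f x)) :=
    intervalIntegral_tendsto_integral_Ioi 0 hint tendsto_id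
  have := hFinf.sub hΦinf
  rw [sub_zero] at this
  refine ge_of_tendsto this ?_
  filter_upwards [eventually_gt_atTop 0] with x hx using hnn x hx

/-- The condition `g(0) = 0` decouples the two half lines, and the evenness of the coefficients
reflects the left one onto the right one. -/
theorem integral_form_nonneg (hQ : IsSolitaryWave κ c Q) (hκ : 0 < κ) (hc : 2 * κ < c)
    (hev : Function.Even Q) {g g' : ℝ → ℂ} (hg : ∀ x, HasDerivAt g (g' x) x)
    (hg' : Continuous g') (hg0 : g 0 = 0) (hginf : Tendsto g (cocompact ℝ) (𝓝 0))
    (hint : Integrable (fun x => coeffP c Q x * ‖g' x‖ ^ 2 + coeffQ κ c Q x * ‖g x‖ ^ 2)) :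
    0 ≤ ∫ x, (coeffP c Q x * ‖g' x‖ ^ 2 + coeffQ κ c Q x * ‖g x‖ ^ 2) := by
  set f : ℝ → ℝ := fun x => coeffP c Q x * ‖g' x‖ ^ 2 + coeffQ κ c Q x * ‖g x‖ ^ 2 with hf
  rw [← intervalIntegral.integral_Iic_add_Ioi (b := 0) hint.integrableOn hint.integrableOn]
  refine add_nonneg ?_ (hQ.integral_Ioi_form_nonneg hκ hc hev hg hg' hg0
    (hginf.mono_left atTop_le_cocompact) hint.integrableOn)
  have h1 : ∫ x in Set.Iic 0, f x = ∫ x in Set.Ioi 0, f (-x) := by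
    have := integral_comp_neg_Ioi 0 f
    rw [this, neg_zero]
  have h2 : ∀ x, f (-x) = coeffP c Q x * ‖-g' (-x)‖ ^ 2 + coeffQ κ c Q x * ‖g (-x)‖ ^ 2 := by
    intro x
    simp only [hf, coeffP_even hev, coeffQ_even hev, norm_neg]
  rw [h1]
  simp_rw [h2]
  refine hQ.integral_Ioi_form_nonneg hκ hc hev (g := fun x => g (-x)) (fun x => ?_) (by fun_prop)
    (by simpa using hg0) ?_ ?_
  · have := HasDerivAt.scomp x (hg (-x)) (hasDerivAt_neg x)
    simpa [Function.comp_def] using this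
  · exact (hginf.mono_left atBot_le_cocompact).comp tendsto_neg_atTop_atBot
  · simp_rw [← h2]
    exact (hint.comp_neg).integrableOn

end IsSolitaryWave


/-! ### Sobolev spaces through distributions: derivatives, multiplication, density. -/

noncomputable section

/-- The embedding of `L²(ℝ)` into the tempered distributions. -/
def toD : L2 →L[ℂ] 𝓢'(ℝ, ℂ) := Lp.toTemperedDistributionCLM ℂ (volume : Measure ℝ) 2

theorem coe_eq_toD (f : L2) : (f : 𝓢'(ℝ, ℂ)) = toD f := rfl

theorem toD_apply (f : L2) (φ : 𝓢(ℝ, ℂ)) : toD f φ = ∫ x, φ x * f x := by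
  change ((f : L2) : 𝓢'(ℝ, ℂ)) φ = _
  simp

theorem toD_injective : Function.Injective toD := toDistribution_injective

theorem toD_toLp (φ : 𝓢(ℝ, ℂ)) :
    toD (φ.toLp 2) = SchwartzMap.toTemperedDistributionCLM ℝ ℂ volume φ :=
  Lp.toTemperedDistribution_toLp_eq φ

theorem memSobolev_zero_iff_toD {T : 𝓢'(ℝ, ℂ)} : MemSobolev 0 2 T ↔ ∃ f : L2, T = toD f :=
  memSobolev_zero_iff

theorem memSobolev_toD (f : L2) : MemSobolev 0 2 (toD f) := memSobolev_zero_iff_toD.mpr ⟨f, rfl⟩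

theorem memSobolev_deriv {s : ℝ} {T : 𝓢'(ℝ, ℂ)} (hT : MemSobolev (s + 1) 2 T) :
    MemSobolev s 2 (derivCLM ℂ T) := by
  have h := hT.lineDerivOp (m := (1 : ℝ))
  rwa [add_sub_cancel_right] at h

/-- In the normalization where `∂` has symbol `2πiξ`, the symbol `1 + |ξ|²` is that of `1 -
(2π)⁻²∂²`. -/
theorem besselPotential_two_eq (T : 𝓢'(ℝ, ℂ)) :
    besselPotential ℝ ℂ 2 T =
      T - ((2 * Real.pi : ℂ) ^ 2)⁻¹ • derivCLM ℂ (derivCLM ℂ T) := by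
  have hd : ∀ T : 𝓢'(ℝ, ℂ), derivCLM ℂ T = LineDeriv.lineDerivOp (1 : ℝ) T := fun T => rfl
  have hpi : (2 * Real.pi : ℂ) ≠ 0 := by
    simp [Real.pi_ne_zero]
  have hg : Function.HasTemperateGrowth (fun x : ℝ => ((inner ℝ x 1 : ℝ) : ℂ)) := by fun_prop
  rw [hd, hd, lineDeriv_eq_fourierMultiplierCLM, lineDeriv_eq_fourierMultiplierCLM, map_smul,
    fourierMultiplierCLM_fourierMultiplierCLM_apply hg hg, smul_smul, smul_smul]
  have e : ((2 * Real.pi : ℂ) ^ 2)⁻¹ * (2 * Real.pi * Complex.I) *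
      (2 * Real.pi * Complex.I) = -1 := by
    have := Complex.I_mul_I
    field_simp
    simp
  rw [e, neg_one_smul, sub_neg_eq_add, besselPotential]
  have e2 : (fun x : ℝ => (((1 + ‖x‖ ^ 2) ^ ((2 : ℝ) / 2) : ℝ) : ℂ)) =
      (fun _ : ℝ => (1 : ℂ)) +
        (fun x : ℝ => ((inner ℝ x 1 : ℝ) : ℂ)) * fun x : ℝ => ((inner ℝ x 1 : ℝ) : ℂ) := by
    ext x
    simp [sq]
  rw [e2]
  ext φ
  simp only [fourierMultiplierCLM_apply]
  rw [smulLeftCLM_add (by fun_prop) (hg.mul hg)]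
  simp

/-- If `T` and `T'` lie in `H^s` then `T` lies in `H^(s + 1)`. -/
theorem memSobolev_succ {s : ℝ} {T : 𝓢'(ℝ, ℂ)} (hT : MemSobolev s 2 T)
    (hT' : MemSobolev s 2 (derivCLM ℂ T)) : MemSobolev (s + 1) 2 T := by
  -- Both `T` and `T''` lie in `H^(s-1)`, and the order-two Bessel potential raises the index by
  -- two.
  have h1 : MemSobolev (s - 1) 2 (besselPotential ℝ ℂ 2 T) := by
    rw [besselPotential_two_eq]
    refine (hT.mono (by linarith)).sub (MemSobolev.smul _ (memSobolev_deriv ?_))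
    simpa using hT'
  rw [memSobolev_besselPotential_iff] at h1
  have e : 2 + (s - 1) = s + 1 := by ring
  rwa [e] at h1

theorem memSobolev_nat_succ_iff {k : ℕ} {T : 𝓢'(ℝ, ℂ)} :
    MemSobolev ((k + 1 : ℕ) : ℝ) 2 T ↔
      MemSobolev (k : ℝ) 2 T ∧ MemSobolev (k : ℝ) 2 (derivCLM ℂ T) := by
  push_cast
  exact ⟨fun h => ⟨h.mono (by linarith), memSobolev_deriv h⟩, fun h => memSobolev_succ h.1 h.2⟩

/-- Multiplication of distributions by a smooth function with bounded derivatives. -/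
def mulD (a : ℝ → ℝ) : 𝓢'(ℝ, ℂ) →L[ℂ] 𝓢'(ℝ, ℂ) := smulLeftCLM ℂ (fun x => (a x : ℂ))

theorem mulD_apply {a : ℝ → ℝ} (T : 𝓢'(ℝ, ℂ)) (φ : 𝓢(ℝ, ℂ)) :
    mulD a T φ = T (SchwartzMap.smulLeftCLM ℂ (fun x => (a x : ℂ)) φ) := rfl

theorem derivCLM_mulD {a : ℝ → ℝ} (ha : BddSmooth a) (T : 𝓢'(ℝ, ℂ)) :
    derivCLM ℂ (mulD a T) = mulD (deriv a) T + mulD a (derivCLM ℂ T) := by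
  ext φ
  change T (SchwartzMap.smulLeftCLM ℂ (fun x => (a x : ℂ)) (-SchwartzMap.derivCLM ℂ ℂ φ)) =
    T (SchwartzMap.smulLeftCLM ℂ (fun x => ((deriv a x : ℝ) : ℂ)) φ) +
      T (-SchwartzMap.derivCLM ℂ ℂ (SchwartzMap.smulLeftCLM ℂ (fun x => (a x : ℂ)) φ))
  rw [← map_add]
  congr 1
  ext x
  have h1 := (ha.differentiable x).hasDerivAt.ofReal_comp
  have h2 := φ.hasDerivAt x
  have e : (SchwartzMap.smulLeftCLM ℂ (fun x => (a x : ℂ)) φ : ℝ → ℂ) =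
      fun x => (a x : ℂ) * φ x := by
    ext y
    rw [SchwartzMap.smulLeftCLM_apply_apply ha.hasTemperateGrowth_ofReal, smul_eq_mul]
  simp only [_root_.add_apply, _root_.neg_apply, SchwartzMap.derivCLM_apply, map_neg,
    SchwartzMap.smulLeftCLM_apply_apply ha.hasTemperateGrowth_ofReal,
    SchwartzMap.smulLeftCLM_apply_apply ha.deriv.hasTemperateGrowth_ofReal, smul_eq_mul]
  have h3 : deriv (fun x => (a x : ℂ) * φ x) x = _ := (h1.mul h2).deriv
  rw [e, h3]
  ring

theorem mulD_mulD {a b : ℝ → ℝ} (ha : BddSmooth a) (hb : BddSmooth b) (h : ∀ x, b x * a x = 1)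
    (T : 𝓢'(ℝ, ℂ)) : mulD b (mulD a T) = T := by
  have := smulLeftCLM_smulLeftCLM_apply (F := ℂ) ha.hasTemperateGrowth_ofReal
    hb.hasTemperateGrowth_ofReal T
  refine this.trans ?_
  have e : ((fun x => (a x : ℂ)) * fun x => (b x : ℂ)) = fun _ => 1 := by
    ext x
    simp only [Pi.mul_apply]
    rw [mul_comm]
    exact_mod_cast h x
  rw [e, smulLeftCLM_const, one_smul]

theorem memLp_top_ofReal {a : ℝ → ℝ} (ha : BddSmooth a) :
    MemLp (fun x => (a x : ℂ)) ⊤ (volume : Measure ℝ) := by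
  obtain ⟨C, hC⟩ := ha.bounded
  refine memLp_top_of_bound (Complex.continuous_ofReal.comp ha.continuous).aestronglyMeasurable C
    (Eventually.of_forall fun x => ?_)
  simpa using hC x

open Classical in
/-- Multiplication by a bounded function on `L²(ℝ)`; zero for an unbounded one. -/
def mulL (a : ℝ → ℝ) : L2 →L[ℂ] L2 :=
  if h : MemLp (fun x => (a x : ℂ)) ⊤ (volume : Measure ℝ) then
    (ContinuousLinearMap.mul ℂ ℂ).holderL volume ⊤ 2 2 (h.toLp _)
  else 0

theorem coeFn_mulL {a : ℝ → ℝ} (ha : BddSmooth a) (f : L2) :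
    mulL a f =ᵐ[volume] fun x => (a x : ℂ) * f x := by
  have h := memLp_top_ofReal ha
  rw [mulL, dif_pos h]
  filter_upwards [(ContinuousLinearMap.mul ℂ ℂ).coeFn_holder (r := 2) (h.toLp _) f,
    h.coeFn_toLp] with x h1 h2
  rw [ContinuousLinearMap.holderL_apply_apply, h1, h2, ContinuousLinearMap.mul_apply']

theorem toD_mulL {a : ℝ → ℝ} (ha : BddSmooth a) (f : L2) : toD (mulL a f) = mulD a (toD f) := by
  ext φ
  rw [mulD_apply, toD_apply, toD_apply]
  refine integral_congr_ae ?_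
  filter_upwards [coeFn_mulL ha f] with x hx
  rw [hx, SchwartzMap.smulLeftCLM_apply_apply ha.hasTemperateGrowth_ofReal, smul_eq_mul]
  ring

theorem memSobolev_zero_mulD {a : ℝ → ℝ} (ha : BddSmooth a) {T : 𝓢'(ℝ, ℂ)}
    (hT : MemSobolev 0 2 T) : MemSobolev 0 2 (mulD a T) := by
  obtain ⟨f, rfl⟩ := memSobolev_zero_iff_toD.mp hT
  rw [← toD_mulL ha]
  exact memSobolev_toD _

theorem memSobolev_nat_mulD (k : ℕ) : ∀ {a : ℝ → ℝ} (_ : BddSmooth a) {T : 𝓢'(ℝ, ℂ)}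
    (_ : MemSobolev (k : ℝ) 2 T), MemSobolev (k : ℝ) 2 (mulD a T) := by
  induction k with
  | zero =>
    intro a ha T hT
    have := memSobolev_zero_mulD ha (T := T) (by simpa using hT)
    simpa using this
  | succ k ih =>
    intro a ha T hT
    rw [memSobolev_nat_succ_iff] at hT ⊢
    refine ⟨ih ha hT.1, ?_⟩
    rw [derivCLM_mulD ha]
    exact (ih ha.deriv hT.1).add (ih ha hT.2)

/-- A continuous operator on distributions that maps `L²` into itself is bounded there. -/
theorem exists_bounded_of_maps_L2 (A : 𝓢'(ℝ, ℂ) →L[ℂ] 𝓢'(ℝ, ℂ))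
    (hA : ∀ f : L2, ∃ g : L2, A (toD f) = toD g) :
    ∃ B : L2 →L[ℂ] L2, ∀ f, A (toD f) = toD (B f) := by
  choose B hB using hA
  let Bl : L2 →ₗ[ℂ] L2 :=
    { toFun := B
      map_add' := fun f g => toD_injective (by
        rw [← hB, map_add, map_add, map_add, hB, hB])
      map_smul' := fun r f => toD_injective (by
        rw [← hB, map_smul, map_smul, map_smul, hB]; rfl) }
  have hcont : Continuous Bl := by
    -- Closed graph theorem: both limits are compared in the distributions, where limits are unique.
    refine Bl.continuous_of_seq_closed_graph fun u x y hu hBu => toD_injective ?_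
    have h1 : Tendsto (fun n => A (toD (u n))) atTop (𝓝 (A (toD x))) :=
      ((A.continuous.comp toD.continuous).tendsto x).comp hu
    have h2 : Tendsto (fun n => toD (Bl (u n))) atTop (𝓝 (toD y)) :=
      (toD.continuous.tendsto y).comp hBu
    have h3 : ∀ n, A (toD (u n)) = toD (Bl (u n)) := fun n => hB (u n)
    simp_rw [h3] at h1
    rw [tendsto_nhds_unique h2 h1]
    exact hB x
  exact ⟨⟨Bl, hcont⟩, fun f => hB f⟩

theorem memSobolev_iterate_deriv {k : ℕ} {T : 𝓢'(ℝ, ℂ)} (j : ℕ)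
    (hT : MemSobolev ((k + j : ℕ) : ℝ) 2 T) : MemSobolev (k : ℝ) 2 ((derivCLM ℂ)^[j] T) := by
  induction j generalizing T with
  | zero => simpa using hT
  | succ j ih =>
    rw [Function.iterate_succ_apply]
    apply ih
    have e : k + (j + 1) = (k + j) + 1 := by ring
    rw [e, memSobolev_nat_succ_iff] at hT
    exact hT.2

theorem iterate_derivCLM_toD_toLp (j : ℕ) (φ : 𝓢(ℝ, ℂ)) :
    (derivCLM ℂ)^[j] (toD (φ.toLp 2)) = toD (((SchwartzMap.derivCLM ℂ ℂ)^[j] φ).toLp 2) := by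
  induction j generalizing φ with
  | zero => rfl
  | succ j ih =>
    rw [Function.iterate_succ_apply, Function.iterate_succ_apply, ← ih, toD_toLp, toD_toLp,
      derivCLM_toTemperedDistributionCLM_eq ℂ]

/-- Schwartz functions are dense in `H^k(ℝ)`. -/
theorem exists_schwartz_tendsto {k : ℕ} {f : L2} (hf : MemSobolev (k : ℝ) 2 (toD f)) :
    ∃ φ : ℕ → 𝓢(ℝ, ℂ), ∀ j ≤ k, ∀ g : L2, (derivCLM ℂ)^[j] (toD f) = toD g →
      Tendsto (fun n => ((SchwartzMap.derivCLM ℂ ℂ)^[j] (φ n)).toLp 2) atTop (𝓝 g) := by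
  obtain ⟨u, hu⟩ := hf
  rw [coe_eq_toD] at hu
  have hfu : toD f = besselPotential ℝ ℂ (-k) (toD u) := by
    rw [← hu]
    simp
  have hdense := SchwartzMap.denseRange_toLpCLM (F := ℂ) (E := ℝ) (p := 2) (μ := volume)
    (by norm_num)
  obtain ⟨v, hv, hvu⟩ := mem_closure_iff_seq_limit.mp (hdense u)
  choose ψ hψ using hv
  have hsymb : Function.HasTemperateGrowth
      (fun x : ℝ => (((1 + ‖x‖ ^ 2) ^ ((-k : ℝ) / 2) : ℝ) : ℂ)) := by fun_prop
  refine ⟨fun n => SchwartzMap.fourierMultiplierCLM ℂ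
    (fun x : ℝ => (((1 + ‖x‖ ^ 2) ^ ((-k : ℝ) / 2) : ℝ) : ℂ)) (ψ n), fun j hj g hg => ?_⟩
  obtain ⟨D, hD⟩ : ∃ D : 𝓢'(ℝ, ℂ) →L[ℂ] 𝓢'(ℝ, ℂ), ∀ T, (derivCLM ℂ)^[j] T = D T := by
    refine ⟨(derivCLM ℂ) ^ j, fun T => ?_⟩
    rw [FunLike.coe_pow_eq_iterate]
  -- Writing `f` as the Bessel potential of order `-k` of `u`, one sequence approximating `u` in
  -- `L²` serves all `j ≤ k`, since `∂ʲ` composed with that potential is bounded on `L²`.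
  obtain ⟨B, hB⟩ := exists_bounded_of_maps_L2 (D ∘L besselPotential ℝ ℂ (-k)) (by
    intro h
    obtain ⟨i, rfl⟩ := Nat.exists_eq_add_of_le' hj
    have h1 : MemSobolev ((i + j : ℕ) : ℝ) 2 (besselPotential ℝ ℂ (-(i + j : ℕ)) (toD h)) := by
      rw [memSobolev_besselPotential_iff]
      simpa using memSobolev_toD h
    have h2 := (memSobolev_iterate_deriv j h1).mono (s' := 0) (by positivity)
    rw [hD] at h2
    exact memSobolev_zero_iff_toD.mp h2)
  have hlim : Tendsto (fun n => B (v n)) atTop (𝓝 g) := by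
    have : g = B u := toD_injective (by
      rw [← hB, ContinuousLinearMap.comp_apply, ← hfu, ← hD, hg])
    rw [this]
    exact (B.continuous.tendsto u).comp hvu
  refine hlim.congr fun n => toD_injective ?_
  rw [← hB, ContinuousLinearMap.comp_apply, ← iterate_derivCLM_toD_toLp, hD]
  congr 1
  rw [toD_toLp, ← fourierMultiplierCLM_toTemperedDistributionCLM_eq hsymb, ← toD_toLp,
    besselPotential, ← hψ n]
  rfl

end


/-! ### Weak derivatives, integration by parts and elliptic regularity. -/

noncomputable section

/-- `g` is the weak derivative of `f`. -/
def HasWeakDeriv (f g : L2) : Prop := derivCLM ℂ (toD f) = toD g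

theorem HasWeakDeriv.add {f f' g g' : L2} (hf : HasWeakDeriv f f') (hg : HasWeakDeriv g g') :
    HasWeakDeriv (f + g) (f' + g') := by
  unfold HasWeakDeriv at *
  rw [map_add, map_add, map_add, hf, hg]

theorem HasWeakDeriv.smul {f f' : L2} (a : ℂ) (hf : HasWeakDeriv f f') :
    HasWeakDeriv (a • f) (a • f') := by
  unfold HasWeakDeriv at *
  rw [map_smul, map_smul, map_smul, hf]

theorem HasWeakDeriv.sub {f f' g g' : L2} (hf : HasWeakDeriv f f') (hg : HasWeakDeriv g g') :
    HasWeakDeriv (f - g) (f' - g') := by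
  unfold HasWeakDeriv at *
  rw [map_sub, map_sub, map_sub, hf, hg]

theorem HasWeakDeriv.mulL {a : ℝ → ℝ} (ha : BddSmooth a) {f f' : L2} (hf : HasWeakDeriv f f') :
    HasWeakDeriv (mulL a f) (mulL (deriv a) f + mulL a f') := by
  unfold HasWeakDeriv at *
  rw [map_add, toD_mulL ha, toD_mulL ha.deriv, toD_mulL ha, derivCLM_mulD ha, hf]

theorem inner_toLp_deriv (φ χ : 𝓢(ℝ, ℂ)) :
    ⟪(SchwartzMap.derivCLM ℂ ℂ φ).toLp 2, χ.toLp 2⟫_ℂ =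
      -⟪φ.toLp 2, (SchwartzMap.derivCLM ℂ ℂ χ).toLp 2⟫_ℂ := by
  have h := SchwartzMap.integral_bilinear_deriv_right_eq_neg_left φ χ
    ((ContinuousLinearMap.mul ℝ ℂ).comp (Complex.conjCLE : ℂ →L[ℝ] ℂ))
  refine (SchwartzMap.inner_toL2_toL2_eq _ _ volume).trans (Eq.trans ?_
    (congrArg Neg.neg (SchwartzMap.inner_toL2_toL2_eq _ _ volume)).symm)
  rw [eq_neg_iff_add_eq_zero, add_comm, ← eq_neg_iff_add_eq_zero]
  simp only [RCLike.inner_apply, SchwartzMap.derivCLM_apply]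
  simp_rw [mul_comm _ ((starRingEnd ℂ) _)]
  exact h

/-- Integration by parts in `H¹(ℝ)`. -/
theorem HasWeakDeriv.inner_eq {f f' g g' : L2} (hf : HasWeakDeriv f f') (hg : HasWeakDeriv g g') :
    ⟪f', g⟫_ℂ = -⟪f, g'⟫_ℂ := by
  have key : ∀ {f f' : L2}, HasWeakDeriv f f' → ∃ φ : ℕ → 𝓢(ℝ, ℂ),
      Tendsto (fun n => (φ n).toLp 2) atTop (𝓝 f) ∧
      Tendsto (fun n => (SchwartzMap.derivCLM ℂ ℂ (φ n)).toLp 2) atTop (𝓝 f') := by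
    intro f f' hf
    have hm : MemSobolev ((1 : ℕ) : ℝ) 2 (toD f) := by
      refine (memSobolev_nat_succ_iff (k := 0)).mpr ⟨by simpa using memSobolev_toD f, ?_⟩
      rw [hf]
      simpa using memSobolev_toD f'
    obtain ⟨φ, hφ⟩ := exists_schwartz_tendsto hm
    exact ⟨φ, hφ 0 (by norm_num) f rfl, hφ 1 le_rfl f' hf⟩
  obtain ⟨φ, h1, h2⟩ := key hf
  obtain ⟨χ, h3, h4⟩ := key hg
  refine tendsto_nhds_unique (h2.inner h3) ?_
  exact ((h1.inner h4).neg).congr fun n => (inner_toLp_deriv _ _).symm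

/-- `u 0, u 1, …, u k` are the successive weak derivatives of `u 0`. -/
def IsJet (k : ℕ) (u : ℕ → L2) : Prop := ∀ j < k, HasWeakDeriv (u j) (u (j + 1))

theorem IsJet.mono {k m : ℕ} {u : ℕ → L2} (hu : IsJet m u) (h : k ≤ m) : IsJet k u :=
  fun j hj => hu j (hj.trans_le h)

theorem IsJet.sub {k : ℕ} {u v : ℕ → L2} (hu : IsJet k u) (hv : IsJet k v) : IsJet k (u - v) :=
  fun j hj => (hu j hj).sub (hv j hj)

theorem IsJet.smul {k : ℕ} {u : ℕ → L2} (a : ℂ) (hu : IsJet k u) : IsJet k (a • u) :=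
  fun j hj => (hu j hj).smul a

theorem IsJet.iterate_eq {k : ℕ} {u : ℕ → L2} (hu : IsJet k u) {j : ℕ} (hj : j ≤ k) :
    (derivCLM ℂ)^[j] (toD (u 0)) = toD (u j) := by
  induction j with
  | zero => rfl
  | succ j ih => rw [Function.iterate_succ_apply', ih (by omega)]; exact hu j hj

theorem exists_isJet {k : ℕ} {f : L2} (hf : MemSobolev (k : ℝ) 2 (toD f)) :
    ∃ u : ℕ → L2, u 0 = f ∧ IsJet k u := by
  have h : ∀ j, ∃ g : L2, j ≤ k → (derivCLM ℂ)^[j] (toD f) = toD g := by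
    intro j
    by_cases hj : j ≤ k
    · obtain ⟨g, hg⟩ := exists_deriv_rep j k hj (toD f) hf
      exact ⟨g, fun _ => hg⟩
    · exact ⟨0, fun h => absurd h hj⟩
  choose u hu using h
  refine ⟨u, toD_injective (hu 0 (Nat.zero_le k)).symm, fun j hj => ?_⟩
  unfold HasWeakDeriv
  rw [← hu j hj.le, ← hu (j + 1) hj, Function.iterate_succ_apply']

theorem IsJet.memSobolev {k : ℕ} {u : ℕ → L2} (hu : IsJet k u) :
    MemSobolev (k : ℝ) 2 (toD (u 0)) := by
  induction k generalizing u with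
  | zero => simpa using memSobolev_toD (u 0)
  | succ k ih =>
    rw [memSobolev_nat_succ_iff]
    refine ⟨ih (hu.mono k.le_succ), ?_⟩
    rw [hu 0 k.succ_pos]
    exact ih (u := fun j => u (j + 1)) fun j hj => hu (j + 1) (by omega)

/-- In the negative orders needed here, the Leibniz rule `aT' = (aT)' - a'T` reduces multiplication
to multiplication on `L²`. -/
theorem memSobolev_mulD_deriv {a : ℝ → ℝ} (ha : BddSmooth a) {T : 𝓢'(ℝ, ℂ)}
    (hT : MemSobolev 0 2 T) : MemSobolev (-1) 2 (mulD a (derivCLM ℂ T)) := by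
  have h : mulD a (derivCLM ℂ T) = derivCLM ℂ (mulD a T) - mulD (deriv a) T := by
    rw [derivCLM_mulD ha]
    abel
  rw [h]
  refine (memSobolev_deriv ?_).sub ((memSobolev_zero_mulD ha.deriv hT).mono (by norm_num))
  simpa using memSobolev_zero_mulD ha hT

theorem memSobolev_mulD_deriv_deriv {a : ℝ → ℝ} (ha : BddSmooth a) {T : 𝓢'(ℝ, ℂ)}
    (hT : MemSobolev 0 2 T) : MemSobolev (-2) 2 (mulD a (derivCLM ℂ (derivCLM ℂ T))) := by
  have h : mulD a (derivCLM ℂ (derivCLM ℂ T)) =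
      derivCLM ℂ (mulD a (derivCLM ℂ T)) - mulD (deriv a) (derivCLM ℂ T) := by
    rw [derivCLM_mulD ha]
    abel
  rw [h]
  refine (memSobolev_deriv ?_).sub ((memSobolev_mulD_deriv ha.deriv hT).mono (by norm_num))
  have e : (-2 : ℝ) + 1 = -1 := by norm_num
  rw [e]
  exact memSobolev_mulD_deriv ha hT

/-- Elliptic regularity for `∂² p ∂² - ∂ q ∂`. -/
theorem memSobolev_four_of_elliptic {p q r : ℝ → ℝ} (hp : BddSmooth p) (hq : BddSmooth q)
    (hr : BddSmooth r) (hpr : ∀ x, r x * p x = 1) {T : 𝓢'(ℝ, ℂ)} (hT : MemSobolev 0 2 T)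
    (hL : MemSobolev 0 2 (derivCLM ℂ (derivCLM ℂ (mulD p (derivCLM ℂ (derivCLM ℂ T)))) -
      derivCLM ℂ (mulD q (derivCLM ℂ T)))) :
    MemSobolev ((4 : ℕ) : ℝ) 2 T := by
  set D : 𝓢'(ℝ, ℂ) →L[ℂ] 𝓢'(ℝ, ℂ) := derivCLM ℂ
  set G := mulD p (D (D T)) with hG
  set F := D G - mulD q (D T) with hF
  have hDF : MemSobolev 0 2 (D F) := by
    rw [hF, map_sub]
    exact hL
  have hG2 : MemSobolev (-2) 2 G := memSobolev_mulD_deriv_deriv hp hT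
  have hq1 : MemSobolev (-1) 2 (mulD q (D T)) := memSobolev_mulD_deriv hq hT
  have up : ∀ {s t : ℝ} {S : 𝓢'(ℝ, ℂ)}, MemSobolev s 2 S → MemSobolev s 2 (D S) → s + 1 = t →
      MemSobolev t 2 S := fun h1 h2 h3 => h3 ▸ memSobolev_succ h1 h2
  have hF3 : MemSobolev (-3) 2 F := by
    refine MemSobolev.sub (memSobolev_deriv ?_) (hq1.mono (by norm_num))
    have e : (-3 : ℝ) + 1 = -2 := by norm_num
    rwa [e]
  -- Since `F'` is the given `L²` datum, `F` climbs one order at a time from `H^(-3)` to `H¹`.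
  have hF2 : MemSobolev (-2) 2 F := up hF3 (hDF.mono (by norm_num)) (by norm_num)
  have hF1 : MemSobolev (-1) 2 F := up hF2 (hDF.mono (by norm_num)) (by norm_num)
  have hF0 : MemSobolev 0 2 F := up hF1 (hDF.mono (by norm_num)) (by norm_num)
  have hF1' : MemSobolev ((1 : ℕ) : ℝ) 2 F := by simpa using up hF0 hDF (zero_add 1)
  have hDG : D G = F + mulD q (D T) := by rw [hF]; abel
  -- Now `G' = F + qT'` lifts `G` to `L²`. Dividing by `p`, that is multiplying by `r`, transfers
  -- this to `T''`, which improves `T'`; a second round then lifts `G` and `T''` to `H²`.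
  have hG1 : MemSobolev (-1) 2 G := by
    refine up hG2 ?_ (by norm_num)
    rw [hDG]
    exact (hF2.add (hq1.mono (by norm_num)))
  have hG0 : MemSobolev 0 2 G := by
    refine up hG1 ?_ (by norm_num)
    rw [hDG]
    exact (hF1.add hq1)
  have hDDT : D (D T) = mulD r G := (mulD_mulD hp hr hpr _).symm
  have hT1 : MemSobolev 1 2 T := by
    refine up hT ?_ (zero_add 1)
    refine up (s := -1) (memSobolev_deriv ?_) ?_ (by norm_num)
    · simpa using hT
    · rw [hDDT]
      exact (memSobolev_zero_mulD hr hG0).mono (by norm_num)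
  have hDT0 : MemSobolev 0 2 (D T) := memSobolev_deriv (by simpa using hT1)
  have hDT1 : MemSobolev ((1 : ℕ) : ℝ) 2 (D T) := by
    have : MemSobolev 0 2 (D (D T)) := by
      rw [hDDT]
      exact memSobolev_zero_mulD hr hG0
    simpa using up hDT0 this (zero_add 1)
  have hDG1 : MemSobolev ((1 : ℕ) : ℝ) 2 (D G) := by
    rw [hDG]
    exact hF1'.add (memSobolev_nat_mulD 1 hq hDT1)
  have hG1' : MemSobolev ((1 : ℕ) : ℝ) 2 G := by
    simpa using up hG0 (hDG1.mono (by norm_num)) (zero_add 1)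
  have hG2' : MemSobolev ((2 : ℕ) : ℝ) 2 G := memSobolev_nat_succ_iff.mpr ⟨hG1', hDG1⟩
  have hD2 : MemSobolev ((2 : ℕ) : ℝ) 2 (D (D T)) := by
    rw [hDDT]
    exact memSobolev_nat_mulD 2 hr hG2'
  have hD1 : MemSobolev ((3 : ℕ) : ℝ) 2 (D T) :=
    memSobolev_nat_succ_iff.mpr ⟨memSobolev_nat_succ_iff.mpr ⟨hDT1, hD2.mono (by norm_num)⟩, hD2⟩
  have hT0 : MemSobolev ((0 : ℕ) : ℝ) 2 T := by simpa using hT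
  exact memSobolev_nat_succ_iff.mpr ⟨memSobolev_nat_succ_iff.mpr ⟨memSobolev_nat_succ_iff.mpr
    ⟨memSobolev_nat_succ_iff.mpr ⟨hT0, hD1.mono (by norm_num)⟩, hD1.mono (by norm_num)⟩,
    hD1.mono (by norm_num)⟩, hD1⟩

theorem opL_eq {κ c : ℝ} {Q : ℝ → ℝ} (hp : BddSmooth (coeffP c Q)) (T : 𝓢'(ℝ, ℂ)) :
    opL κ c Q T = derivCLM ℂ (derivCLM ℂ (mulD (coeffP c Q) (derivCLM ℂ (derivCLM ℂ T)))) -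
      derivCLM ℂ (mulD (coeffQ κ c Q) (derivCLM ℂ T)) := by
  have e : smulLeftCLM ℂ (fun x : ℝ => ((Q x - c : ℝ) : ℂ)) = -mulD (coeffP c Q) := by
    rw [mulD, ← smulLeftCLM_neg hp.hasTemperateGrowth_ofReal]
    congr 1
    ext x
    simp [coeffP]
  change -derivCLM ℂ (derivCLM ℂ (smulLeftCLM ℂ (fun x : ℝ => ((Q x - c : ℝ) : ℂ))
    (derivCLM ℂ (derivCLM ℂ T))) + mulD (coeffQ κ c Q) (derivCLM ℂ T)) = _
  rw [e, map_add]
  change -(derivCLM ℂ (derivCLM ℂ (-mulD (coeffP c Q) _)) + _) = _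
  rw [map_neg, map_neg]
  abel

end


/-! ### The quadratic form of `L`: one negative direction and the lower bound by the eigenvalue. -/

noncomputable section

theorem inner_mulL {a : ℝ → ℝ} (ha : BddSmooth a) (f g : L2) :
    ⟪mulL a f, g⟫_ℂ = ⟪f, mulL a g⟫_ℂ := by
  rw [L2.inner_def, L2.inner_def]
  refine integral_congr_ae ?_
  filter_upwards [coeFn_mulL ha f, coeFn_mulL ha g] with x h1 h2
  rw [h1, h2]
  simp only [RCLike.inner_apply, map_mul, Complex.conj_ofReal]
  ring

theorem integrable_mul_norm_sq {a : ℝ → ℝ} (ha : BddSmooth a) (f : L2) :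
    Integrable (fun x => a x * ‖f x‖ ^ 2) := by
  have h : Integrable (fun x => ⟪f x, mulL a f x⟫_ℂ) := L2.integrable_inner f (mulL a f)
  refine h.re.congr ?_
  filter_upwards [coeFn_mulL ha f] with x hx
  rw [hx, RCLike.inner_apply, mul_assoc, Complex.mul_conj']
  norm_cast

theorem re_inner_mulL {a : ℝ → ℝ} (ha : BddSmooth a) (f : L2) :
    (⟪mulL a f, f⟫_ℂ).re = ∫ x, a x * ‖f x‖ ^ 2 := by
  rw [inner_mulL ha, L2.inner_def]
  have h : Integrable (fun x => ⟪f x, mulL a f x⟫_ℂ) := L2.integrable_inner f (mulL a f)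
  refine (integral_re h).symm.trans (integral_congr_ae ?_)
  filter_upwards [coeFn_mulL ha f] with x hx
  rw [hx, RCLike.inner_apply, mul_assoc, Complex.mul_conj']
  norm_cast

theorem norm_sq_eq_integral (f : L2) : ‖f‖ ^ 2 = ∫ x, ‖f x‖ ^ 2 := by
  rw [← inner_self_eq_norm_sq (𝕜 := ℂ), L2.inner_def]
  have h : Integrable (fun x => ⟪f x, f x⟫_ℂ) := L2.integrable_inner f f
  refine (integral_re h).symm.trans (integral_congr_ae (Eventually.of_forall fun x => ?_))
  exact inner_self_eq_norm_sq (𝕜 := ℂ) (f x)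

theorem integrable_norm_sq (f : L2) : Integrable (fun x => ‖f x‖ ^ 2) := by
  have h : Integrable (fun x => ⟪f x, f x⟫_ℂ) := L2.integrable_inner f f
  exact h.re.congr (Eventually.of_forall fun x => inner_self_eq_norm_sq (𝕜 := ℂ) (f x))

theorem le_re_inner_mulL {a : ℝ → ℝ} (ha : BddSmooth a) {m : ℝ} (hm : ∀ x, m ≤ a x) (f : L2) :
    m * ‖f‖ ^ 2 ≤ (⟪mulL a f, f⟫_ℂ).re := by
  rw [re_inner_mulL ha, norm_sq_eq_integral, ← integral_const_mul]
  exact integral_mono ((integrable_norm_sq f).const_mul m) (integrable_mul_norm_sq ha f)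
    fun x => mul_le_mul_of_nonneg_right (hm x) (sq_nonneg _)

/-- The sesquilinear form of `∂² p ∂² - ∂ q ∂`, in terms of the weak derivatives. -/
def formB (p q : ℝ → ℝ) (u v : ℕ → L2) : ℂ := ⟪mulL p (u 2), v 2⟫_ℂ + ⟪mulL q (u 1), v 1⟫_ℂ

theorem formB_conj {p q : ℝ → ℝ} (hp : BddSmooth p) (hq : BddSmooth q) (u v : ℕ → L2) :
    formB p q v u = (starRingEnd ℂ) (formB p q u v) := by
  rw [formB, formB, map_add, inner_conj_symm, inner_conj_symm, inner_mulL hp, inner_mulL hq]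

theorem formB_sub_smul (p q : ℝ → ℝ) (u v : ℕ → L2) (t : ℂ) :
    formB p q (u - t • v) (u - t • v) = formB p q u u - t * formB p q u v -
      (starRingEnd ℂ) t * formB p q v u + (starRingEnd ℂ) t * t * formB p q v v := by
  simp only [formB, Pi.sub_apply, Pi.smul_apply, map_sub, map_smul, inner_sub_left,
    inner_sub_right, inner_smul_left, inner_smul_right]
  ring

/-- `∂² p ∂² u - ∂ q ∂ u`, in terms of the weak derivatives of `u`. -/
def ellL (p q : ℝ → ℝ) (u : ℕ → L2) : L2 :=
  ((mulL (deriv (deriv p)) (u 2) + mulL (deriv p) (u 3)) +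
    (mulL (deriv p) (u 3) + mulL p (u 4))) - (mulL (deriv q) (u 1) + mulL q (u 2))

theorem toD_ellL {p q : ℝ → ℝ} (hp : BddSmooth p) (hq : BddSmooth q) {u : ℕ → L2}
    (hu : IsJet 4 u) : toD (ellL p q u) =
      derivCLM ℂ (derivCLM ℂ (mulD p (derivCLM ℂ (derivCLM ℂ (toD (u 0)))))) -
        derivCLM ℂ (mulD q (derivCLM ℂ (toD (u 0)))) := by
  have h1 : derivCLM ℂ (toD (u 0)) = toD (u 1) := hu 0 (by norm_num)
  have h2 : derivCLM ℂ (toD (u 1)) = toD (u 2) := hu 1 (by norm_num)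
  have h3 : derivCLM ℂ (mulD p (toD (u 2))) = toD (mulL (deriv p) (u 2) + mulL p (u 3)) := by
    rw [← toD_mulL hp]
    exact (hu 2 (by norm_num)).mulL hp
  have h4 : derivCLM ℂ (toD (mulL (deriv p) (u 2) + mulL p (u 3))) =
      toD ((mulL (deriv (deriv p)) (u 2) + mulL (deriv p) (u 3)) +
        (mulL (deriv p) (u 3) + mulL p (u 4))) :=
    ((hu 2 (by norm_num)).mulL hp.deriv).add ((hu 3 (by norm_num)).mulL hp)
  have h5 : derivCLM ℂ (mulD q (toD (u 1))) = toD (mulL (deriv q) (u 1) + mulL q (u 2)) := by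
    rw [← toD_mulL hq]
    exact (hu 1 (by norm_num)).mulL hq
  rw [h1, h2, h3, h4, h5, ← map_sub]
  rfl

/-- Two integrations by parts move half of the derivatives onto `v`, which therefore needs only two.
This is what suits the component of `V` in `H²`. -/
theorem inner_ellL {p q : ℝ → ℝ} (hp : BddSmooth p) (hq : BddSmooth q) {u v : ℕ → L2}
    (hu : IsJet 4 u) (hv : IsJet 2 v) : ⟪ellL p q u, v 0⟫_ℂ = formB p q u v := by
  have h3 := ((hu 2 (by norm_num)).mulL hp).inner_eq (hv 1 (by norm_num))
  have h4 := (((hu 2 (by norm_num)).mulL hp.deriv).add ((hu 3 (by norm_num)).mulL hp)).inner_eq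
    (hv 0 (by norm_num))
  have h5 := ((hu 1 (by norm_num)).mulL hq).inner_eq (hv 0 (by norm_num))
  rw [ellL, inner_sub_left, h4, h5, h3, formB]
  ring

/-- The jet of a Schwartz function. -/
def schwartzJet (φ : 𝓢(ℝ, ℂ)) (j : ℕ) : L2 := ((SchwartzMap.derivCLM ℂ ℂ)^[j] φ).toLp 2

theorem exists_schwartzJet_tendsto {k : ℕ} {u : ℕ → L2} (hu : IsJet k u) :
    ∃ φ : ℕ → 𝓢(ℝ, ℂ), ∀ j ≤ k, Tendsto (fun n => schwartzJet (φ n) j) atTop (𝓝 (u j)) := by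
  obtain ⟨φ, hφ⟩ := exists_schwartz_tendsto hu.memSobolev
  exact ⟨φ, fun j hj => hφ j hj (u j) (hu.iterate_eq hj)⟩

theorem schwartzJet_sub_smul (φ χ : 𝓢(ℝ, ℂ)) (t : ℂ) :
    schwartzJet (φ - t • χ) = schwartzJet φ - t • schwartzJet χ := by
  ext1 j
  have h : ∀ φ : 𝓢(ℝ, ℂ), (SchwartzMap.derivCLM ℂ ℂ)^[j] φ = ((SchwartzMap.derivCLM ℂ ℂ) ^ j) φ :=
    fun φ => by rw [FunLike.coe_pow_eq_iterate]
  simp only [schwartzJet, h, Pi.sub_apply, Pi.smul_apply, map_sub, map_smul]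
  exact (map_sub (SchwartzMap.toLpCLM ℂ ℂ 2 volume) _ _).trans
    (congrArg _ (map_smul (SchwartzMap.toLpCLM ℂ ℂ 2 volume) _ _))

theorem re_formB_self {p q : ℝ → ℝ} (hp : BddSmooth p) (hq : BddSmooth q) (φ : 𝓢(ℝ, ℂ)) :
    Integrable (fun x => p x * ‖deriv (deriv φ) x‖ ^ 2 + q x * ‖deriv φ x‖ ^ 2) ∧
    (formB p q (schwartzJet φ) (schwartzJet φ)).re =
      ∫ x, (p x * ‖deriv (deriv φ) x‖ ^ 2 + q x * ‖deriv φ x‖ ^ 2) := by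
  have key : ∀ {a : ℝ → ℝ} (_ : BddSmooth a) (χ : 𝓢(ℝ, ℂ)),
      (fun x => a x * ‖(χ.toLp 2 : L2) x‖ ^ 2) =ᵐ[volume] fun x => a x * ‖χ x‖ ^ 2 := by
    intro a _ χ
    filter_upwards [χ.coeFn_toLp 2 volume] with x hx
    rw [hx]
  have i1 := (integrable_mul_norm_sq hp (schwartzJet φ 2)).congr (key hp _)
  have i2 := (integrable_mul_norm_sq hq (schwartzJet φ 1)).congr (key hq _)
  refine ⟨i1.add i2, ?_⟩
  rw [formB, Complex.add_re, re_inner_mulL hp, re_inner_mulL hq, schwartzJet, schwartzJet,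
    integral_congr_ae (key hp _), integral_congr_ae (key hq _)]
  exact (integral_add i1 i2).symm

/-- On Schwartz functions whose derivative vanishes at the crest, the form of `L` is
nonnegative. -/
theorem IsSolitaryWave.formB_nonneg {κ c : ℝ} {Q : ℝ → ℝ} (hQ : IsSolitaryWave κ c Q) (hκ : 0 < κ)
    (hc : 2 * κ < c) (hev : Function.Even Q) {φ : 𝓢(ℝ, ℂ)} (hφ : deriv φ 0 = 0) :
    0 ≤ (formB (coeffP c Q) (coeffQ κ c Q) (schwartzJet φ) (schwartzJet φ)).re := by
  obtain ⟨h1, h2⟩ := re_formB_self (hQ.bddSmooth_coeffP hκ hc) (hQ.bddSmooth_coeffQ hκ hc) φ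
  rw [h2]
  set χ := SchwartzMap.derivCLM ℂ ℂ φ
  exact hQ.integral_form_nonneg hκ hc hev (g := deriv φ) (fun x => χ.hasDerivAt x)
    (SchwartzMap.derivCLM ℂ ℂ χ).continuous hφ χ.tendsto_cocompact h1

/-- A reversed Cauchy-Schwarz inequality: the form of `L` has at most one negative direction. -/
theorem IsSolitaryWave.formB_mul_le {κ c : ℝ} {Q : ℝ → ℝ} (hQ : IsSolitaryWave κ c Q) (hκ : 0 < κ)
    (hc : 2 * κ < c) (hev : Function.Even Q) {u v : ℕ → L2} (hu : IsJet 2 u) (hv : IsJet 2 v)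
    (hneg : (formB (coeffP c Q) (coeffQ κ c Q) v v).re < 0) :
    (formB (coeffP c Q) (coeffQ κ c Q) u u).re * (formB (coeffP c Q) (coeffQ κ c Q) v v).re ≤
      ‖formB (coeffP c Q) (coeffQ κ c Q) u v‖ ^ 2 := by
  have hp := hQ.bddSmooth_coeffP hκ hc
  have hq := hQ.bddSmooth_coeffQ hκ hc
  obtain ⟨φ, hφ⟩ := exists_schwartzJet_tendsto hu
  obtain ⟨χ, hχ⟩ := exists_schwartzJet_tendsto hv
  have lim : ∀ {u v : ℕ → L2} {φ χ : ℕ → 𝓢(ℝ, ℂ)},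
      (∀ j ≤ 2, Tendsto (fun n => schwartzJet (φ n) j) atTop (𝓝 (u j))) →
      (∀ j ≤ 2, Tendsto (fun n => schwartzJet (χ n) j) atTop (𝓝 (v j))) →
      Tendsto (fun n => formB (coeffP c Q) (coeffQ κ c Q) (schwartzJet (φ n)) (schwartzJet (χ n)))
        atTop (𝓝 (formB (coeffP c Q) (coeffQ κ c Q) u v)) := by
    intro u v φ χ hφ hχ
    exact ((((mulL _).continuous.tendsto _).comp (hφ 2 le_rfl)).inner (hχ 2 le_rfl)).add
      ((((mulL _).continuous.tendsto _).comp (hφ 1 (by norm_num))).inner (hχ 1 (by norm_num)))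
  have l1 := (Complex.continuous_re.tendsto _).comp (lim hφ hφ)
  have l2 := (Complex.continuous_re.tendsto _).comp (lim hχ hχ)
  have l3 := lim hφ hχ
  refine le_of_tendsto_of_tendsto (l1.mul l2) (l3.norm.pow 2) ?_
  -- The argument runs on Schwartz approximants, whose derivative has a value at the crest; the
  -- strict inequality `B(v,v) < 0` survives the approximation.
  filter_upwards [l2.eventually_lt_const hneg] with n hn
  simp only [Function.comp_apply] at hn ⊢
  set b := formB (coeffP c Q) (coeffQ κ c Q) (schwartzJet (φ n)) (schwartzJet (χ n)) with hb
  have hne : deriv (χ n) 0 ≠ 0 := fun h => absurd (hQ.formB_nonneg hκ hc hev h) (not_le.mpr hn)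
  -- This `t` makes the derivative of `φ - tχ` vanish at the crest, so the form is nonnegative
  -- there.
  set t : ℂ := deriv (φ n) 0 / deriv (χ n) 0 with ht
  have hz : deriv (φ n - t • χ n : 𝓢(ℝ, ℂ)) 0 = 0 := by
    have e : SchwartzMap.derivCLM ℂ ℂ (φ n - t • χ n) = SchwartzMap.derivCLM ℂ ℂ (φ n) -
        t • SchwartzMap.derivCLM ℂ ℂ (χ n) := by rw [map_sub, map_smul]
    have e2 := congrArg (fun f : 𝓢(ℝ, ℂ) => f 0) e
    have e3 : deriv (φ n - t • χ n : 𝓢(ℝ, ℂ)) 0 = deriv (φ n) 0 - t * deriv (χ n) 0 := e2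
    rw [e3, ht, div_mul_cancel₀ _ hne, sub_self]
  have h0 := hQ.formB_nonneg hκ hc hev hz
  rw [schwartzJet_sub_smul, formB_sub_smul, formB_conj hp hq (schwartzJet (φ n)) (schwartzJet (χ n)),
    ← hb] at h0
  have e1 : ((starRingEnd ℂ) t * (starRingEnd ℂ) b).re = (t * b).re := by
    rw [← map_mul, Complex.conj_re]
  have e2 : ((starRingEnd ℂ) t * t * formB (coeffP c Q) (coeffQ κ c Q) (schwartzJet (χ n))
      (schwartzJet (χ n))).re = ‖t‖ ^ 2 * (formB (coeffP c Q) (coeffQ κ c Q) (schwartzJet (χ n))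
      (schwartzJet (χ n))).re := by
    rw [Complex.conj_mul', ← Complex.ofReal_pow, Complex.re_ofReal_mul]
  rw [Complex.add_re, Complex.sub_re, Complex.sub_re, e1, e2] at h0
  have h1 : -(‖t‖ * ‖b‖) ≤ (t * b).re := by
    rw [← norm_mul]
    exact (abs_le.mp (Complex.abs_re_le_norm _)).1
  set β := (formB (coeffP c Q) (coeffQ κ c Q) (schwartzJet (χ n)) (schwartzJet (χ n))).re
  set α := (formB (coeffP c Q) (coeffQ κ c Q) (schwartzJet (φ n)) (schwartzJet (φ n))).re
  -- Multiplying `α - 2Re(tb) + |t|²β ≥ 0` by `β < 0` and completing the square in `|t|β` gives `αβ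
  -- ≤ |b|²`.
  nlinarith [sq_nonneg (‖t‖ * β + ‖b‖), mul_nonneg h0 (neg_nonneg.mpr hn.le),
    mul_nonneg (neg_nonneg.mpr hn.le) (by linarith : 0 ≤ (t * b).re + ‖t‖ * ‖b‖)]

/-- A negative eigenvalue of `L` bounds its form from below. -/
theorem IsSolitaryWave.le_formB {κ c : ℝ} {Q : ℝ → ℝ} (hQ : IsSolitaryWave κ c Q) (hκ : 0 < κ)
    (hc : 2 * κ < c) (hev : Function.Even Q) {lam : ℝ} (hlam : lam < 0)
    (heig : IsEigenvalueL κ c Q lam) {u : ℕ → L2} (hu : IsJet 2 u) :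
    lam * ‖u 0‖ ^ 2 ≤ (formB (coeffP c Q) (coeffQ κ c Q) u u).re := by
  have hp := hQ.bddSmooth_coeffP hκ hc
  have hq := hQ.bddSmooth_coeffQ hκ hc
  obtain ⟨ψ, hψ, hψ0, hLψ⟩ := heig
  rw [coe_eq_toD] at hψ hLψ
  obtain ⟨v, rfl, hv⟩ := exists_isJet (k := 4) (f := ψ) (by exact_mod_cast hψ)
  have hLv : ellL (coeffP c Q) (coeffQ κ c Q) v = (lam : ℂ) • v 0 := by
    apply toD_injective
    rw [toD_ellL hp hq hv, ← opL_eq hp, hLψ, map_smul]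
  have hv2 := hv.mono (show 2 ≤ 4 by norm_num)
  have hvw : ∀ w, IsJet 2 w → formB (coeffP c Q) (coeffQ κ c Q) v w = lam * ⟪v 0, w 0⟫_ℂ := by
    intro w hw
    rw [← inner_ellL hp hq hv hw, hLv, inner_smul_left, Complex.conj_ofReal]
  have hnpos : 0 < ‖v 0‖ ^ 2 := by positivity
  have hself : ⟪v 0, v 0⟫_ℂ = ((‖v 0‖ ^ 2 : ℝ) : ℂ) := by
    rw [inner_self_eq_norm_sq_to_K]
    norm_cast
  have hvv : formB (coeffP c Q) (coeffQ κ c Q) v v = ((lam * ‖v 0‖ ^ 2 : ℝ) : ℂ) := by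
    rw [hvw v hv2, hself]
    push_cast
    ring
  set a : ℂ := ⟪v 0, u 0⟫_ℂ / ⟪v 0, v 0⟫_ℂ with ha
  have hs0 : ⟪v 0, v 0⟫_ℂ ≠ 0 := by simpa using hψ0
  set h : ℕ → L2 := u - a • v with hh
  have hjet : IsJet 2 h := hu.sub (hv2.smul a)
  have horth : ⟪v 0, h 0⟫_ℂ = 0 := by
    rw [hh, Pi.sub_apply, Pi.smul_apply, inner_sub_right, inner_smul_right, ha,
      div_mul_cancel₀ _ hs0, sub_self]
  have hvh : formB (coeffP c Q) (coeffQ κ c Q) v h = 0 := by rw [hvw h hjet, horth, mul_zero]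
  have hhv : formB (coeffP c Q) (coeffQ κ c Q) h v = 0 := by
    rw [formB_conj hp hq v h, hvh, map_zero]
  have hneg : (formB (coeffP c Q) (coeffQ κ c Q) v v).re < 0 := by
    rw [hvv, Complex.ofReal_re]
    exact mul_neg_of_neg_of_pos hlam hnpos
  -- The part `h` orthogonal to the eigenvector `v` is also orthogonal for the form, so the reversed
  -- Cauchy-Schwarz inequality gives `B(h,h)B(v,v) ≤ 0` with `B(v,v) < 0`.
  have hhh : 0 ≤ (formB (coeffP c Q) (coeffQ κ c Q) h h).re := by
    have := hQ.formB_mul_le hκ hc hev hjet hv2 hneg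
    rw [hhv, norm_zero] at this
    by_contra! hlt
    have := mul_pos_of_neg_of_neg hlt hneg
    linarith
  have hu_eq : u = h - (-a) • v := by
    rw [hh]
    module
  have e1 : (formB (coeffP c Q) (coeffQ κ c Q) u u).re =
      (formB (coeffP c Q) (coeffQ κ c Q) h h).re + ‖a‖ ^ 2 * (lam * ‖v 0‖ ^ 2) := by
    rw [hu_eq, formB_sub_smul, hvh, hhv, hvv, Complex.conj_mul',
      ← Complex.ofReal_pow, Complex.add_re, Complex.re_ofReal_mul, Complex.ofReal_re, norm_neg]
    simp
  have e2 : ‖u 0‖ ^ 2 = ‖h 0‖ ^ 2 + ‖a‖ ^ 2 * ‖v 0‖ ^ 2 := by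
    have e3 : u 0 = h 0 + a • v 0 := by
      rw [hh]
      simp
    have e4 : ⟪h 0, a • v 0⟫_ℂ = 0 := by
      rw [inner_smul_right, inner_eq_zero_symm.mp horth, mul_zero]
    have := norm_add_sq_eq_norm_sq_add_norm_sq_of_inner_eq_zero (𝕜 := ℂ) _ _ e4
    rw [e3, sq, this, norm_smul]
    ring
  rw [e1, e2]
  nlinarith [mul_nonneg (neg_nonneg.mpr hlam.le) (sq_nonneg ‖h 0‖)]

end


/-! ### A priori estimates in `H²` and `H⁴`. -/

noncomputable section

theorem IsJet.norm_sq_le {k : ℕ} {u : ℕ → L2} (hu : IsJet k u) {j : ℕ} (hj : j + 2 ≤ k) :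
    ‖u (j + 1)‖ ^ 2 ≤ ‖u j‖ * ‖u (j + 2)‖ := by
  have h := (hu j (by omega)).inner_eq (hu (j + 1) (by omega))
  have h2 := norm_inner_le_norm (𝕜 := ℂ) (u j) (u (j + 2))
  rw [← norm_neg, ← h, inner_self_eq_norm_sq_to_K, norm_pow] at h2
  simpa using h2

theorem mul_norm_le_norm_mulL {a : ℝ → ℝ} (ha : BddSmooth a) {m : ℝ} (hm : ∀ x, m ≤ a x)
    (f : L2) : m * ‖f‖ ≤ ‖mulL a f‖ := by
  by_cases h0 : ‖f‖ = 0
  · rw [h0, mul_zero]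
    exact norm_nonneg _
  have h1 := le_re_inner_mulL ha hm f
  have h2 : (⟪mulL a f, f⟫_ℂ).re ≤ ‖mulL a f‖ * ‖f‖ := re_inner_le_norm (𝕜 := ℂ) _ _
  have h3 : 0 < ‖f‖ := lt_of_le_of_ne (norm_nonneg _) (Ne.symm h0)
  refine le_of_mul_le_mul_right ?_ h3
  linarith

/-- The norm of `H^k(ℝ)`. -/
def jetNorm (k : ℕ) (u : ℕ → L2) : ℝ := Real.sqrt (∑ j ∈ Finset.range (k + 1), ‖u j‖ ^ 2)

theorem jetNorm_nonneg (k : ℕ) (u : ℕ → L2) : 0 ≤ jetNorm k u := Real.sqrt_nonneg _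

theorem sq_jetNorm (k : ℕ) (u : ℕ → L2) :
    jetNorm k u ^ 2 = ∑ j ∈ Finset.range (k + 1), ‖u j‖ ^ 2 :=
  Real.sq_sqrt (Finset.sum_nonneg fun _ _ => sq_nonneg _)

theorem norm_le_jetNorm {k j : ℕ} (hj : j ≤ k) (u : ℕ → L2) : ‖u j‖ ≤ jetNorm k u := by
  refine Real.le_sqrt_of_sq_le ?_
  exact Finset.single_le_sum (f := fun j => ‖u j‖ ^ 2) (fun _ _ => sq_nonneg _)
    (Finset.mem_range.mpr (Nat.lt_succ_of_le hj))

theorem jetNorm_le_sum (k : ℕ) (u : ℕ → L2) :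
    jetNorm k u ≤ ∑ j ∈ Finset.range (k + 1), ‖u j‖ :=
  Real.sqrt_le_iff.mpr ⟨Finset.sum_nonneg fun _ _ => norm_nonneg _,
    Finset.sum_sq_le_sq_sum_of_nonneg fun _ _ => norm_nonneg _⟩

/-- Gårding's inequality: `q` has no sign, but `‖u'‖² ≤ ‖u‖‖u''‖` lets half of the leading term
absorb the first-order terms at the cost of an `L²` term. -/
theorem exists_coercive {p q : ℝ → ℝ} (hp : BddSmooth p) {m : ℝ} (hm0 : 0 < m)
    (hm : ∀ x, m ≤ p x) : ∃ K, 0 ≤ K ∧ ∀ u, IsJet 2 u →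
      m / 2 * jetNorm 2 u ^ 2 ≤ (formB p q u u).re + K * ‖u 0‖ ^ 2 := by
  set s := m / 2 + ‖mulL q‖ with hs
  refine ⟨m / 2 + s ^ 2 / (2 * m), by positivity, fun u hu => ?_⟩
  have h1 := le_re_inner_mulL hp hm (u 2)
  have h2 : -(‖mulL q‖ * ‖u 1‖ ^ 2) ≤ (⟪mulL q (u 1), u 1⟫_ℂ).re := by
    have e1 : |(⟪mulL q (u 1), u 1⟫_ℂ).re| ≤ ‖mulL q (u 1)‖ * ‖u 1‖ :=
      (Complex.abs_re_le_norm _).trans (norm_inner_le_norm _ _)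
    have e2 := mul_le_mul_of_nonneg_right ((mulL q).le_opNorm (u 1)) (norm_nonneg (u 1))
    have := (abs_le.mp e1).1
    nlinarith
  have h3 := hu.norm_sq_le (j := 0) le_rfl
  have h4 : s * (‖u 0‖ * ‖u 2‖) ≤ m / 2 * ‖u 2‖ ^ 2 + s ^ 2 / (2 * m) * ‖u 0‖ ^ 2 := by
    have e : m / 2 * ‖u 2‖ ^ 2 + s ^ 2 / (2 * m) * ‖u 0‖ ^ 2 - s * (‖u 0‖ * ‖u 2‖) =
        (m * ‖u 2‖ - s * ‖u 0‖) ^ 2 / (2 * m) := by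
      field_simp
      ring
    have : 0 ≤ (m * ‖u 2‖ - s * ‖u 0‖) ^ 2 / (2 * m) := by positivity
    linarith
  have h5 : s * ‖u 1‖ ^ 2 ≤ s * (‖u 0‖ * ‖u 2‖) :=
    mul_le_mul_of_nonneg_left h3 (by positivity)
  rw [sq_jetNorm, formB, Complex.add_re]
  simp only [Finset.sum_range_succ, Finset.sum_range_zero, zero_add]
  have h6 : (m / 2 + ‖mulL q‖) * ‖u 1‖ ^ 2 ≤
      m / 2 * ‖u 2‖ ^ 2 + s ^ 2 / (2 * m) * ‖u 0‖ ^ 2 := by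
    rw [← hs]
    exact h5.trans h4
  linarith

theorem norm_formB_le (p q : ℝ → ℝ) (u v : ℕ → L2) :
    ‖formB p q u v‖ ≤ (‖mulL p‖ + ‖mulL q‖) * (jetNorm 2 u * jetNorm 2 v) := by
  have key : ∀ (a : ℝ → ℝ) (j : ℕ), j ≤ 2 →
      ‖⟪mulL a (u j), v j⟫_ℂ‖ ≤ ‖mulL a‖ * (jetNorm 2 u * jetNorm 2 v) := by
    intro a j hj
    refine (norm_inner_le_norm _ _).trans ?_
    rw [← mul_assoc]
    exact mul_le_mul (((mulL a).le_opNorm _).trans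
      (mul_le_mul_of_nonneg_left (norm_le_jetNorm hj u) (norm_nonneg _))) (norm_le_jetNorm hj v)
      (norm_nonneg _) (mul_nonneg (norm_nonneg _) (jetNorm_nonneg _ _))
  rw [add_mul]
  exact (norm_add_le _ _).trans (add_le_add (key p 2 le_rfl) (key q 1 (by norm_num)))

theorem norm_mulL_four_le (p q : ℝ → ℝ) (u : ℕ → L2) :
    ‖mulL p (u 4)‖ ≤ ‖ellL p q u‖ + ‖mulL (deriv (deriv p))‖ * ‖u 2‖ +
      2 * (‖mulL (deriv p)‖ * ‖u 3‖) + ‖mulL (deriv q)‖ * ‖u 1‖ + ‖mulL q‖ * ‖u 2‖ := by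
  have h4 : mulL p (u 4) = ellL p q u - (mulL (deriv (deriv p)) (u 2) + mulL (deriv p) (u 3)
      + mulL (deriv p) (u 3)) + (mulL (deriv q) (u 1) + mulL q (u 2)) := by
    rw [ellL]
    abel
  rw [h4]
  refine (norm_add_le _ _).trans ?_
  have a1 := norm_sub_le (ellL p q u) (mulL (deriv (deriv p)) (u 2) + mulL (deriv p) (u 3)
      + mulL (deriv p) (u 3))
  have a2 := norm_add₃_le (a := mulL (deriv (deriv p)) (u 2)) (b := mulL (deriv p) (u 3))
      (c := mulL (deriv p) (u 3))
  have a3 := norm_add_le (mulL (deriv q) (u 1)) (mulL q (u 2))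
  have b1 := (mulL (deriv (deriv p))).le_opNorm (u 2)
  have b2 := (mulL (deriv p)).le_opNorm (u 3)
  have b3 := (mulL (deriv q)).le_opNorm (u 1)
  have b4 := (mulL q).le_opNorm (u 2)
  linarith

/-- The third-derivative term is absorbed by interpolation, `A x₃ ≤ (m/2) x₄ + (A²/(2m)) x₂`, which
leaves half of the leading term. -/
theorem fourth_order_inequality {m A : ℝ} (hm0 : 0 < m) (hA0 : 0 ≤ A) {x₂ x₃ x₄ l N : ℝ}
    (h2 : 0 ≤ x₂) (h4 : 0 ≤ x₄) (hl : 0 ≤ l) (h2N : x₂ ≤ N)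
    (h : m * x₄ ≤ l + A * (2 * N) + A * x₃) (h3 : x₃ ^ 2 ≤ x₂ * x₄) :
    x₄ ≤ 2 / m * (1 + 2 * A + A ^ 2 / (2 * m)) * (l + N) ∧ x₃ ≤ x₂ + x₄ := by
  have h6 : A * x₃ ≤ m / 2 * x₄ + A ^ 2 / (2 * m) * x₂ := by
    refine abs_le_of_sq_le_sq' ?_ (by positivity) |>.2
    have e1 : (A * x₃) ^ 2 ≤ A ^ 2 * (x₂ * x₄) := by
      rw [mul_pow]
      exact mul_le_mul_of_nonneg_left h3 (sq_nonneg _)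
    have e2 : (m / 2 * x₄ + A ^ 2 / (2 * m) * x₂) ^ 2 - A ^ 2 * (x₂ * x₄) =
        (m / 2 * x₄ - A ^ 2 / (2 * m) * x₂) ^ 2 := by
      field_simp
      ring
    have := sq_nonneg (m / 2 * x₄ - A ^ 2 / (2 * m) * x₂)
    linarith
  constructor
  · have e1 : A ^ 2 / (2 * m) * x₂ ≤ A ^ 2 / (2 * m) * N :=
      mul_le_mul_of_nonneg_left h2N (by positivity)
    have e2 : m / 2 * x₄ ≤ (1 + 2 * A + A ^ 2 / (2 * m)) * (l + N) := by
      have t1 : 0 ≤ (2 * A + A ^ 2 / (2 * m)) * l := by positivity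
      have t2 : (1 + 2 * A + A ^ 2 / (2 * m)) * (l + N) =
        l + N + A * (2 * N) + A ^ 2 / (2 * m) * N + (2 * A + A ^ 2 / (2 * m)) * l := by ring
      linarith
    have e3 : x₄ = 2 / m * (m / 2 * x₄) := by field_simp
    rw [e3, mul_assoc]
    exact mul_le_mul_of_nonneg_left e2 (by positivity)
  · refine abs_le_of_sq_le_sq' ?_ (by positivity) |>.2
    nlinarith [mul_nonneg h2 h4]

/-- The a priori estimate in `H⁴` for `∂² p ∂² - ∂ q ∂`. -/
theorem exists_jetNorm_four_le {p : ℝ → ℝ} (q : ℝ → ℝ) (hp : BddSmooth p) {m : ℝ} (hm0 : 0 < m)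
    (hm : ∀ x, m ≤ p x) : ∃ C, 0 ≤ C ∧ ∀ u, IsJet 4 u →
      jetNorm 4 u ≤ C * (‖ellL p q u‖ + jetNorm 2 u) := by
  obtain ⟨A₁, hA₁⟩ : ∃ a, a = ‖mulL (deriv (deriv p))‖ := ⟨_, rfl⟩
  obtain ⟨A₂, hA₂⟩ : ∃ a, a = ‖mulL (deriv p)‖ := ⟨_, rfl⟩
  obtain ⟨A₃, hA₃⟩ : ∃ a, a = ‖mulL (deriv q)‖ := ⟨_, rfl⟩
  obtain ⟨A₄, hA₄⟩ : ∃ a, a = ‖mulL q‖ := ⟨_, rfl⟩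
  have hA₁0 : 0 ≤ A₁ := hA₁ ▸ norm_nonneg _
  have hA₂0 : 0 ≤ A₂ := hA₂ ▸ norm_nonneg _
  have hA₃0 : 0 ≤ A₃ := hA₃ ▸ norm_nonneg _
  have hA₄0 : 0 ≤ A₄ := hA₄ ▸ norm_nonneg _
  set A := A₁ + 2 * A₂ + A₃ + A₄ with hA
  have hA0 : 0 ≤ A := by positivity
  set C₁ := 2 / m * (1 + 2 * A + A ^ 2 / (2 * m)) with hC₁
  have hC₁0 : 0 ≤ C₁ := by positivity
  refine ⟨4 + 2 * C₁, by positivity, fun u hu => ?_⟩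
  have n0 := norm_le_jetNorm (show 0 ≤ 2 by norm_num) u
  have n1 := norm_le_jetNorm (show 1 ≤ 2 by norm_num) u
  have n2 := norm_le_jetNorm (le_refl 2) u
  have hN : 0 ≤ jetNorm 2 u := jetNorm_nonneg _ _
  have i3 : ‖u 3‖ ^ 2 ≤ ‖u 2‖ * ‖u 4‖ := hu.norm_sq_le (j := 2) le_rfl
  have h5 := (mul_norm_le_norm_mulL hp hm (u 4)).trans (norm_mulL_four_le p q u)
  rw [← hA₁, ← hA₂, ← hA₃, ← hA₄] at h5
  have p0 := norm_nonneg (u 0)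
  have p1 := norm_nonneg (u 1)
  have p2 := norm_nonneg (u 2)
  have p3 := norm_nonneg (u 3)
  have p4 := norm_nonneg (u 4)
  have pl := norm_nonneg (ellL p q u)
  refine (jetNorm_le_sum 4 u).trans ?_
  simp only [Finset.sum_range_succ, Finset.sum_range_zero, zero_add]
  generalize ‖ellL p q u‖ = l at *
  generalize jetNorm 2 u = N at *
  generalize ‖u 0‖ = x₀ at *
  generalize ‖u 1‖ = x₁ at *
  generalize ‖u 2‖ = x₂ at *
  generalize ‖u 3‖ = x₃ at *
  generalize ‖u 4‖ = x₄ at *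
  have h6 : m * x₄ ≤ l + A * (2 * N) + A * x₃ := by
    have c1 := mul_le_mul_of_nonneg_left n2 hA₁0
    have c3 := mul_le_mul_of_nonneg_left n1 hA₃0
    have c4 := mul_le_mul_of_nonneg_left n2 hA₄0
    have r1 : A * (2 * N) = 2 * (A₁ * N) + 4 * (A₂ * N) + 2 * (A₃ * N) + 2 * (A₄ * N) := by
      rw [hA]
      ring
    have r2 : A * x₃ = A₁ * x₃ + 2 * (A₂ * x₃) + A₃ * x₃ + A₄ * x₃ := by
      rw [hA]
      ring
    have d1 : 0 ≤ A₁ * N := by positivity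
    have d2 : 0 ≤ A₂ * N := by positivity
    have d3 : 0 ≤ A₃ * N := by positivity
    have d4 : 0 ≤ A₄ * N := by positivity
    have d5 : 0 ≤ A₁ * x₃ := by positivity
    have d7 : 0 ≤ A₃ * x₃ := by positivity
    have d8 : 0 ≤ A₄ * x₃ := by positivity
    linarith
  obtain ⟨h7, h8⟩ := fourth_order_inequality hm0 hA0 p2 p4 pl n2 h6 i3
  rw [← hC₁] at h7
  linarith

/-- The elementary inequality behind the resolvent estimates. -/
theorem resolvent_inequality {a K P M₀ : ℝ} (ha : 0 < a) (hK : 0 ≤ K)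
    (hM₀ : 0 < M₀) : ∃ C, 0 ≤ C ∧ ∀ {x y F V b β M : ℝ}, 0 ≤ F → 0 ≤ V →
      0 ≤ b → M₀ ≤ M → 3 / 4 * M ^ 2 * b ≤ F + M * V →
      x ^ 2 + M ^ 2 * β ≤ F * x + M * (P * (y * V)) → a * y ^ 2 ≤ β + K * b ^ 2 →
      x ≤ C * (F + V) ∧ M * y ≤ C * (F + V) := by
  -- In the application `x = ‖Lu‖`, `y = ‖u‖_{H²}`, `b = ‖u‖_{L²}`, `β = B(u,u)`, `M = |μ|`, `F =
  -- ‖f‖` and `V = ‖v‖_{H²}`.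
  set c₁ := 4 / 3 * (1 / M₀ + 1) with hc₁
  set G := 1 / 2 + P ^ 2 / (2 * a) + K * c₁ ^ 2 with hG
  have hG0 : 0 ≤ G := by positivity
  set C := 1 + 2 * G + 2 * G / a with hC
  have hq : 0 ≤ 2 * G / a := by positivity
  have hC1 : 1 ≤ C := by linarith
  refine ⟨C, by linarith, fun {x y F V b β M} hF hV hb hM h1 h2 h3 => ?_⟩
  set S := F + V with hS
  have hS0 : 0 ≤ S := by positivity
  have hM0 : 0 < M := hM₀.trans_le hM
  -- The spectral bound controls `M b`, hence the Gårding error after its multiplication by `M²`.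
  have hMb : M * b ≤ c₁ * S := by
    have e1 : 3 / 4 * (M * b) ≤ F / M + V := by
      have : 3 / 4 * (M * b) = (3 / 4 * M ^ 2 * b) / M := by field_simp
      rw [this, div_le_iff₀ hM0, add_mul, div_mul_cancel₀ _ hM0.ne']
      linarith
    have e2 : F / M ≤ F / M₀ := div_le_div_of_nonneg_left hF hM₀ hM
    have e3 : c₁ * S = 4 / 3 * (F / M₀ + V + V / M₀ + F) := by
      rw [hc₁, hS]
      field_simp
      ring
    have e4 : 0 ≤ V / M₀ := by positivity
    rw [e3]
    linarith
  have hMb2 : (M * b) ^ 2 ≤ (c₁ * S) ^ 2 := pow_le_pow_left₀ (by positivity) hMb 2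
  have hmain : x ^ 2 + a * (M * y) ^ 2 ≤ F * x + P * (M * y) * V + K * (c₁ * S) ^ 2 := by
    have e1 := mul_le_mul_of_nonneg_left h3 (sq_nonneg M)
    have e2 := mul_le_mul_of_nonneg_left hMb2 hK
    have r1 : a * (M * y) ^ 2 = M ^ 2 * (a * y ^ 2) := by ring
    have r2 : M ^ 2 * (β + K * b ^ 2) = M ^ 2 * β + K * (M * b) ^ 2 := by ring
    have r3 : M * (P * (y * V)) = P * (M * y) * V := by ring
    linarith
  have y1 : F * x ≤ 1 / 2 * x ^ 2 + 1 / 2 * F ^ 2 := by linarith [sq_nonneg (F - x)]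
  have y2 : P * (M * y) * V ≤ a / 2 * (M * y) ^ 2 + P ^ 2 / (2 * a) * V ^ 2 := by
    have e : a / 2 * (M * y) ^ 2 + P ^ 2 / (2 * a) * V ^ 2 - P * (M * y) * V =
        (a * (M * y) - P * V) ^ 2 / (2 * a) := by
      field_simp
      ring
    have : 0 ≤ (a * (M * y) - P * V) ^ 2 / (2 * a) := by positivity
    linarith
  have hFS : F ^ 2 ≤ S ^ 2 := pow_le_pow_left₀ hF (by linarith) 2
  have hVS : V ^ 2 ≤ S ^ 2 := pow_le_pow_left₀ hV (by linarith) 2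
  have hfin : 1 / 2 * x ^ 2 + a / 2 * (M * y) ^ 2 ≤ G * S ^ 2 := by
    have e := mul_le_mul_of_nonneg_left hVS (show 0 ≤ P ^ 2 / (2 * a) by positivity)
    have r : G * S ^ 2 = 1 / 2 * S ^ 2 + P ^ 2 / (2 * a) * S ^ 2 + K * (c₁ * S) ^ 2 := by
      rw [hG]
      ring
    linarith
  have hCC : C ≤ C ^ 2 := le_self_pow₀ hC1 two_ne_zero
  have hS2 := sq_nonneg S
  constructor
  · refine abs_le_of_sq_le_sq' ?_ (by positivity) |>.2
    rw [mul_pow]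
    have e1 : 0 ≤ a / 2 * (M * y) ^ 2 := by positivity
    have e2 : 2 * G * S ^ 2 ≤ C ^ 2 * S ^ 2 :=
      mul_le_mul_of_nonneg_right (by linarith) hS2
    linarith
  · refine abs_le_of_sq_le_sq' ?_ (by positivity) |>.2
    rw [mul_pow]
    have e1 : 0 ≤ 1 / 2 * x ^ 2 := by positivity
    have e2 : 2 * G / a * S ^ 2 ≤ C ^ 2 * S ^ 2 :=
      mul_le_mul_of_nonneg_right (by linarith) hS2
    have e3 : (M * y) ^ 2 = 2 / a * (a / 2 * (M * y) ^ 2) := by field_simp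
    have e4 : 2 / a * (a / 2 * (M * y) ^ 2) ≤ 2 / a * (G * S ^ 2) :=
      mul_le_mul_of_nonneg_left (by linarith) (by positivity)
    have e5 : 2 / a * (G * S ^ 2) = 2 * G / a * S ^ 2 := by ring
    linarith

end


/-! ### Invertibility of `L + z` on `L²` and the scalar resolvent estimate. -/

noncomputable section

theorem mulD_toD_toLp {a : ℝ → ℝ} (ha : BddSmooth a) (φ : 𝓢(ℝ, ℂ)) :
    mulD a (toD (φ.toLp 2)) =
      toD ((SchwartzMap.smulLeftCLM ℂ (fun x => (a x : ℂ)) φ).toLp 2) := by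
  rw [← toD_mulL ha]
  congr 1
  refine Lp.ext ?_
  filter_upwards [coeFn_mulL ha (φ.toLp 2), φ.coeFn_toLp 2 volume,
    (SchwartzMap.smulLeftCLM ℂ (fun x => (a x : ℂ)) φ).coeFn_toLp 2 volume] with x h1 h2 h3
  rw [h1, h2, h3, SchwartzMap.smulLeftCLM_apply_apply ha.hasTemperateGrowth_ofReal, smul_eq_mul]

theorem derivCLM_toD_toLp (φ : 𝓢(ℝ, ℂ)) :
    derivCLM ℂ (toD (φ.toLp 2)) = toD ((SchwartzMap.derivCLM ℂ ℂ φ).toLp 2) :=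
  iterate_derivCLM_toD_toLp 1 φ

/-- `∂² p ∂² - ∂ q ∂` on Schwartz functions. -/
def schwartzL (p q : ℝ → ℝ) : 𝓢(ℝ, ℂ) →L[ℂ] 𝓢(ℝ, ℂ) :=
  SchwartzMap.derivCLM ℂ ℂ ∘L SchwartzMap.derivCLM ℂ ℂ ∘L
    SchwartzMap.smulLeftCLM ℂ (fun x => (p x : ℂ)) ∘L SchwartzMap.derivCLM ℂ ℂ ∘L
      SchwartzMap.derivCLM ℂ ℂ -
    SchwartzMap.derivCLM ℂ ℂ ∘L SchwartzMap.smulLeftCLM ℂ (fun x => (q x : ℂ)) ∘L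
      SchwartzMap.derivCLM ℂ ℂ

theorem toLp_sub (φ χ : 𝓢(ℝ, ℂ)) : 
    (φ - χ).toLp 2 (volume : Measure ℝ) = φ.toLp 2 volume - χ.toLp 2 volume :=
  map_sub (SchwartzMap.toLpCLM ℂ ℂ 2 volume) φ χ

theorem opL_toD_toLp {κ c : ℝ} {Q : ℝ → ℝ} (hp : BddSmooth (coeffP c Q))
    (hq : BddSmooth (coeffQ κ c Q)) (φ : 𝓢(ℝ, ℂ)) :
    opL κ c Q (toD (φ.toLp 2)) = toD ((schwartzL (coeffP c Q) (coeffQ κ c Q) φ).toLp 2) := by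
  rw [opL_eq hp]
  simp only [derivCLM_toD_toLp, mulD_toD_toLp hp, mulD_toD_toLp hq]
  rw [← map_sub, ← toLp_sub]
  rfl

theorem opL_apply {κ c : ℝ} {Q : ℝ → ℝ} (hp : BddSmooth (coeffP c Q)) (T : 𝓢'(ℝ, ℂ))
    (φ : 𝓢(ℝ, ℂ)) :
    opL κ c Q T φ = T (schwartzL (coeffP c Q) (coeffQ κ c Q) φ) := by
  rw [opL_eq hp]
  set d : 𝓢(ℝ, ℂ) →L[ℂ] 𝓢(ℝ, ℂ) := SchwartzMap.derivCLM ℂ ℂ with hd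
  set P : 𝓢(ℝ, ℂ) →L[ℂ] 𝓢(ℝ, ℂ) := SchwartzMap.smulLeftCLM ℂ (fun x => (coeffP c Q x : ℂ))
    with hP
  set R : 𝓢(ℝ, ℂ) →L[ℂ] 𝓢(ℝ, ℂ) := SchwartzMap.smulLeftCLM ℂ (fun x => (coeffQ κ c Q x : ℂ))
    with hR
  change T (-d (-d (P (-d (-d φ))))) - T (-d (R (-d φ))) = T (d (d (P (d (d φ)))) - d (R (d φ)))
  simp only [map_neg, map_sub, neg_neg]

theorem toD_star_apply (w : L2) (φ : 𝓢(ℝ, ℂ)) : toD (star w) φ = ⟪w, φ.toLp 2 volume⟫_ℂ := by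
  rw [toD_apply, L2.inner_def]
  refine integral_congr_ae ?_
  filter_upwards [Lp.coeFn_star w, φ.coeFn_toLp 2 volume] with x h1 h2
  rw [h1, h2, RCLike.inner_apply]
  rfl

variable {κ c : ℝ} {Q : ℝ → ℝ}

namespace IsSolitaryWave

/-- Elliptic regularity identifies the maximal domain of `L` in `L²` with `H⁴`, so the range can be
studied without imposing Sobolev conditions. -/
theorem exists_jet_of_opL_eq (hQ : IsSolitaryWave κ c Q) (hκ : 0 < κ) (hc : 2 * κ < c) {f g : L2}
    (h : opL κ c Q (toD f) = toD g) :
    ∃ u, u 0 = f ∧ IsJet 4 u ∧ ellL (coeffP c Q) (coeffQ κ c Q) u = g := by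
  have hp := hQ.bddSmooth_coeffP hκ hc
  have hq := hQ.bddSmooth_coeffQ hκ hc
  have hreg : MemSobolev ((4 : ℕ) : ℝ) 2 (toD f) := by
    refine memSobolev_four_of_elliptic hp hq (hQ.bddSmooth_inv_coeffP hκ hc) (fun x => ?_)
      (memSobolev_toD f) ?_
    · have := hQ.two_mul_le_sub hκ hc x
      exact inv_mul_cancel₀ (by unfold coeffP; linarith)
    · rw [← opL_eq hp, h]
      exact memSobolev_toD g
  obtain ⟨u, rfl, hu⟩ := exists_isJet hreg
  refine ⟨u, rfl, hu, toD_injective ?_⟩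
  rw [toD_ellL hp hq hu, ← opL_eq hp, h]

variable {lam : ℝ}

/-- `L + z` is bounded below when `z` exceeds minus the lowest eigenvalue. -/
theorem norm_le_of_eigenvalue (hQ : IsSolitaryWave κ c Q) (hκ : 0 < κ) (hc : 2 * κ < c)
    (hev : Function.Even Q) (hlam : lam < 0) (heig : IsEigenvalueL κ c Q lam) (z : ℝ)
    {u : ℕ → L2} (hu : IsJet 4 u) :
    (z + lam) * ‖u 0‖ ≤ ‖ellL (coeffP c Q) (coeffQ κ c Q) u + (z : ℂ) • u 0‖ := by
  have hp := hQ.bddSmooth_coeffP hκ hc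
  have hq := hQ.bddSmooth_coeffQ hκ hc
  have hu2 := hu.mono (show 2 ≤ 4 by norm_num)
  have h1 := hQ.le_formB hκ hc hev hlam heig hu2
  rw [← inner_ellL hp hq hu hu2] at h1
  have h2 : (⟪ellL (coeffP c Q) (coeffQ κ c Q) u + (z : ℂ) • u 0, u 0⟫_ℂ).re =
      (⟪ellL (coeffP c Q) (coeffQ κ c Q) u, u 0⟫_ℂ).re + z * ‖u 0‖ ^ 2 := by
    rw [inner_add_left, inner_smul_left, Complex.conj_ofReal, inner_self_eq_norm_sq_to_K,
      Complex.add_re, Complex.re_ofReal_mul]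
    norm_cast
  have h3 : (⟪ellL (coeffP c Q) (coeffQ κ c Q) u + (z : ℂ) • u 0, u 0⟫_ℂ).re ≤ _ :=
    re_inner_le_norm (𝕜 := ℂ) _ _
  by_cases h0 : ‖u 0‖ = 0
  · rw [h0, mul_zero]
    exact norm_nonneg _
  refine le_of_mul_le_mul_right ?_ (lt_of_le_of_ne (norm_nonneg _) (Ne.symm h0))
  rw [h2] at h3
  linarith

/-- The range of `L + z`, with domain the `L²` functions that `L` maps into `L²`. -/
def rangeL (κ c : ℝ) (Q : ℝ → ℝ) (z : ℝ) : Submodule ℂ L2 where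
  carrier := {g | ∃ f : L2, opL κ c Q (toD f) + (z : ℂ) • toD f = toD g}
  add_mem' := by
    rintro g g' ⟨f, hf⟩ ⟨f', hf'⟩
    refine ⟨f + f', ?_⟩
    rw [map_add, map_add, map_add, ← hf, ← hf']
    module
  zero_mem' := ⟨0, by rw [← map_smul toD, smul_zero, map_zero, map_zero, zero_add]⟩
  smul_mem' := by
    rintro a g ⟨f, hf⟩
    refine ⟨a • f, ?_⟩
    rw [map_smul, map_smul, map_smul, ← hf]
    module

theorem norm_le_of_opL_eq (hQ : IsSolitaryWave κ c Q) (hκ : 0 < κ) (hc : 2 * κ < c)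
    (hev : Function.Even Q) (hlam : lam < 0) (heig : IsEigenvalueL κ c Q lam) {z : ℝ}
    {f g : L2} (h : opL κ c Q (toD f) + (z : ℂ) • toD f = toD g) :
    (z + lam) * ‖f‖ ≤ ‖g‖ := by
  have h' : opL κ c Q (toD f) = toD (g - (z : ℂ) • f) := by
    rw [map_sub, map_smul, ← h, add_sub_cancel_right]
  obtain ⟨u, rfl, hu, hLu⟩ := hQ.exists_jet_of_opL_eq hκ hc h'
  have := hQ.norm_le_of_eigenvalue hκ hc hev hlam heig z hu
  rwa [hLu, sub_add_cancel] at this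

/-- The lower bound makes preimages of a convergent sequence Cauchy, and the equation passes to the
limit by continuity of `L` on distributions. -/
theorem isClosed_rangeL (hQ : IsSolitaryWave κ c Q) (hκ : 0 < κ) (hc : 2 * κ < c)
    (hev : Function.Even Q) (hlam : lam < 0) (heig : IsEigenvalueL κ c Q lam) {z : ℝ}
    (hz : 0 < z + lam) : IsClosed (rangeL κ c Q z : Set L2) := by
  refine IsSeqClosed.isClosed fun g y hg hy => ?_
  choose f hf using hg
  have hd : ∀ n m, dist (f n) (f m) ≤ (z + lam)⁻¹ * dist (g n) (g m) := by
    intro n m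
    have e : opL κ c Q (toD (f n - f m)) + (z : ℂ) • toD (f n - f m) = toD (g n - g m) := by
      rw [map_sub, map_sub, map_sub, ← hf n, ← hf m]
      module
    have := hQ.norm_le_of_opL_eq hκ hc hev hlam heig e
    rw [dist_eq_norm, dist_eq_norm, inv_mul_eq_div, le_div_iff₀ hz]
    linarith
  have hcau : CauchySeq f := by
    rw [cauchySeq_iff_tendsto_dist_atTop_0]
    have := (cauchySeq_iff_tendsto_dist_atTop_0.mp hy.cauchySeq).const_mul (z + lam)⁻¹
    rw [mul_zero] at this
    exact squeeze_zero (fun _ => dist_nonneg) (fun nm => hd nm.1 nm.2) this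
  obtain ⟨x, hx⟩ := cauchySeq_tendsto_of_complete hcau
  refine ⟨x, ?_⟩
  have t1 : Tendsto (fun n => toD (f n)) atTop (𝓝 (toD x)) := (toD.continuous.tendsto x).comp hx
  have t2 : Tendsto (fun n => toD (g n)) atTop (𝓝 (toD y)) := (toD.continuous.tendsto y).comp hy
  have t3 : Tendsto (fun n => opL κ c Q (toD (f n)) + (z : ℂ) • toD (f n)) atTop
      (𝓝 (opL κ c Q (toD x) + (z : ℂ) • toD x)) :=
    (((opL κ c Q).continuous.tendsto _).comp t1).add (t1.const_smul _)
  exact tendsto_nhds_unique t3 (t2.congr fun n => (hf n).symm)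

/-- Orthogonality is tested on the images of Schwartz functions. The conjugate appears because
distributions pair bilinearly while the inner product is conjugate linear in `w`; `L` is its own
transpose. -/
theorem opL_star_of_mem_orthogonal (hQ : IsSolitaryWave κ c Q) (hκ : 0 < κ) (hc : 2 * κ < c)
    {z : ℝ} {w : L2} (hw : w ∈ (rangeL κ c Q z)ᗮ) :
    opL κ c Q (toD (star w)) + (z : ℂ) • toD (star w) = toD 0 := by
  have hp := hQ.bddSmooth_coeffP hκ hc
  have hq := hQ.bddSmooth_coeffQ hκ hc
  ext φ
  have hmem : (schwartzL (coeffP c Q) (coeffQ κ c Q) φ).toLp 2 volume + (z : ℂ) • φ.toLp 2 volume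
      ∈ rangeL κ c Q z :=
    ⟨φ.toLp 2 volume, by rw [opL_toD_toLp hp hq, map_add, map_smul]⟩
  have h0 := (Submodule.mem_orthogonal' _ _).mp hw _ hmem
  rw [inner_add_right, inner_smul_right, ← toD_star_apply, ← toD_star_apply, ← opL_apply hp] at h0
  rw [map_zero]
  exact h0

theorem rangeL_eq_top (hQ : IsSolitaryWave κ c Q) (hκ : 0 < κ) (hc : 2 * κ < c)
    (hev : Function.Even Q) (hlam : lam < 0) (heig : IsEigenvalueL κ c Q lam) {z : ℝ}
    (hz : 0 < z + lam) : rangeL κ c Q z = ⊤ := by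
  have : CompleteSpace (rangeL κ c Q z) :=
    (hQ.isClosed_rangeL hκ hc hev hlam heig hz).completeSpace_coe
  refine Submodule.orthogonal_eq_bot_iff.mp ((Submodule.eq_bot_iff _).mpr fun w hw => ?_)
  have hn := hQ.norm_le_of_opL_eq hκ hc hev hlam heig (hQ.opL_star_of_mem_orthogonal hκ hc hw)
  rw [norm_zero] at hn
  have h0 : star w = 0 := norm_le_zero_iff.mp (nonpos_of_mul_nonpos_right hn hz)
  rw [← star_star w, h0]
  refine Lp.ext ?_
  filter_upwards [Lp.coeFn_star (0 : L2), Lp.coeFn_zero ℂ 2 (volume : Measure ℝ)] with x h1 h2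
  rw [h1, Pi.star_apply, h2, Pi.zero_apply, star_zero]

theorem exists_jet_solution (hQ : IsSolitaryWave κ c Q) (hκ : 0 < κ) (hc : 2 * κ < c)
    (hev : Function.Even Q) (hlam : lam < 0) (heig : IsEigenvalueL κ c Q lam) {z : ℝ}
    (hz : 0 < z + lam) (g : L2) :
    ∃ f : L2, opL κ c Q (toD f) + (z : ℂ) • toD f = toD g := by
  have : g ∈ rangeL κ c Q z := by
    rw [hQ.rangeL_eq_top hκ hc hev hlam heig hz]
    trivial
  exact this

/-- The resolvent estimates, in terms of the weak derivatives. -/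
theorem exists_resolvent_bound (hQ : IsSolitaryWave κ c Q) (hκ : 0 < κ) (hc : 2 * κ < c)
    (hev : Function.Even Q) (hlam : lam < 0) (heig : IsEigenvalueL κ c Q lam) :
    ∃ C, 0 ≤ C ∧ ∀ (μ : ℝ) (f : L2) (u v : ℕ → L2), 4 * |lam| ≤ μ ^ 2 → IsJet 4 u → IsJet 2 v →
      ellL (coeffP c Q) (coeffQ κ c Q) u + ((μ ^ 2 : ℝ) : ℂ) • u 0 =
        f + (Complex.I * μ) • v 0 →
      ‖ellL (coeffP c Q) (coeffQ κ c Q) u‖ ≤ C * (‖f‖ + jetNorm 2 v) ∧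
      |μ| * jetNorm 2 u ≤ C * (‖f‖ + jetNorm 2 v) ∧
      jetNorm 4 u ≤ C * (‖f‖ + jetNorm 2 v) := by
  have hp := hQ.bddSmooth_coeffP hκ hc
  have hq := hQ.bddSmooth_coeffQ hκ hc
  have hm : ∀ x, 2 * κ ≤ coeffP c Q x := hQ.two_mul_le_sub hκ hc
  have hm0 : 0 < 2 * κ := by linarith
  obtain ⟨K, hK, hcoer⟩ := exists_coercive (q := coeffQ κ c Q) hp hm0 hm
  obtain ⟨C₄, hC₄, hfour⟩ := exists_jetNorm_four_le (coeffQ κ c Q) hp hm0 hm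
  have hM₀ : 0 < Real.sqrt (4 * |lam|) := Real.sqrt_pos.mpr (by
    have := abs_pos.mpr hlam.ne
    positivity)
  obtain ⟨C, hC, hmain⟩ := resolvent_inequality
    (P := ‖mulL (coeffP c Q)‖ + ‖mulL (coeffQ κ c Q)‖) (show 0 < 2 * κ / 2 by linarith) hK hM₀
  refine ⟨C + C₄ * (C + C / Real.sqrt (4 * |lam|)), by positivity, fun μ f u v hμ hu hv h => ?_⟩
  set ℓ := ellL (coeffP c Q) (coeffQ κ c Q) u with hℓ
  have hu2 := hu.mono (show 2 ≤ 4 by norm_num)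
  have hMμ : Real.sqrt (4 * |lam|) ≤ |μ| :=
    Real.sqrt_le_iff.mpr ⟨abs_nonneg _, by rwa [sq_abs]⟩
  have hv0 := norm_le_jetNorm (show 0 ≤ 2 by norm_num) v
  have hrhs : ‖f + (Complex.I * μ) • v 0‖ ≤ ‖f‖ + |μ| * jetNorm 2 v := by
    refine (norm_add_le _ _).trans (add_le_add_right ?_ _)
    rw [norm_smul, norm_mul, Complex.norm_I, one_mul, Complex.norm_real, Real.norm_eq_abs]
    exact mul_le_mul_of_nonneg_left hv0 (abs_nonneg _)
  -- The threshold `4|λ| ≤ μ²` turns the lower bound `μ² + λ` into `(3/4)μ²`.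
  have h1 : 3 / 4 * |μ| ^ 2 * ‖u 0‖ ≤ ‖f‖ + |μ| * jetNorm 2 v := by
    refine le_trans ?_ hrhs
    rw [← h]
    refine le_trans ?_ (hQ.norm_le_of_eigenvalue hκ hc hev hlam heig (μ ^ 2) hu)
    refine mul_le_mul_of_nonneg_right ?_ (norm_nonneg _)
    rw [abs_of_neg hlam] at hμ
    rw [sq_abs]
    linarith
  -- The equation is paired with `Lu`: the source `iμv` becomes `iμB(u,v)`, with one power of `|μ|`
  -- and only `H²` norms, against `μ²B(u,u)` on the left.
  have h2 : ‖ℓ‖ ^ 2 + |μ| ^ 2 * (formB (coeffP c Q) (coeffQ κ c Q) u u).re ≤ ‖f‖ * ‖ℓ‖ +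
      |μ| * ((‖mulL (coeffP c Q)‖ + ‖mulL (coeffQ κ c Q)‖) * (jetNorm 2 u * jetNorm 2 v)) := by
    have e1 : (⟪ℓ, ℓ + ((μ ^ 2 : ℝ) : ℂ) • u 0⟫_ℂ).re =
        ‖ℓ‖ ^ 2 + |μ| ^ 2 * (formB (coeffP c Q) (coeffQ κ c Q) u u).re := by
      rw [inner_add_right, inner_smul_right, inner_ellL hp hq hu hu2, Complex.add_re,
        Complex.re_ofReal_mul, sq_abs, inner_self_eq_norm_sq_to_K]
      norm_cast
    rw [← e1, h, inner_add_right, inner_smul_right, inner_ellL hp hq hu hv]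
    refine (Complex.re_le_norm _).trans ((norm_add_le _ _).trans (add_le_add ?_ ?_))
    · exact (norm_inner_le_norm _ _).trans_eq (mul_comm _ _)
    · rw [norm_mul, norm_mul, Complex.norm_I, one_mul, Complex.norm_real, Real.norm_eq_abs]
      exact mul_le_mul_of_nonneg_left (norm_formB_le _ _ u v) (abs_nonneg _)
  obtain ⟨b1, b2⟩ := hmain (norm_nonneg f) (jetNorm_nonneg 2 v) (norm_nonneg (u 0)) hMμ h1 h2
    (hcoer u hu2)
  have hS : 0 ≤ ‖f‖ + jetNorm 2 v := add_nonneg (norm_nonneg _) (jetNorm_nonneg _ _)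
  have b3 : jetNorm 2 u ≤ C / Real.sqrt (4 * |lam|) * (‖f‖ + jetNorm 2 v) := by
    rw [div_mul_eq_mul_div, le_div_iff₀ hM₀, mul_comm]
    exact (mul_le_mul_of_nonneg_right hMμ (jetNorm_nonneg _ _)).trans b2
  have b4 : jetNorm 4 u ≤ C₄ * ((C + C / Real.sqrt (4 * |lam|)) * (‖f‖ + jetNorm 2 v)) :=
    (hfour u hu).trans (mul_le_mul_of_nonneg_left (by rw [add_mul]; exact add_le_add b1 b3) hC₄)
  have r1 : 0 ≤ C * (‖f‖ + jetNorm 2 v) := by positivity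
  have r2 : 0 ≤ C₄ * ((C + C / Real.sqrt (4 * |lam|)) * (‖f‖ + jetNorm 2 v)) := by positivity
  rw [add_mul, mul_assoc]
  exact ⟨b1.trans (le_add_of_nonneg_right r2), b2.trans (le_add_of_nonneg_right r2),
    b4.trans (le_add_of_nonneg_left r1)⟩

end IsSolitaryWave

end


/-! ### Parity, and `𝓛` as a map from `Y` to `X`. -/

noncomputable section

/-- Reflection of Schwartz functions. -/
def reflectS : 𝓢(ℝ, ℂ) →L[ℂ] 𝓢(ℝ, ℂ) :=
  SchwartzMap.compCLMOfContinuousLinearEquiv ℂ (ContinuousLinearEquiv.neg ℝ : ℝ ≃L[ℝ] ℝ)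

theorem reflectS_apply (φ : 𝓢(ℝ, ℂ)) (x : ℝ) : reflectS φ x = φ (-x) := rfl

/-- Reflection of distributions. -/
def reflectD : 𝓢'(ℝ, ℂ) →L[ℂ] 𝓢'(ℝ, ℂ) := PointwiseConvergenceCLM.precomp ℂ reflectS

theorem reflectD_apply (T : 𝓢'(ℝ, ℂ)) (φ : 𝓢(ℝ, ℂ)) : reflectD T φ = T (reflectS φ) := rfl

theorem reflectD_derivCLM (T : 𝓢'(ℝ, ℂ)) : reflectD (derivCLM ℂ T) = -derivCLM ℂ (reflectD T) := by
  ext φ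
  change T (-SchwartzMap.derivCLM ℂ ℂ (reflectS φ)) =
    -(T (reflectS (-SchwartzMap.derivCLM ℂ ℂ φ)))
  simp only [map_neg, neg_neg]
  rw [← map_neg T]
  congr 1
  ext x
  have h := deriv_comp_neg φ x
  change -deriv (fun x => φ (-x)) x = deriv φ (-x)
  rw [h, neg_neg]

theorem reflectD_mulD {a : ℝ → ℝ} (ha : BddSmooth a) (hev : ∀ x, a (-x) = a x) (T : 𝓢'(ℝ, ℂ)) :
    reflectD (mulD a T) = mulD a (reflectD T) := by
  ext φ
  rw [reflectD_apply, mulD_apply, mulD_apply, reflectD_apply]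
  congr 1
  ext x
  rw [reflectS_apply, SchwartzMap.smulLeftCLM_apply_apply ha.hasTemperateGrowth_ofReal,
    SchwartzMap.smulLeftCLM_apply_apply ha.hasTemperateGrowth_ofReal, reflectS_apply, hev]

theorem reflectD_toD (f : L2) : reflectD (toD f) = toD (reflect f) := by
  ext φ
  rw [reflectD_apply, toD_apply, toD_apply, ← integral_neg_eq_self]
  refine integral_congr_ae ?_
  filter_upwards [Lp.coeFn_compMeasurePreserving f
    (Measure.measurePreserving_neg (volume : Measure ℝ))] with x hx
  have hx' : reflect f x = f (-x) := hx
  rw [hx', reflectS_apply, neg_neg]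

theorem mem_oddL2_iff_toD (f : L2) : f ∈ oddL2 ↔ reflectD (toD f) = -toD f := by
  rw [reflectD_toD, ← map_neg]
  exact ⟨fun h => congrArg toD h, fun h => toD_injective h⟩

variable {κ c : ℝ} {Q : ℝ → ℝ}

/-- Each derivative changes sign under reflection, each term of `L` has an even number of them, and
the coefficients are even. -/
theorem IsSolitaryWave.reflectD_opL (hQ : IsSolitaryWave κ c Q) (hκ : 0 < κ) (hc : 2 * κ < c)
    (hev : Function.Even Q) (T : 𝓢'(ℝ, ℂ)) :
    reflectD (opL κ c Q T) = opL κ c Q (reflectD T) := by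
  have hp := hQ.bddSmooth_coeffP hκ hc
  have hq := hQ.bddSmooth_coeffQ hκ hc
  rw [opL_eq hp, opL_eq hp, map_sub]
  simp only [reflectD_derivCLM, reflectD_mulD hp (coeffP_even hev),
    reflectD_mulD hq (coeffQ_even hev), map_neg, neg_neg]

theorem HOdd.toDist_eq (k : ℕ) (f : HOdd k) : HOdd.toDist k f = toD (HOdd.toL2 k f) := rfl

theorem HOdd.exists_isJet (k : ℕ) (f : HOdd k) : ∃ u, u 0 = HOdd.toL2 k f ∧ IsJet k u :=
  CHKP.exists_isJet (HOdd.toL2_mem k f).1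

theorem HOdd.norm_eq_jetNorm {k : ℕ} {f : HOdd k} {u : ℕ → L2} (h0 : u 0 = HOdd.toL2 k f)
    (hu : IsJet k u) : ‖f‖ = jetNorm k u := by
  rw [HOdd.norm_eq, jetNorm, ← Fin.sum_univ_eq_sum_range (fun j => ‖u j‖ ^ 2)]
  congr 2
  ext j
  have h1 := HOdd.wderiv_spec k j f
  rw [HOdd.toDist_eq, ← h0, hu.iterate_eq (Nat.lt_succ_iff.mp j.2)] at h1
  rw [toD_injective h1]

theorem HOdd.exists_of_mem {k : ℕ} {f : L2} (hf : f ∈ oddSobolev k) :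
    ∃ F : HOdd k, HOdd.toL2 k F = f :=
  ⟨(⟨f, hf⟩ : oddSobolev k), rfl⟩

/-- This is what makes the domain of the graph operator all of `Y` and not a part of it. -/
theorem IsSolitaryWave.exists_oddL2_eq_opL (hQ : IsSolitaryWave κ c Q) (hκ : 0 < κ)
    (hc : 2 * κ < c) (hev : Function.Even Q) (f : HOdd 4) :
    ∃ g : oddL2, toD g = opL κ c Q (HOdd.toDist 4 f) := by
  have hp := hQ.bddSmooth_coeffP hκ hc
  have hq := hQ.bddSmooth_coeffQ hκ hc
  obtain ⟨u, h0, hu⟩ := f.exists_isJet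
  have h1 : toD (ellL (coeffP c Q) (coeffQ κ c Q) u) = opL κ c Q (HOdd.toDist 4 f) := by
    rw [toD_ellL hp hq hu, ← opL_eq hp, h0, HOdd.toDist_eq]
  refine ⟨⟨ellL (coeffP c Q) (coeffQ κ c Q) u, ?_⟩, h1⟩
  rw [mem_oddL2_iff_toD, h1, hQ.reflectD_opL hκ hc hev, HOdd.toDist_eq,
    (mem_oddL2_iff_toD _).mp (HOdd.toL2_mem 4 f).2, map_neg]

/-- A linear map `ℓ : H⁴_odd → L²_odd` realizing the differential operator `L`. -/
def RealizesL (κ c : ℝ) (Q : ℝ → ℝ) (ℓ : HOdd 4 →ₗ[ℂ] oddL2) : Prop :=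
  ∀ f, toD (ℓ f) = opL κ c Q (HOdd.toDist 4 f)

theorem IsSolitaryWave.exists_realizesL (hQ : IsSolitaryWave κ c Q) (hκ : 0 < κ)
    (hc : 2 * κ < c) (hev : Function.Even Q) : ∃ ℓ, RealizesL κ c Q ℓ := by
  choose ℓ hℓ using hQ.exists_oddL2_eq_opL hκ hc hev
  refine ⟨{ toFun := ℓ, map_add' := fun f g => ?_, map_smul' := fun a f => ?_ }, hℓ⟩
  · apply Subtype.ext
    apply toD_injective
    rw [hℓ, map_add, map_add, ← hℓ, ← hℓ, ← map_add]
    rfl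
  · apply Subtype.ext
    apply toD_injective
    rw [hℓ, map_smul, map_smul, ← hℓ, ← map_smul]
    rfl

/-- The operator `(0, L; 1, 0)` as a map from `Y` to `X`. -/
def blockOp (ℓ : HOdd 4 →ₗ[ℂ] oddL2) : Y →ₗ[ℂ] X where
  toFun Z := WithLp.toLp 1 (ℓ Z.snd, Z.fst)
  map_add' := by
    intro Z Z'
    simp only [WithLp.add_fst, WithLp.add_snd, map_add]
    rfl
  map_smul' := by
    intro a Z
    simp only [WithLp.smul_fst, WithLp.smul_snd, map_smul]
    rfl

theorem mem_graphCurlyL_iff {ℓ : HOdd 4 →ₗ[ℂ] oddL2} (hℓ : RealizesL κ c Q ℓ) (W V : X) :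
    (W, V) ∈ graphCurlyL κ c Q ↔ ∃ Z, inclYX Z = W ∧ blockOp ℓ Z = V := by
  constructor
  · rintro ⟨Z, h1, h2, h3⟩
    refine ⟨Z, h1, ?_⟩
    have e : ℓ Z.snd = V.fst := Subtype.ext (toD_injective ((hℓ _).trans h2.symm))
    exact WithLp.ofLp_injective 1 (Prod.ext e h3.symm)
  · rintro ⟨Z, h1, rfl⟩
    exact ⟨Z, h1, hℓ Z.snd, rfl⟩

theorem curlyL_domain_eq {ℓ : HOdd 4 →ₗ[ℂ] oddL2} (hℓ : RealizesL κ c Q ℓ) :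
    (curlyL κ c Q).domain = LinearMap.range inclYX := by
  ext W
  rw [LinearPMap.mem_domain_iff, graph_curlyL]
  constructor
  · rintro ⟨V, hV⟩
    obtain ⟨Z, h, -⟩ := (mem_graphCurlyL_iff hℓ W V).mp hV
    exact ⟨Z, h⟩
  · rintro ⟨Z, rfl⟩
    exact ⟨blockOp ℓ Z, (mem_graphCurlyL_iff hℓ _ _).mpr ⟨Z, rfl, rfl⟩⟩

theorem curlyL_inclYX {ℓ : HOdd 4 →ₗ[ℂ] oddL2} (hℓ : RealizesL κ c Q ℓ) (Z : Y)
    (h : inclYX Z ∈ (curlyL κ c Q).domain) : curlyL κ c Q ⟨inclYX Z, h⟩ = blockOp ℓ Z := by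
  have h1 : (inclYX Z, curlyL κ c Q ⟨inclYX Z, h⟩) ∈ (curlyL κ c Q).graph :=
    LinearPMap.mem_graph _ ⟨inclYX Z, h⟩
  rw [graph_curlyL] at h1
  obtain ⟨Z', h2, h3⟩ := (mem_graphCurlyL_iff hℓ _ _).mp h1
  rw [← h3, inclYX_injective h2]

end


/-! ### Inverting the block operator `𝓛 - iμ`. -/

noncomputable section

/-- The operator `𝓛 - iμ` as a map from `Y` to `X`. -/
def shiftedOp (ℓ : HOdd 4 →ₗ[ℂ] oddL2) (μ : ℝ) : Y →ₗ[ℂ] X :=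
  blockOp ℓ - (Complex.I * μ) • inclYX

theorem shiftedOp_apply (ℓ : HOdd 4 →ₗ[ℂ] oddL2) (μ : ℝ) (Z : Y) :
    shiftedOp ℓ μ Z = blockOp ℓ Z - (Complex.I * μ) • inclYX Z := rfl

theorem fst_shiftedOp (ℓ : HOdd 4 →ₗ[ℂ] oddL2) (μ : ℝ) (Z : Y) :
    (shiftedOp ℓ μ Z).fst = ℓ Z.snd - (Complex.I * μ) • HOdd.toOddL2 2 Z.fst := rfl

theorem snd_shiftedOp (ℓ : HOdd 4 →ₗ[ℂ] oddL2) (μ : ℝ) (Z : Y) :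
    (shiftedOp ℓ μ Z).snd = Z.fst - (Complex.I * μ) • HOdd.incl 2 4 (by norm_num) Z.snd := rfl

theorem norm_I_mul_ofReal_smul {E : Type*} [NormedAddCommGroup E] [NormedSpace ℂ E] (μ : ℝ)
    (x : E) : ‖(Complex.I * (μ : ℂ)) • x‖ = |μ| * ‖x‖ := by
  rw [norm_smul, norm_mul, Complex.norm_I, one_mul, Complex.norm_real, Real.norm_eq_abs]

variable {κ c : ℝ} {Q : ℝ → ℝ} {ℓ : HOdd 4 →ₗ[ℂ] oddL2}

theorem RealizesL.toD_opL (hℓ : RealizesL κ c Q ℓ) (f : HOdd 4) :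
    opL κ c Q (toD (HOdd.toL2 4 f)) = toD (ℓ f) := (hℓ f).symm

namespace IsSolitaryWave

theorem exists_shiftedOp_bound (hQ : IsSolitaryWave κ c Q) (hκ : 0 < κ) (hc : 2 * κ < c)
    (hev : Function.Even Q) {lam : ℝ} (hlam : lam < 0) (heig : IsEigenvalueL κ c Q lam)
    (hℓ : RealizesL κ c Q ℓ) :
    ∃ C, 0 ≤ C ∧ ∀ (μ : ℝ) (Z : Y), 4 * |lam| ≤ μ ^ 2 →
      ‖Z‖ ≤ C * ‖shiftedOp ℓ μ Z‖ ∧ |μ| * ‖inclYX Z‖ ≤ C * ‖shiftedOp ℓ μ Z‖ := by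
  have hp := hQ.bddSmooth_coeffP hκ hc
  have hq := hQ.bddSmooth_coeffQ hκ hc
  obtain ⟨C, hC, hb⟩ := hQ.exists_resolvent_bound hκ hc hev hlam heig
  refine ⟨1 + 2 * C, by positivity, fun μ Z hμ => ?_⟩
  set V := shiftedOp ℓ μ Z with hV
  obtain ⟨u, hu0, hu⟩ := Z.snd.exists_isJet
  obtain ⟨v, hv0, hv⟩ := V.snd.exists_isJet
  have hell : ellL (coeffP c Q) (coeffQ κ c Q) u = ℓ Z.snd := by
    apply toD_injective
    rw [toD_ellL hp hq hu, ← opL_eq hp, hu0, hℓ.toD_opL]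
  have hV1 : (V.fst : L2) = ℓ Z.snd - (Complex.I * μ) • HOdd.toL2 2 Z.fst :=
    congrArg Subtype.val (fst_shiftedOp ℓ μ Z)
  have hV2 := snd_shiftedOp ℓ μ Z
  rw [← hV] at hV2
  have hv0' : v 0 = HOdd.toL2 2 Z.fst - (Complex.I * μ) • u 0 := by
    rw [hv0, hV2, map_sub, map_smul, HOdd.toL2_incl, hu0]
  have hI : (Complex.I * (μ : ℂ)) * (Complex.I * μ) = -((μ ^ 2 : ℝ) : ℂ) := by
    push_cast
    linear_combination (μ : ℂ) ^ 2 * Complex.I_mul_I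
  -- Elimination of the first component: `LW₂ + μ²W₂ = V₁ + iμV₂`.
  have heq : ellL (coeffP c Q) (coeffQ κ c Q) u + ((μ ^ 2 : ℝ) : ℂ) • u 0
      = (V.fst : L2) + (Complex.I * μ) • v 0 := by
    rw [hell, hV1, hv0', smul_sub, smul_smul, hI]
    module
  obtain ⟨b1, b2, b3⟩ := hb μ V.fst u v hμ hu hv heq
  have hN : ‖(V.fst : L2)‖ + jetNorm 2 v = ‖V‖ := by
    rw [WithLp.prod_norm_eq_of_L1, HOdd.norm_eq_jetNorm hv0 hv]
    rfl
  rw [hN] at b1 b2 b3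
  have n4 : ‖Z.snd‖ = jetNorm 4 u := HOdd.norm_eq_jetNorm hu0 hu
  have n2 : ‖HOdd.incl 2 4 (by norm_num) Z.snd‖ = jetNorm 2 u :=
    HOdd.norm_eq_jetNorm (by rw [HOdd.toL2_incl, hu0]) (hu.mono (by norm_num))
  have hZ1 : Z.fst = V.snd + (Complex.I * μ) • HOdd.incl 2 4 (by norm_num) Z.snd := by
    rw [hV2]; abel
  have hsnd : ‖V.snd‖ ≤ ‖V‖ := by
    rw [WithLp.prod_norm_eq_of_L1]; linarith [norm_nonneg V.fst]
  have hfst : ‖(V.fst : L2)‖ ≤ ‖V‖ := by linarith [jetNorm_nonneg 2 v]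
  have hZ1n : ‖Z.fst‖ ≤ (1 + C) * ‖V‖ := by
    have h := norm_add_le V.snd ((Complex.I * μ) • HOdd.incl 2 4 (by norm_num) Z.snd)
    rw [← hZ1, norm_I_mul_ofReal_smul, n2] at h
    linarith
  -- The second row bounds the first component in `H²` without gain; the gain of `|μ|` in `L²` comes
  -- from the first row, `iμW₁ = LW₂ - V₁`.
  have hZ1l : |μ| * ‖HOdd.toL2 2 Z.fst‖ ≤ (1 + C) * ‖V‖ := by
    have h : (Complex.I * μ) • HOdd.toL2 2 Z.fst
        = ellL (coeffP c Q) (coeffQ κ c Q) u - (V.fst : L2) := by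
      rw [hell, hV1]; abel
    have h' := norm_sub_le (ellL (coeffP c Q) (coeffQ κ c Q) u) (V.fst : L2)
    rw [← h, norm_I_mul_ofReal_smul] at h'
    linarith
  constructor
  · rw [WithLp.prod_norm_eq_of_L1, n4]
    linarith
  · have e : ‖inclYX Z‖ = ‖HOdd.toL2 2 Z.fst‖ + jetNorm 2 u := by
      rw [WithLp.prod_norm_eq_of_L1, ← n2]
      rfl
    rw [e, mul_add]
    linarith

theorem exists_HOdd_solution (hQ : IsSolitaryWave κ c Q) (hκ : 0 < κ) (hc : 2 * κ < c)
    (hev : Function.Even Q) {lam : ℝ} (hlam : lam < 0) (heig : IsEigenvalueL κ c Q lam)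
    (hℓ : RealizesL κ c Q ℓ) {z : ℝ} (hz : 0 < z + lam) (g : oddL2) :
    ∃ F : HOdd 4, ℓ F + (z : ℂ) • HOdd.toOddL2 4 F = g := by
  obtain ⟨f, hf⟩ := hQ.exists_jet_solution hκ hc hev hlam heig hz (g : L2)
  have h1 : opL κ c Q (toD f) = toD ((g : L2) - (z : ℂ) • f) := by
    rw [map_sub, map_smul, ← hf, add_sub_cancel_right]
  obtain ⟨u, hu0, hu, -⟩ := hQ.exists_jet_of_opL_eq hκ hc h1
  -- For odd data, `f` plus its reflection solves the homogeneous equation and so vanishes.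
  have hodd : f ∈ oddL2 := by
    have h2 : opL κ c Q (toD (f + reflect f)) + (z : ℂ) • toD (f + reflect f) = toD (0 : L2) := by
      have h3 := congrArg reflectD hf
      rw [map_add, map_smul, hQ.reflectD_opL hκ hc hev, (mem_oddL2_iff_toD _).mp g.2,
        reflectD_toD] at h3
      rw [map_add, map_add, smul_add, add_add_add_comm, hf, h3, add_neg_cancel, map_zero]
    have h4 := hQ.norm_le_of_opL_eq hκ hc hev hlam heig h2
    rw [norm_zero] at h4
    have h5 : ‖f + reflect f‖ = 0 :=
      le_antisymm (nonpos_of_mul_nonpos_right h4 hz) (norm_nonneg _)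
    exact eq_neg_of_add_eq_zero_right (norm_eq_zero.mp h5)
  have hmem : f ∈ oddSobolev 4 := by
    refine ⟨?_, hodd⟩
    have := hu.memSobolev
    rwa [hu0] at this
  obtain ⟨F, rfl⟩ := HOdd.exists_of_mem hmem
  refine ⟨F, Subtype.ext (toD_injective ?_)⟩
  rw [hℓ.toD_opL, ← map_smul, ← map_add] at hf
  exact hf

theorem shiftedOp_surjective (hQ : IsSolitaryWave κ c Q) (hκ : 0 < κ) (hc : 2 * κ < c)
    (hev : Function.Even Q) {lam : ℝ} (hlam : lam < 0) (heig : IsEigenvalueL κ c Q lam)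
    (hℓ : RealizesL κ c Q ℓ) {μ : ℝ} (hμ : 0 < μ ^ 2 + lam) :
    Function.Surjective (shiftedOp ℓ μ) := by
  intro V
  obtain ⟨F, hF⟩ := hQ.exists_HOdd_solution hκ hc hev hlam heig hℓ hμ
    (V.fst + (Complex.I * μ) • HOdd.toOddL2 2 V.snd)
  refine ⟨WithLp.toLp 1
    (V.snd + (Complex.I * μ) • HOdd.incl 2 4 (by norm_num) F, F), ?_⟩
  refine WithLp.ofLp_injective 1 (Prod.ext ?_ ?_)
  · have e : HOdd.toOddL2 2 (HOdd.incl 2 4 (by norm_num) F) = HOdd.toOddL2 4 F :=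
      Subtype.ext (HOdd.toL2_incl 2 4 (by norm_num) F)
    have hI : (Complex.I * (μ : ℂ)) * (Complex.I * μ) = -((μ ^ 2 : ℝ) : ℂ) := by
      push_cast
      linear_combination (μ : ℂ) ^ 2 * Complex.I_mul_I
    change ℓ F - (Complex.I * μ) •
      HOdd.toOddL2 2 (V.snd + (Complex.I * μ) • HOdd.incl 2 4 (by norm_num) F) = V.fst
    rw [map_add, map_smul, e, smul_add, smul_smul, hI]
    rw [← eq_sub_iff_add_eq] at hF
    rw [hF]
    module
  · change V.snd + (Complex.I * μ) • HOdd.incl 2 4 (by norm_num) F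
      - (Complex.I * μ) • HOdd.incl 2 4 (by norm_num) F = V.snd
    abel

theorem exists_isResolvent (hQ : IsSolitaryWave κ c Q) (hκ : 0 < κ) (hc : 2 * κ < c)
    (hev : Function.Even Q) {lam : ℝ} (hlam : lam < 0) (heig : IsEigenvalueL κ c Q lam) :
    ∃ C, 0 ≤ C ∧ ∀ μ : ℝ, 4 * |lam| ≤ μ ^ 2 → ∃ (R : X →L[ℂ] X) (S : X →L[ℂ] Y),
      IsResolvent (E := X) (curlyL κ c Q) (Complex.I * μ) R ∧ (∀ V, inclYX (S V) = R V) ∧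
        |μ| * ‖R‖ ≤ C ∧ ‖S‖ ≤ C := by
  obtain ⟨ℓ, hℓ⟩ := hQ.exists_realizesL hκ hc hev
  obtain ⟨C, hC, hb⟩ := hQ.exists_shiftedOp_bound hκ hc hev hlam heig hℓ
  refine ⟨C, hC, fun μ hμ => ?_⟩
  have hl : 0 < |lam| := abs_pos.mpr hlam.ne
  have hμ0 : 0 < |μ| := by
    refine abs_pos.mpr fun h => ?_
    rw [h] at hμ
    linarith
  have hinj : Function.Injective (shiftedOp ℓ μ) := by
    rw [injective_iff_map_eq_zero]
    intro Z hZ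
    have h := (hb μ Z hμ).1
    rw [hZ, norm_zero, mul_zero] at h
    exact norm_le_zero_iff.mp h
  have hsurj := hQ.shiftedOp_surjective hκ hc hev hlam heig hℓ (μ := μ) (by
    have := neg_abs_le lam
    linarith)
  let e := LinearEquiv.ofBijective (shiftedOp ℓ μ) ⟨hinj, hsurj⟩
  have he : ∀ V, shiftedOp ℓ μ (e.symm V) = V := e.apply_symm_apply
  have he' : ∀ Z, e.symm (shiftedOp ℓ μ Z) = Z := e.symm_apply_apply
  have hS : ∀ V, ‖e.symm V‖ ≤ C * ‖V‖ := fun V => by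
    have h := (hb μ (e.symm V) hμ).1
    rwa [he] at h
  have hR : ∀ V, ‖inclYX (e.symm V)‖ ≤ C / |μ| * ‖V‖ := fun V => by
    have h := (hb μ (e.symm V) hμ).2
    rw [he] at h
    rwa [div_mul_eq_mul_div, le_div_iff₀ hμ0, mul_comm]
  let S : X →L[ℂ] Y := e.symm.toLinearMap.mkContinuous C hS
  let R : X →L[ℂ] X := (inclYX ∘ₗ e.symm.toLinearMap).mkContinuous (C / |μ|) hR
  refine ⟨R, S, ⟨fun V => ?_, fun W => ?_⟩, fun V => rfl, ?_,
    LinearMap.mkContinuous_norm_le _ hC _⟩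
  · have h : inclYX (e.symm V) ∈ (curlyL κ c Q).domain := by
      rw [curlyL_domain_eq hℓ]
      exact ⟨_, rfl⟩
    refine ⟨h, ?_⟩
    change curlyL κ c Q ⟨inclYX (e.symm V), h⟩ - (Complex.I * μ) • inclYX (e.symm V) = V
    rw [curlyL_inclYX hℓ, ← shiftedOp_apply, he]
  · obtain ⟨W, hW⟩ := W
    have hW' := hW
    rw [curlyL_domain_eq hℓ] at hW'
    obtain ⟨Z, rfl⟩ := hW'
    change inclYX (e.symm (curlyL κ c Q ⟨inclYX Z, hW⟩ - (Complex.I * μ) • inclYX Z)) = inclYX Z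
    rw [curlyL_inclYX hℓ, ← shiftedOp_apply, he']
  · have h := LinearMap.mkContinuous_norm_le (inclYX ∘ₗ e.symm.toLinearMap)
      (div_nonneg hC hμ0.le) hR
    rwa [le_div_iff₀ hμ0, mul_comm] at h

end IsSolitaryWave

/-! ### The Lyapunov-Iooss hypothesis and the conclusion. -/

section Resolvent

variable {E : Type*} [NormedAddCommGroup E] [NormedSpace ℂ E]

theorem IsResolvent.norm_apply_le {A : E →ₗ.[ℂ] E} {μ : ℂ} {R : E →L[ℂ] E}
    (h : IsResolvent A μ R) (V : E) :
    ∃ hV : R V ∈ A.domain, ‖A ⟨R V, hV⟩‖ ≤ (1 + ‖μ‖ * ‖R‖) * ‖V‖ := by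
  obtain ⟨hV, e⟩ := h.1 V
  refine ⟨hV, ?_⟩
  have h1 : ‖A ⟨R V, hV⟩‖ ≤ ‖V‖ + ‖μ • R V‖ := by
    rw [sub_eq_iff_eq_add.mp e]
    exact norm_add_le _ _
  have h2 := mul_le_mul_of_nonneg_left (R.le_opNorm V) (norm_nonneg μ)
  rw [norm_smul] at h1
  linarith

/-- Since `AR = 1 + μR`, the single bound on `|μ|‖R‖` gives both the decay of `‖R‖` and the
boundedness in the graph norm. -/
theorem lyapunovIoossResolventHypothesis_of_bound {A : E →ₗ.[ℂ] E} {ω₀ C : ℝ} (hω : 0 < ω₀)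
    (hC : 0 ≤ C)
    (h : ∀ n : ℤ, 1 < |n| → ∃ R : E →L[ℂ] E, IsResolvent A (Complex.I * n * ω₀) R ∧
      |(n : ℝ) * ω₀| * ‖R‖ ≤ C) : LyapunovIoossResolventHypothesis A ω₀ := by
  choose! R hR hRC using h
  have hev : ∀ᶠ n : ℤ in cofinite, 1 < |n| := by
    rw [eventually_cofinite]
    refine (Set.finite_Icc (-1 : ℤ) 1).subset fun n hn => ?_
    exact abs_le.mp (not_lt.mp hn)
  have hnorm : ∀ n : ℤ, ‖Complex.I * n * (ω₀ : ℂ)‖ = |(n : ℝ) * ω₀| := fun n => by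
    rw [abs_mul]
    simp
  have hb : ∀ n : ℤ, 1 < |n| → ‖R n‖ ≤ C / ω₀ * |(n : ℝ)|⁻¹ := fun n hn => by
    have h1 := hRC n hn
    have hn0 : 0 < |(n : ℝ)| := by exact_mod_cast zero_lt_one.trans hn
    rw [abs_mul, abs_of_pos hω] at h1
    rw [← div_eq_mul_inv, div_div, le_div_iff₀ (by positivity)]
    linarith
  refine ⟨R, hR, ?_, C / ω₀ + (1 + C), ?_⟩
  · have ht : Tendsto (fun n : ℤ => C / ω₀ * |(n : ℝ)|⁻¹) cofinite (𝓝 0) := by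
      have h1 : Tendsto (fun n : ℤ => |(n : ℝ)|) cofinite atTop :=
        (tendsto_norm_cocompact_atTop (E := ℝ)).comp Int.tendsto_coe_cofinite
      simpa using (tendsto_inv_atTop_zero.comp h1).const_mul (C / ω₀)
    exact squeeze_zero' (Eventually.of_forall fun n => norm_nonneg _) (hev.mono hb) ht
  · filter_upwards [hev] with n hn V
    obtain ⟨hV, h1⟩ := (hR n hn).norm_apply_le V
    refine ⟨hV, ?_⟩
    rw [hnorm] at h1
    have hn1 : 1 ≤ |(n : ℝ)| := by exact_mod_cast hn.le
    have h2 : ‖R n‖ ≤ C / ω₀ := (hb n hn).trans <|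
      mul_le_of_le_one_right (by positivity) (inv_le_one_of_one_le₀ hn1)
    have h3 := (R n).le_of_opNorm_le h2 V
    have h4 := mul_le_mul_of_nonneg_right (hRC n hn) (norm_nonneg V)
    linarith

end Resolvent

end

end CHKP

theorem mainTheorem7 (κ c : ℝ) (hκ : 0 < κ) (hc : 2 * κ < c)
    (Q : ℝ → ℝ) (hQ : CHKP.IsSolitaryWave κ c Q) (hQ_even : Function.Even Q)
    (lam : ℝ) (hlam : lam < 0) (hlamL : CHKP.IsEigenvalueL κ c Q lam) :
    (CHKP.curlyL κ c Q).domain = LinearMap.range CHKP.inclYX ∧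
    (∃ C : ℝ, ∀ n : ℤ, 1 < |n| →
      ∃ (R : CHKP.X →L[ℂ] CHKP.X) (S : CHKP.X →L[ℂ] CHKP.Y),
        CHKP.IsResolvent (E := CHKP.X) (CHKP.curlyL κ c Q) (Complex.I * n * Real.sqrt |lam|) R ∧
        (∀ V, CHKP.inclYX (S V) = R V) ∧
        ‖R‖ ≤ C / Real.sqrt |(n : ℝ)| ∧
        ‖S‖ ≤ C) ∧
    CHKP.LyapunovIoossResolventHypothesis (E := CHKP.X) (CHKP.curlyL κ c Q) (Real.sqrt |lam|) := by
  obtain ⟨ℓ, hℓ⟩ := hQ.exists_realizesL hκ hc hQ_even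
  obtain ⟨C, hC, hres⟩ := hQ.exists_isResolvent hκ hc hQ_even hlam hlamL
  have hω : 0 < Real.sqrt |lam| := Real.sqrt_pos.mpr (abs_pos.mpr hlam.ne)
  have key : ∀ n : ℤ, 1 < |n| → ∃ (R : CHKP.X →L[ℂ] CHKP.X) (S : CHKP.X →L[ℂ] CHKP.Y),
      CHKP.IsResolvent (E := CHKP.X) (CHKP.curlyL κ c Q) (Complex.I * n * Real.sqrt |lam|) R ∧
        (∀ V, CHKP.inclYX (S V) = R V) ∧ |(n : ℝ) * (Real.sqrt |lam|)| * ‖R‖ ≤ C ∧ ‖S‖ ≤ C := by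
    intro n hn
    have hn2 : (2 : ℝ) ≤ |(n : ℝ)| := by exact_mod_cast hn
    -- For integers `|n| > 1` means `|n| ≥ 2`, which is exactly the threshold `μ² ≥ 4|λ|`.
    have hμ : 4 * |lam| ≤ ((n : ℝ) * Real.sqrt |lam|) ^ 2 := by
      rw [mul_pow, Real.sq_sqrt (abs_nonneg lam), ← sq_abs (n : ℝ)]
      refine mul_le_mul_of_nonneg_right ?_ (abs_nonneg lam)
      nlinarith
    have h := hres _ hμ
    have e : Complex.I * (((n : ℝ) * Real.sqrt |lam| : ℝ) : ℂ)
        = Complex.I * n * Real.sqrt |lam| := by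
      push_cast
      ring
    rwa [e] at h
  refine ⟨CHKP.curlyL_domain_eq hℓ, ⟨C + C / Real.sqrt |lam|, fun n hn => ?_⟩,
    CHKP.lyapunovIoossResolventHypothesis_of_bound hω hC fun n hn => ?_⟩
  · obtain ⟨R, S, h1, h2, h3, h4⟩ := key n hn
    have hn1 : 1 ≤ |(n : ℝ)| := by exact_mod_cast hn.le
    have hn0 : 0 < |(n : ℝ)| := zero_lt_one.trans_le hn1
    refine ⟨R, S, h1, h2, ?_, h4.trans (le_add_of_nonneg_right (by positivity))⟩
    rw [le_div_iff₀ (Real.sqrt_pos.mpr hn0)]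
    have h5 : ‖R‖ * |(n : ℝ)| ≤ C / Real.sqrt |lam| := by
      rw [le_div_iff₀ hω]
      rw [abs_mul, abs_of_pos hω] at h3
      linarith
    -- The bound proved is of order `1/|n|`; it is weakened here to `1/√|n|`.
    have h6 : Real.sqrt |(n : ℝ)| ≤ |(n : ℝ)| := by
      rw [Real.sqrt_le_left hn0.le]
      nlinarith
    linarith [mul_le_mul_of_nonneg_left h6 (norm_nonneg R)]
  · obtain ⟨R, S, h1, -, h3, -⟩ := key n hn
    exact ⟨R, h1, h3⟩
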